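/- Let $k$ be an algebraically closed field of characteristic $p>0$. Let $X,Y,H$ be the standard basis of $\mathfrak{sl}_2(\mathbb{C})$ (so $[X,Y]=H$, $[H,X]=2X$, $[H,Y]=-2Y$), let $\mathcal{U}_{\mathbb{Z}}$ be the subring of the universal enveloping algebra of $\mathfrak{sl}_2(\mathbb{C})$ generated by all $X^{(m)}=X^m/m!$ and $Y^{(m)}=Y^m/m!$ with $m\ge 0$, and let $\mathcal{U}=\mathcal{U}_{\mathbb{Z}}\otimes_{\mathbb{Z}}k$ be the hyperalgebra of $\mathrm{SL}_2(k)$. With $\binom{H+c}{m}=(H+c)(H+c-1)\cdots(H+c-m+1)/m!$, the elements $Y^{(m)}\binom{H}{n}X^{(m')}$ form a $k$-basis of $\mathcal{U}$; let $\mathrm{Fr}':\mathcal{U}\to\mathcal{U}$ be the $k$-linear map with $Y^{(m)}\binom{H}{n}X^{(m')}\mapsto Y^{(mp)}\binom{H}{np}X^{(m'p)}$. For $a\in\mathbb{Z}$ put $\mu_a=\binom{H-a-1}{p-1}\in\mathcal{U}$. *One pair, $p$ odd.* Let $\mathcal{P}=\{0,\dots,p-1\}\times\{0,1,\dots,(p-1)/2\}$.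 Over $\mathbb{F}_p$ put $\varphi_{a,m}(x)=\prod_{i=0}^{m-1}(x-i(i+a+1))$, $\psi(x)=\prod_{i\in\mathbb{F}_p}(x-i^2)$, $\psi^{(1)}_j(x)=\psi(x)/(x-j^2)$, $\psi^{(0)}_0(x)=\prod_{i\in\mathbb{F}_p^\times}(x-i^2)$ and, for $j\ne0$, $\psi^{(0)}_j(x)=2x(x+j^2)\prod_{i\in\mathbb{F}_p^\times\setminus\{j,-j\}}(x-i^2)$. For $(a,j)\in\mathcal{P}$ and $\varepsilon\in\{0,1\}$ let $$B^{(\varepsilon)}(a,j)=\psi^{(\varepsilon)}_j\Big(\mu_aYX+\big(\tfrac{a+1}{2}\big)^2\Big)\,\mu_a ,$$ and let $n^{(\varepsilon)}(a,j)$ be the largest $n\ge0$ such that $\varphi_{a,n}(x)$ divides $\psi^{(\varepsilon)}_j\big(x+(\frac{a+1}{2})^2\big)$. *One pair, $p=2$.* Let $\mathcal{P}=\{(0,\frac12),(1,0),(1,1)\}$, $B^{(0)}(0,\frac12)=\mu_0$, $B^{(1)}(0,\frac12)=\mu_0YX$, $B^{(0)}(1,0)=B^{(1)}(1,0)=\mu_1YX$,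 $B^{(0)}(1,1)=B^{(1)}(1,1)=\mu_1YX+\mu_1$, and $n^{(0)}(0,\frac12)=0$, $n^{(1)}(0,\frac12)=1$, $n^{(0)}(1,0)=n^{(1)}(1,0)=1$, $n^{(0)}(1,1)=n^{(1)}(1,1)=0$. *The maps $Z$.* For every prime $p$ and $(a,j)\in\mathcal{P}$ there are unique $c^{(\varepsilon)}_m\in\mathbb{F}_p$ with $B^{(\varepsilon)}(a,j)=\mu_a\sum_{m=n^{(\varepsilon)}(a,j)}^{p-1}c^{(\varepsilon)}_mY^mX^m$. Consider the conditions (A) $a$ is even and $(p-a+1)/2\le j\le(p-1)/2$; (C) $a$ is odd and $0\le j\le(a-1)/2$. If (A) or (C) holds, put $s(a,j)=1$ if $p=2$, $s(a,j)=(p-a+1)/2$ if $p$ is odd and $a$ is even, and $s(a,j)=(p-a)/2$ if $p$ and $a$ are odd. For $z\in\mathcal{U}$ let $$Z^{(\varepsilon)}(z;(a,j))=\mu_a\sum_{m=n^{(\varepsilon)}(a,j)}^{p-1}c^{(\varepsilon)}_mY^mX^{m-s(a,j)}\,\mathrm{Fr}'(z)\,X^{s(a,j)}$$ if (A) or (C)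 holds, and $Z^{(\varepsilon)}(z;(a,j))=\mathrm{Fr}'(z)\,B^{(\varepsilon)}(a,j)$ otherwise. *Tuples.* Let $r\ge1$, $(\boldsymbol a,\boldsymbol j)=((a_i,j_i))_{i=0}^{r-1}\in\mathcal{P}^r$ and $\boldsymbol\varepsilon=(\varepsilon_0,\dots,\varepsilon_{r-1})\in\{0,1\}^r$. Put $B^{(\boldsymbol\varepsilon)}(\boldsymbol a,\boldsymbol j)=B^{(\varepsilon_0)}(a_0,j_0)$ if $r=1$, and $$B^{(\boldsymbol\varepsilon)}(\boldsymbol a,\boldsymbol j)=Z^{(\varepsilon_0)}\Big(B^{(\varepsilon_1,\dots,\varepsilon_{r-1})}\big((a_1,\dots,a_{r-1}),(j_1,\dots,j_{r-1})\big);(a_0,j_0)\Big)$$ if $r\ge2$. Let $\mathcal{X}_r(\boldsymbol a,\boldsymbol j)$ be the set of all $\boldsymbol\varepsilon\in\{0,1\}^r$ such that $\varepsilon_i=0$ whenever $j_i=0$ (if $p$ is odd), respectively such that $\varepsilon_i=0$ whenever $a_i=1$ (if $p=2$). **Lemma.** Let $\boldsymbol\varepsilon,\tilde{\boldsymbol\varepsilon}\in\mathcal{X}_r(\boldsymbol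 a,\boldsymbol j)$. If there is an $s$ with $0\le s\le r-1$ and $\varepsilon_s=\tilde\varepsilon_s=1$, then $$B^{(\boldsymbol\varepsilon)}(\boldsymbol a,\boldsymbol j)\,B^{(\tilde{\boldsymbol\varepsilon})}(\boldsymbol a,\boldsymbol j)=0 .$$ Otherwise $$B^{(\boldsymbol\varepsilon)}(\boldsymbol a,\boldsymbol j)\,B^{(\tilde{\boldsymbol\varepsilon})}(\boldsymbol a,\boldsymbol j)=B^{(\boldsymbol\varepsilon+\tilde{\boldsymbol\varepsilon})}(\boldsymbol a,\boldsymbol j),$$ and $\boldsymbol\varepsilon+\tilde{\boldsymbol\varepsilon}$ also lies in $\mathcal{X}_r(\boldsymbol a,\boldsymbol j)$. -/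

import Mathlib

open Polynomial TensorProduct

noncomputable section

namespace Hyperalgebra

/-! ### Integer-valued polynomials -/

/-- The polynomial `(T + c)(T + c - 1) ⋯ (T + c - m + 1) / m!`. -/
def binomPoly (c : ℤ) (m : ℕ) : ℂ[X] :=
  C ((m.factorial : ℂ)⁻¹) * ∏ i ∈ Finset.range m, (X + C ((c : ℂ) - (i : ℂ)))

/-- A complex polynomial taking integer values at the integers. -/
def IntValued (f : ℂ[X]) : Prop := ∀ z : ℤ, ∃ w : ℤ, f.eval (z : ℂ) = (w : ℂ)

theorem binomPoly_eval (c : ℤ) (m : ℕ) (t : ℂ) :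
    (binomPoly c m).eval t =
      ((m.factorial : ℂ)⁻¹) * ∏ i ∈ Finset.range m, (t + ((c : ℂ) - (i : ℂ))) := by
  simp [binomPoly, eval_prod]

theorem binomPoly_eval_int (c : ℤ) (m : ℕ) (z : ℤ) :
    (binomPoly c m).eval (z : ℂ) = (Ring.choose (z + c) m : ℤ) := by
  rw [binomPoly_eval, inv_mul_eq_iff_eq_mul₀ (by exact_mod_cast m.factorial_ne_zero)]
  have h := Ring.descPochhammer_eq_factorial_smul_choose (z + c) m
  rw [← Polynomial.eval_eq_smeval, descPochhammer_eval_eq_prod_range, nsmul_eq_mul] at h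
  have h2 := congrArg (Int.cast : ℤ → ℂ) h
  push_cast at h2
  rw [← h2]
  exact Finset.prod_congr rfl fun i _ => by ring

theorem intValued_binomPoly (c : ℤ) (m : ℕ) : IntValued (binomPoly c m) :=
  fun z => ⟨_, binomPoly_eval_int c m z⟩

theorem IntValued.mul {f g : ℂ[X]} (hf : IntValued f) (hg : IntValued g) :
    IntValued (f * g) := fun z => by
  obtain ⟨u, hu⟩ := hf z
  obtain ⟨v, hv⟩ := hg z
  exact ⟨u * v, by simp [hu, hv]⟩

theorem IntValued.shift {f : ℂ[X]} (hf : IntValued f) (c : ℤ) :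
    IntValued (f.comp (X + C (c : ℂ))) := fun z => by
  obtain ⟨u, hu⟩ := hf (z + c)
  exact ⟨u, by rw [← hu]; simp⟩

theorem binomPoly_natDegree_le (c : ℤ) (m : ℕ) : (binomPoly c m).natDegree ≤ m := by
  refine (natDegree_C_mul_le _ _).trans ((natDegree_prod_le _ _).trans ?_)
  simp only [natDegree_X_add_C]
  simp

/-- An integer-valued polynomial of degree at most `d` is an integral combination of the binomial
polynomials of degree at most `d`. -/
theorem IntValued.exists_sum {f : ℂ[X]} (hf : IntValued f) {d : ℕ} (hd : f.natDegree ≤ d) :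
    ∃ c : ℕ → ℤ, f = ∑ n ∈ Finset.range (d + 1), C (c n : ℂ) * binomPoly 0 n := by
  choose φ hφ using fun n : ℕ => hf n
  refine ⟨fun n => (fwdDiff 1)^[n] φ 0, ?_⟩
  have key : ∀ n : ℕ, n ≤ d → f.eval (n : ℂ) =
      (∑ n ∈ Finset.range (d + 1), C (((fwdDiff 1)^[n] φ 0 : ℤ) : ℂ) * binomPoly 0 n).eval
        (n : ℂ) := by
    intro n hn
    have h1 := shift_eq_sum_fwdDiff_iter 1 φ n 0
    have h2 : f.eval (n : ℂ) = (φ n : ℂ) := by simpa using hφ n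
    rw [h2]
    simp only [smul_eq_mul, mul_one, zero_add] at h1
    rw [h1, eval_finsetSum]
    push_cast
    have h3 : ∀ i : ℕ, (binomPoly 0 i).eval (n : ℂ) = (n.choose i : ℂ) := fun i => by
      have := binomPoly_eval_int 0 i n
      rw [add_zero, Ring.choose_natCast] at this
      simpa using this
    rw [← Finset.sum_subset (Finset.range_mono (Nat.succ_le_succ hn))]
    · exact Finset.sum_congr rfl fun i _ => by simp [h3, mul_comm]
    · intro i _ hi
      have : n < i := by simpa using hi
      simp [h3, Nat.choose_eq_zero_of_lt this]
  refine Polynomial.eq_of_degree_sub_lt_of_eval_finset_eq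
    ((Finset.range (d + 1)).image (Nat.cast : ℕ → ℂ)) ?_ ?_
  · rw [Finset.card_image_of_injective _ Nat.cast_injective, Finset.card_range]
    refine (Polynomial.degree_lt_iff_coeff_zero _ _).2 fun m hm => ?_
    refine coeff_eq_zero_of_natDegree_lt (lt_of_le_of_lt ?_ (Nat.lt_of_succ_le hm))
    refine (natDegree_sub_le _ _).trans (max_le hd (natDegree_sum_le_of_forall_le _ _ ?_))
    intro i hi
    exact (natDegree_C_mul_le _ _).trans ((binomPoly_natDegree_le 0 i).trans
      (by simpa [Nat.lt_succ_iff] using hi))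
  · intro t ht
    obtain ⟨n, hn, rfl⟩ := Finset.mem_image.1 ht
    exact key n (by simpa [Nat.lt_succ_iff] using hn)

theorem binomPoly_zero (c : ℤ) : binomPoly c 0 = 1 := by simp [binomPoly]

theorem binomPoly_succ (c : ℤ) (m : ℕ) :
    C ((m : ℂ) + 1) * binomPoly c (m + 1) = (X + C ((c : ℂ) - m)) * binomPoly c m := by
  have h : ((m : ℂ) + 1) * ((m + 1).factorial : ℂ)⁻¹ = (m.factorial : ℂ)⁻¹ := by
    rw [Nat.factorial_succ]; push_cast
    have : (m : ℂ) + 1 ≠ 0 := by exact_mod_cast m.succ_ne_zero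
    have : (m.factorial : ℂ) ≠ 0 := by exact_mod_cast m.factorial_ne_zero
    field_simp
  rw [binomPoly, binomPoly, Finset.prod_range_succ, ← mul_assoc, ← C_mul, h]
  ring

theorem binomPoly_pascal (c : ℤ) (m : ℕ) :
    binomPoly (c + 1) (m + 1) = binomPoly c (m + 1) + binomPoly c m := by
  refine Polynomial.eq_of_infinite_eval_eq _ _ (Set.infinite_of_injective_forall_mem
    (f := fun n : ℕ => (((n : ℤ) : ℂ))) (fun a b h => by simpa using h) fun n => ?_)
  simp only [Set.mem_ofPred_eq, eval_add, binomPoly_eval_int]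
  rw [← add_assoc, Ring.choose_succ_succ]
  push_cast; ring

/-! ### Commutation formulas for an `sl₂`-triple in an associative algebra -/

section Triple

variable {A : Type*} [Ring A] [Algebra ℂ A]

/-- The divided power `u ^ m / m!`. -/
def divPow (u : A) (m : ℕ) : A := ((m.factorial : ℂ)⁻¹) • u ^ m

/-- The divided power with an integral exponent, which is zero if the exponent is negative. -/
def divPowInt (u : A) (n : ℤ) : A := if 0 ≤ n then divPow u n.toNat else 0

theorem divPow_zero (u : A) : divPow u 0 = 1 := by simp [divPow]

theorem divPow_one (u : A) : divPow u 1 = u := by simp [divPow]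

theorem divPowInt_natCast (u : A) (n : ℕ) : divPowInt u n = divPow u n := by
  simp [divPowInt]

theorem divPowInt_of_neg (u : A) {n : ℤ} (h : n < 0) : divPowInt u n = 0 := by
  simp [divPowInt, not_le.2 h]

theorem inv_factorial_succ (n : ℕ) :
    ((n : ℂ) + 1) * ((n + 1).factorial : ℂ)⁻¹ = (n.factorial : ℂ)⁻¹ := by
  rw [Nat.factorial_succ]; push_cast
  have : (n : ℂ) + 1 ≠ 0 := by exact_mod_cast n.succ_ne_zero
  have : (n.factorial : ℂ) ≠ 0 := by exact_mod_cast n.factorial_ne_zero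
  field_simp

theorem mul_divPow (u : A) (n : ℕ) : u * divPow u n = ((n : ℂ) + 1) • divPow u (n + 1) := by
  rw [divPow, divPow, smul_smul, inv_factorial_succ, pow_succ', mul_smul_comm]

theorem mul_divPowInt (u : A) (n : ℤ) :
    u * divPowInt u n = ((n : ℂ) + 1) • divPowInt u (n + 1) := by
  rcases lt_or_ge n 0 with h | h
  · rw [divPowInt_of_neg u h, mul_zero]
    rcases (show n + 1 < 0 ∨ n = -1 by omega) with h1 | rfl
    · rw [divPowInt_of_neg u h1, smul_zero]
    · simp
  · lift n to ℕ using h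
    rw [show ((n : ℤ) + 1) = ((n + 1 : ℕ) : ℤ) by push_cast; ring, divPowInt_natCast,
      divPowInt_natCast]
    exact_mod_cast mul_divPow u n

theorem divPow_mul (u : A) (m n : ℕ) :
    divPow u m * divPow u n = ((m + n).choose m : ℤ) • divPow u (m + n) := by
  rw [divPow, divPow, divPow, smul_mul_smul_comm, ← pow_add, ← Int.cast_smul_eq_zsmul ℂ, smul_smul]
  congr 1
  have h := Nat.choose_mul_factorial_mul_factorial (Nat.le_add_right m n)
  rw [Nat.add_sub_cancel_left] at h
  have h1 : (((m + n).choose m * m.factorial * n.factorial : ℕ) : ℂ) = ((m + n).factorial : ℕ) := by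
    rw [h]
  push_cast at h1 ⊢
  have : (m.factorial : ℂ) ≠ 0 := by exact_mod_cast m.factorial_ne_zero
  have : (n.factorial : ℂ) ≠ 0 := by exact_mod_cast n.factorial_ne_zero
  have : ((m + n).factorial : ℂ) ≠ 0 := by exact_mod_cast (m + n).factorial_ne_zero
  field_simp
  linear_combination -h1

theorem semiconj_aeval {R S : Type*} [CommRing R] [Ring S] [Algebra R S] {u a b : S}
    (h : SemiconjBy u a b) (f : R[X]) :
    SemiconjBy u (aeval a f) (aeval b f) := by
  induction f using Polynomial.induction_on' with
  | add f g hf hg => simpa using hf.add_right hg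
  | monomial n c =>
    simp only [aeval_monomial]
    exact SemiconjBy.mul_right (Algebra.commutes c u).symm (h.pow_right n)

variable {x y h : A}

theorem aeval_shift (f : ℂ[X]) (c : ℂ) :
    aeval (h + algebraMap ℂ A c) f = aeval h (f.comp (X + C c)) := by
  rw [aeval_comp]; simp

theorem semiconj_pow {u : A} {c : ℂ} (hu : u * h = (h + algebraMap ℂ A c) * u) (n : ℕ) :
    SemiconjBy (u ^ n) h (h + algebraMap ℂ A (c * n)) := by
  induction n with
  | zero => simp
  | succ n ih =>
    have h1 : SemiconjBy u h (h + algebraMap ℂ A c) := hu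
    have h2 := (h1.add_right (Algebra.commutes (c * (n : ℂ)) u).symm).mul_left ih
    have h3 : h + algebraMap ℂ A (c * ((n + 1 : ℕ) : ℂ)) =
        h + algebraMap ℂ A c + algebraMap ℂ A (c * (n : ℂ)) := by
      rw [add_assoc, ← map_add]
      congr 2
      push_cast; ring
    rw [pow_succ', h3]
    exact h2

theorem divPowInt_mul_aeval {u : A} {c : ℂ} (hu : u * h = (h + algebraMap ℂ A c) * u) (n : ℤ)
    (f : ℂ[X]) :
    divPowInt u n * aeval h f = aeval h (f.comp (X + C (c * n))) * divPowInt u n := by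
  rcases lt_or_ge n 0 with h0 | h0
  · simp [divPowInt_of_neg u h0]
  · lift n to ℕ using h0
    rw [divPowInt_natCast, divPow, smul_mul_assoc, mul_smul_comm, ← aeval_shift]
    congr 1
    exact_mod_cast semiconj_aeval (semiconj_pow hu n) f

theorem aeval_mul_divPowInt {u : A} {c : ℂ} (hu : u * h = (h + algebraMap ℂ A c) * u) (n : ℤ)
    (f : ℂ[X]) :
    aeval h f * divPowInt u n = divPowInt u n * aeval h (f.comp (X + C (-(c * n)))) := by
  rw [divPowInt_mul_aeval hu, comp_assoc]
  simp

theorem binomPoly_comp (c d : ℤ) (m : ℕ) :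
    (binomPoly c m).comp (X + C (d : ℂ)) = binomPoly (c + d) m := by
  simp only [binomPoly, mul_comp, C_comp, prod_comp, add_comp, X_comp]
  congr 1
  refine Finset.prod_congr rfl fun i _ => ?_
  rw [add_assoc, ← C_add]
  congr 2
  push_cast; ring

theorem mul_divPowInt_of_triple (hy : y * h = (h + algebraMap ℂ A 2) * y)
    (hxy : x * y = y * x + h) (n : ℤ) :
    x * divPowInt y n =
      divPowInt y n * x + divPowInt y (n - 1) * aeval h (X + C (-(n : ℂ) + 1)) := by
  rcases lt_or_ge n 0 with h0 | h0
  · simp [divPowInt_of_neg y h0, divPowInt_of_neg y (show n - 1 < 0 by omega)]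
  · lift n to ℕ using h0
    induction n with
    | zero => simp [divPowInt, divPow]
    | succ n ih =>
      have e1 : divPowInt y ((n + 1 : ℕ) : ℤ) = ((n : ℂ) + 1)⁻¹ • (y * divPowInt y n) := by
        rw [mul_divPowInt, smul_smul, Int.cast_natCast, inv_mul_cancel₀, one_smul]
        · push_cast; rfl
        · exact_mod_cast n.succ_ne_zero
      have e2 : y * divPowInt y ((n : ℤ) - 1) = (n : ℂ) • divPowInt y n := by
        rw [mul_divPowInt]; simp
      have e3 : h * divPowInt y n = divPowInt y n * aeval h (X + C (-(2 * (n : ℂ)))) := by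
        have := aeval_mul_divPowInt hy n X
        simpa using this
      have e4 : x * (y * divPowInt y n) = (y * divPowInt y n) * x +
          ((n : ℂ) + 1) • (divPowInt y n * aeval h (X + C (-(n : ℂ)))) := by
        rw [← mul_assoc, hxy, add_mul, e3, mul_assoc, ih, mul_add, ← mul_assoc, ← mul_assoc, e2,
          smul_mul_assoc, add_assoc, ← mul_smul_comm, ← mul_add, ← mul_smul_comm]
        congr 2
        rw [← map_smul, ← map_smul, ← map_add]
        congr 1
        simp only [smul_eq_C_mul, C_neg, C_add, C_mul, Int.cast_natCast]
        simp only [C_1, C_ofNat]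
        ring
      rw [e1, mul_smul_comm, e4, smul_add, smul_smul, inv_mul_cancel₀, one_smul, smul_mul_assoc]
      · push_cast; simp
      · exact_mod_cast n.succ_ne_zero

/-- Kostant's formula for `x ^ (r) * y ^ (s)`. -/
theorem divPow_mul_divPow (hx : x * h = (h + algebraMap ℂ A (-2)) * x)
    (hy : y * h = (h + algebraMap ℂ A 2) * y) (hxy : x * y = y * x + h) (r : ℕ) (s : ℤ) :
    divPowInt x r * divPowInt y s = ∑ k ∈ Finset.range (r + 1),
      divPowInt y (s - k) * aeval h (binomPoly (2 * k - r - s) k) * divPowInt x (r - k) := by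
  induction r with
  | zero => simp [divPowInt, divPow, binomPoly_zero]
  | succ r ih =>
    have hr : ((r : ℂ) + 1) ≠ 0 := by exact_mod_cast r.succ_ne_zero
    have e1 : divPowInt x ((r + 1 : ℕ) : ℤ) = ((r : ℂ) + 1)⁻¹ • (x * divPowInt x r) := by
      rw [mul_divPowInt, smul_smul, Int.cast_natCast, inv_mul_cancel₀ hr, one_smul]
      push_cast; rfl
    let P : ℕ → A := fun k => divPowInt y (s - k) *
      aeval h (C ((r : ℂ) - k + 1) * binomPoly (2 * k - r - s - 2) k) * divPowInt x (r + 1 - k)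
    let Q : ℕ → A := fun k => divPowInt y (s - k - 1) *
      aeval h ((X + C ((k : ℂ) + 1 - s)) * binomPoly (2 * k - r - s) k) * divPowInt x (r - k)
    have e2 : ∀ k : ℕ, x * (divPowInt y (s - k) * aeval h (binomPoly (2 * k - r - s) k) *
        divPowInt x (r - k)) = P k + Q k := by
      intro k
      have f1 : x * aeval h (binomPoly (2 * k - r - s) k) =
          aeval h (binomPoly (2 * k - r - s - 2) k) * x := by
        have := divPowInt_mul_aeval hx 1 (binomPoly (2 * k - r - s) k)
        have h1 : divPowInt x 1 = x := by simp [divPowInt, divPow]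
        rw [h1] at this
        rw [this, sub_eq_add_neg _ (2 : ℤ), ← binomPoly_comp]
        simp
      have f2 : x * divPowInt x (r - k) = ((r : ℂ) - k + 1) • divPowInt x (r + 1 - k) := by
        rw [mul_divPowInt]; push_cast
        rw [show (r : ℤ) - k + 1 = r + 1 - k by ring]
      rw [← mul_assoc, ← mul_assoc, mul_divPowInt_of_triple hy hxy, add_mul, add_mul]
      congr 1
      · simp only [P]
        rw [mul_assoc _ x, f1, mul_assoc, mul_assoc _ x, f2, map_mul, aeval_C, mul_smul_comm,
          mul_smul_comm, mul_assoc, mul_assoc (algebraMap ℂ A _), ← Algebra.smul_def,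
          mul_smul_comm]
      · simp only [Q, map_mul]
        rw [mul_assoc (divPowInt y _)]
        push_cast
        rw [show -((s : ℂ) - k) + 1 = (k : ℂ) + 1 - s by ring]
    have e3 : P (r + 1) = 0 := by simp [P]
    rw [e1, smul_mul_assoc, mul_assoc, ih, Finset.mul_sum, Finset.sum_congr rfl fun k _ => e2 k,
      Finset.sum_add_distrib, ← add_zero (∑ k ∈ _, P k), ← e3, ← Finset.sum_range_succ,
      inv_smul_eq_iff₀ hr, Finset.sum_range_succ' P,
      Finset.sum_range_succ' _ (r + 1), smul_add,
      add_right_comm, ← Finset.sum_add_distrib, Finset.smul_sum]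
    congr 1
    · refine Finset.sum_congr rfl fun m _ => ?_
      simp only [P, Q]
      push_cast
      rw [show s - ((m : ℤ) + 1) = s - m - 1 by ring,
        show (r : ℤ) + 1 - ((m : ℤ) + 1) = r - m by ring,
        show (2 * ((m : ℤ) + 1) - r - s - 2) = 2 * m - r - s by ring,
        show (2 * ((m : ℤ) + 1) - (r + 1) - s) = (2 * m - r - s) + 1 by ring,
        ← add_mul, ← mul_add, ← map_add, ← smul_mul_assoc, ← mul_smul_comm, ← map_smul]
      congr 3
      have g1 := binomPoly_succ (2 * m - r - s) m
      rw [binomPoly_pascal, smul_eq_C_mul]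
      push_cast at g1 ⊢
      simp only [map_sub, map_add, map_mul, map_natCast, map_intCast, map_one, map_ofNat] at g1 ⊢
      linear_combination -g1
    · simp only [P]
      simp only [Nat.cast_zero, sub_zero, binomPoly_zero, map_one, mul_one, aeval_C,
        Algebra.smul_def]
      rw [← mul_assoc, Algebra.commutes]
      push_cast; rfl

end Triple

/-! ### The Kostant form -/

/-- The Lie algebra `sl₂(ℂ)`. -/
abbrev SL2 : Type := LieAlgebra.SpecialLinear.sl (Fin 2) ℂ

/-- The matrix `X` with rows `(0, 1)` and `(0, 0)`. -/
def matX : SL2 := ⟨!![0, 1; 0, 0], by simp [LieAlgebra.SpecialLinear.sl]⟩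

/-- The matrix `Y` with rows `(0, 0)` and `(1, 0)`. -/
def matY : SL2 := ⟨!![0, 0; 1, 0], by simp [LieAlgebra.SpecialLinear.sl]⟩

/-- The matrix `H` with rows `(1, 0)` and `(0, -1)`. -/
def matH : SL2 := ⟨!![1, 0; 0, -1], by simp [LieAlgebra.SpecialLinear.sl]⟩

/-- The universal enveloping algebra of `sl₂(ℂ)`. -/
abbrev UC : Type := UniversalEnvelopingAlgebra ℂ SL2

/-- `X` in the universal enveloping algebra. -/
def genX : UC := UniversalEnvelopingAlgebra.ι ℂ matX

/-- `Y` in the universal enveloping algebra. -/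
def genY : UC := UniversalEnvelopingAlgebra.ι ℂ matY

/-- `H` in the universal enveloping algebra. -/
def genH : UC := UniversalEnvelopingAlgebra.ι ℂ matH

section
attribute [local instance 100] LieRing.ofAssociativeRing

theorem lie_matX_matY : ⁅matX, matY⁆ = matH := by
  apply Subtype.ext
  rw [LieAlgebra.SpecialLinear.sl_bracket]
  ext i j
  fin_cases i <;> fin_cases j <;> simp [matX, matY, matH]

theorem lie_matH_matX : ⁅matH, matX⁆ = (2 : ℂ) • matX := by
  apply Subtype.ext
  rw [LieAlgebra.SpecialLinear.sl_bracket]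
  ext i j
  fin_cases i <;> fin_cases j <;> simp [matX, matH]
  norm_num

theorem lie_matH_matY : ⁅matH, matY⁆ = (-2 : ℂ) • matY := by
  apply Subtype.ext
  rw [LieAlgebra.SpecialLinear.sl_bracket]
  ext i j
  fin_cases i <;> fin_cases j <;> simp [matY, matH]
  norm_num

theorem genX_mul_genY : genX * genY = genY * genX + genH := by
  have h := LieHom.map_lie (UniversalEnvelopingAlgebra.ι ℂ) matX matY
  rw [lie_matX_matY, LieRing.of_associative_ring_bracket] at h
  exact (add_eq_of_eq_sub' h).symm

theorem genX_mul_genH : genX * genH = (genH + algebraMap ℂ UC (-2)) * genX := by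
  have h := LieHom.map_lie (UniversalEnvelopingAlgebra.ι ℂ) matH matX
  rw [lie_matH_matX, LieRing.of_associative_ring_bracket, map_smul] at h
  have h' : (2 : ℂ) • genX = genH * genX - genX * genH := h
  rw [add_mul, ← Algebra.smul_def, neg_smul, h']
  abel

theorem genY_mul_genH : genY * genH = (genH + algebraMap ℂ UC 2) * genY := by
  have h := LieHom.map_lie (UniversalEnvelopingAlgebra.ι ℂ) matH matY
  rw [lie_matH_matY, LieRing.of_associative_ring_bracket, map_smul] at h
  have h' : (-2 : ℂ) • genY = genH * genY - genY * genH := h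
  rw [add_mul, ← Algebra.smul_def, ← neg_neg ((2 : ℂ) • genY), ← neg_smul, h']
  abel

end

/-- The element `(H + c)(H + c - 1) ⋯ (H + c - m + 1) / m!`. -/
def binomH (c : ℤ) (m : ℕ) : UC := aeval genH (binomPoly c m)

/-- The subring of the enveloping algebra generated by all `X ^ m / m!` and `Y ^ m / m!`. -/
def UZ : Subring UC := Subring.closure (Set.range (divPow genX) ∪ Set.range (divPow genY))

theorem divPow_genX_mem (m : ℕ) : divPow genX m ∈ UZ :=
  Subring.subset_closure (Or.inl ⟨m, rfl⟩)

theorem divPow_genY_mem (m : ℕ) : divPow genY m ∈ UZ :=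
  Subring.subset_closure (Or.inr ⟨m, rfl⟩)

theorem divPowInt_mem {u : UC} (hu : ∀ m, divPow u m ∈ UZ) (n : ℤ) : divPowInt u n ∈ UZ := by
  unfold divPowInt
  split_ifs
  · exact hu _
  · exact UZ.zero_mem

theorem aeval_genH_eq_sum (d : ℕ) (c : ℕ → ℤ) :
    aeval genH (∑ n ∈ Finset.range (d + 1), C (c n : ℂ) * binomPoly 0 n) =
      ∑ n ∈ Finset.range (d + 1), c n • binomH 0 n := by
  rw [map_sum]
  refine Finset.sum_congr rfl fun n _ => ?_
  rw [map_mul, aeval_C, ← Algebra.smul_def, Int.cast_smul_eq_zsmul, binomH]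

theorem binomH_zero_mem (n : ℕ) : binomH 0 n ∈ UZ := by
  induction n using Nat.strong_induction_on with
  | _ n ih =>
    have h := divPow_mul_divPow genX_mul_genH genY_mul_genH genX_mul_genY n n
    rw [Finset.sum_range_succ] at h
    have h1 : divPowInt genY ((n : ℤ) - n) * aeval genH (binomPoly (2 * n - n - n) n) *
        divPowInt genX ((n : ℤ) - n) = binomH 0 n := by
      rw [sub_self, show (2 * (n : ℤ) - n - n) = 0 by ring]
      simp [divPowInt, divPow, binomH]
    rw [h1] at h
    rw [← sub_eq_iff_eq_add'.2 h]
    refine UZ.sub_mem (UZ.mul_mem (divPowInt_mem divPow_genX_mem _)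
      (divPowInt_mem divPow_genY_mem _)) (UZ.sum_mem fun k hk => ?_)
    refine UZ.mul_mem (UZ.mul_mem (divPowInt_mem divPow_genY_mem _) ?_)
      (divPowInt_mem divPow_genX_mem _)
    obtain ⟨c, hc⟩ := (intValued_binomPoly (2 * k - n - n) k).exists_sum
      (binomPoly_natDegree_le _ _)
    rw [hc, aeval_genH_eq_sum]
    refine UZ.sum_mem fun i hi => UZ.zsmul_mem (ih i ?_) _
    simp only [Finset.mem_range] at hi hk
    omega

theorem aeval_genH_mem {f : ℂ[X]} (hf : IntValued f) : aeval genH f ∈ UZ := by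
  obtain ⟨c, hc⟩ := hf.exists_sum le_rfl
  rw [hc, aeval_genH_eq_sum]
  exact UZ.sum_mem fun i _ => UZ.zsmul_mem (binomH_zero_mem i) _

theorem binomH_mem (c : ℤ) (n : ℕ) : binomH c n ∈ UZ :=
  aeval_genH_mem (intValued_binomPoly c n)

/-- `X ^ (m)` in the integral form. -/
def intX (m : ℕ) : UZ := ⟨divPow genX m, divPow_genX_mem m⟩

/-- `Y ^ (m)` in the integral form. -/
def intY (m : ℕ) : UZ := ⟨divPow genY m, divPow_genY_mem m⟩

/-- `binom(H + c, m)` in the integral form. -/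
def intH (c : ℤ) (m : ℕ) : UZ := ⟨binomH c m, binomH_mem c m⟩

/-- The element `Y ^ (m) * binom(H, n) * X ^ (l)` of the integral form, for `i = (m, n, l)`. -/
def intMono (i : ℕ × ℕ × ℕ) : UZ := intY i.1 * intH 0 i.2.1 * intX i.2.2

/-- The `ℤ`-span of the elements `Y ^ (m) * binom(H, n) * X ^ (l)`. -/
def monoSpan : Submodule ℤ UC := Submodule.span ℤ (Set.range fun i => (intMono i : UC))

theorem mem_monoSpan_aux {f : ℂ[X]} (hf : IntValued f) (m l : ℕ) :
    divPow genY m * aeval genH f * divPow genX l ∈ monoSpan := by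
  obtain ⟨c, hc⟩ := hf.exists_sum le_rfl
  rw [hc, aeval_genH_eq_sum, Finset.mul_sum, Finset.sum_mul]
  refine Submodule.sum_mem _ fun n _ => ?_
  rw [mul_smul_comm, smul_mul_assoc]
  exact Submodule.smul_mem _ _ (Submodule.subset_span ⟨(m, n, l), rfl⟩)

theorem mul_mem_monoSpan {u : UC} (hu : ∀ i, u * (intMono i : UC) ∈ monoSpan) {w : UC}
    (hw : w ∈ monoSpan) : u * w ∈ monoSpan := by
  induction hw using Submodule.span_induction with
  | mem w h => obtain ⟨i, rfl⟩ := h; exact hu i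
  | zero => simp
  | add a b _ _ ha hb => rw [mul_add]; exact Submodule.add_mem _ ha hb
  | smul c a _ ha => rw [mul_smul_comm]; exact Submodule.smul_mem _ _ ha

theorem divPow_genY_mul_mem (r : ℕ) (i : ℕ × ℕ × ℕ) :
    divPow genY r * (intMono i : UC) ∈ monoSpan := by
  change divPow genY r * (divPow genY i.1 * binomH 0 i.2.1 * divPow genX i.2.2) ∈ monoSpan
  rw [← mul_assoc, ← mul_assoc, divPow_mul, smul_mul_assoc, smul_mul_assoc]
  exact Submodule.smul_mem _ _ (mem_monoSpan_aux (intValued_binomPoly 0 i.2.1) _ _)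

theorem divPow_genX_mul_mem (r : ℕ) (i : ℕ × ℕ × ℕ) :
    divPow genX r * (intMono i : UC) ∈ monoSpan := by
  obtain ⟨s, n, l⟩ := i
  change divPow genX r * (divPow genY s * binomH 0 n * divPow genX l) ∈ monoSpan
  rw [← mul_assoc, ← mul_assoc, ← divPowInt_natCast genX r, ← divPowInt_natCast genY s,
    divPow_mul_divPow genX_mul_genH genY_mul_genH genX_mul_genY, Finset.sum_mul, Finset.sum_mul]
  refine Submodule.sum_mem _ fun k hk => ?_
  rw [mul_assoc _ _ (binomH 0 n), binomH, divPowInt_mul_aeval genX_mul_genH,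
    ← mul_assoc, mul_assoc _ (aeval genH _) (aeval genH _), ← map_mul]
  have hk' : k ≤ r := by simpa [Nat.lt_succ_iff] using hk
  rw [show (r : ℤ) - k = ((r - k : ℕ) : ℤ) by omega, divPowInt_natCast, mul_assoc _ _ (divPow _ l),
    divPow_mul, mul_smul_comm]
  refine Submodule.smul_mem _ _ ?_
  rcases lt_or_ge ((s : ℤ) - k) 0 with h0 | h0
  · simp [divPowInt_of_neg _ h0]
  · rw [show (s : ℤ) - k = ((s - k : ℕ) : ℤ) by omega, divPowInt_natCast]
    refine mem_monoSpan_aux ((intValued_binomPoly _ _).mul ?_) _ _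
    have := (intValued_binomPoly 0 n).shift (-2 * ((r - k : ℕ) : ℤ))
    push_cast at this ⊢
    exact this

theorem mem_monoSpan_of_mem_UZ {u : UC} (hu : u ∈ UZ) : u ∈ monoSpan := by
  have key : ∀ w ∈ monoSpan, u * w ∈ monoSpan := by
    induction hu using Subring.closure_induction with
    | mem u h =>
      rcases h with ⟨m, rfl⟩ | ⟨m, rfl⟩
      · exact fun w hw => mul_mem_monoSpan (divPow_genX_mul_mem m) hw
      · exact fun w hw => mul_mem_monoSpan (divPow_genY_mul_mem m) hw
    | zero => simp
    | one => simp
    | add a b _ _ ha hb =>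
      exact fun w hw => by rw [add_mul]; exact Submodule.add_mem _ (ha w hw) (hb w hw)
    | neg a _ ha => exact fun w hw => by rw [neg_mul]; exact Submodule.neg_mem _ (ha w hw)
    | mul a b _ _ ha hb => exact fun w hw => by rw [mul_assoc]; exact ha _ (hb w hw)
  have h1 : (1 : UC) ∈ monoSpan := by
    have := mem_monoSpan_aux (intValued_binomPoly 0 0) 0 0
    simpa [divPow_zero, binomPoly_zero] using this
  simpa using key 1 h1

theorem span_intMono : ⊤ ≤ Submodule.span ℤ (Set.range intMono) := by
  rintro ⟨u, hu⟩ -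
  have h := mem_monoSpan_of_mem_UZ hu
  have h2 : monoSpan = (Submodule.span ℤ (Set.range intMono)).map
      (UZ.subtype.toAddMonoidHom.toIntLinearMap) := by
    rw [Submodule.map_span, ← Set.range_comp]; rfl
  rw [h2] at h
  obtain ⟨v, hv, hvu⟩ := h
  have : v = ⟨u, hu⟩ := Subtype.ext hvu
  exact this ▸ hv


/-! ### Linear independence, by means of the generic Verma module -/

/-- The underlying module of the generic Verma module. -/
abbrev Verma : Type := ℕ →₀ ℂ[X]

/-- The action of `X` on the generic Verma module. -/
def opX : Module.End ℂ[X] Verma :=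
  Finsupp.linearCombination ℂ[X] fun i => Finsupp.single (i - 1) ((i : ℂ[X]) * (X - (i : ℂ[X]) + 1))

/-- The action of `Y` on the generic Verma module. -/
def opY : Module.End ℂ[X] Verma :=
  Finsupp.linearCombination ℂ[X] fun i => Finsupp.single (i + 1) 1

/-- The action of `H` on the generic Verma module. -/
def opH : Module.End ℂ[X] Verma :=
  Finsupp.linearCombination ℂ[X] fun i => Finsupp.single i (X - 2 * (i : ℂ[X]))

theorem opX_single (i : ℕ) (g : ℂ[X]) : opX (Finsupp.single i g) =
    Finsupp.single (i - 1) (g * ((i : ℂ[X]) * (X - (i : ℂ[X]) + 1))) := by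
  rw [opX, Finsupp.linearCombination_single, Finsupp.smul_single, smul_eq_mul]

theorem opY_single (i : ℕ) (g : ℂ[X]) : opY (Finsupp.single i g) = Finsupp.single (i + 1) g := by
  simp [opY, Finsupp.linearCombination_single]

theorem opH_single (i : ℕ) (g : ℂ[X]) : opH (Finsupp.single i g) =
    Finsupp.single i (g * (X - 2 * (i : ℂ[X]))) := by
  rw [opH, Finsupp.linearCombination_single, Finsupp.smul_single, smul_eq_mul]

theorem opX_opY : opX * opY - opY * opX = opH := by
  refine Finsupp.lhom_ext fun i g => ?_
  simp only [LinearMap.sub_apply, Module.End.mul_apply, opX_single, opY_single, opH_single]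
  rcases i with _ | i
  · simp
  · simp only [Nat.add_sub_cancel, ← Finsupp.single_sub]
    congr 1
    push_cast; ring

theorem opH_opX : opH * opX - opX * opH = (2 : ℂ) • opX := by
  refine Finsupp.lhom_ext fun i g => ?_
  simp only [LinearMap.sub_apply, Module.End.mul_apply, opX_single, opH_single,
    LinearMap.smul_apply, Finsupp.smul_single]
  rcases i with _ | i
  · simp
  · simp only [Nat.add_sub_cancel, ← Finsupp.single_sub, smul_eq_C_mul, C_ofNat]
    congr 1
    push_cast; ring

theorem opH_opY : opH * opY - opY * opH = (-2 : ℂ) • opY := by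
  refine Finsupp.lhom_ext fun i g => ?_
  simp only [LinearMap.sub_apply, Module.End.mul_apply, opY_single, opH_single,
    LinearMap.smul_apply, Finsupp.smul_single, ← Finsupp.single_sub, smul_eq_C_mul, C_neg, C_ofNat]
  congr 1
  push_cast; ring

section
attribute [local instance 100] LieRing.ofAssociativeRing

theorem sl_apply_one_one (M : SL2) : M.val 1 1 = -M.val 0 0 := by
  have h : Matrix.trace M.val = 0 := M.2
  rw [Matrix.trace_fin_two] at h
  linear_combination h

/-- The generic Verma module as a representation of `sl₂(ℂ)`. -/
def vermaLie : SL2 →ₗ⁅ℂ⁆ Module.End ℂ[X] Verma where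
  toFun M := M.val 0 1 • opX + M.val 1 0 • opY + M.val 0 0 • opH
  map_add' M N := by simp [add_smul]; abel
  map_smul' c M := by simp [mul_smul, smul_add]
  map_lie' {M N} := by
    rw [LieRing.of_associative_ring_bracket, LieAlgebra.SpecialLinear.sl_bracket]
    simp only [Matrix.sub_apply, Matrix.mul_apply, Fin.sum_univ_two, sl_apply_one_one]
    have e1 : opX * opY = opH + opY * opX := by rw [← opX_opY]; abel
    have e2 : opH * opX = (2 : ℂ) • opX + opX * opH := by rw [← opH_opX]; abel
    have e3 : opH * opY = (-2 : ℂ) • opY + opY * opH := by rw [← opH_opY]; abel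
    simp only [mul_add, add_mul, smul_mul_smul_comm, e1, e2, e3, smul_add, smul_smul]
    module

/-- The generic Verma module as a representation of the enveloping algebra. -/
def vermaRep : UC →ₐ[ℂ] Module.End ℂ[X] Verma := UniversalEnvelopingAlgebra.lift ℂ vermaLie

theorem vermaRep_genX : vermaRep genX = opX := by
  rw [vermaRep, genX, UniversalEnvelopingAlgebra.lift_ι_apply]
  simp [vermaLie, matX]

theorem vermaRep_genY : vermaRep genY = opY := by
  rw [vermaRep, genY, UniversalEnvelopingAlgebra.lift_ι_apply]
  simp [vermaLie, matY]

theorem vermaRep_genH : vermaRep genH = opH := by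
  rw [vermaRep, genH, UniversalEnvelopingAlgebra.lift_ι_apply]
  simp [vermaLie, matH]

end

theorem opX_pow_single_of_lt (l : ℕ) : ∀ (i : ℕ) (g : ℂ[X]), i < l →
    (opX ^ l) (Finsupp.single i g) = 0 := by
  induction l with
  | zero => intro i g h; omega
  | succ l ih =>
    intro i g h
    rw [pow_succ, Module.End.mul_apply, opX_single]
    rcases i with _ | i
    · simp
    · exact ih _ _ (by omega)

theorem opX_pow_single_self (l : ℕ) : ∀ g : ℂ[X], g ≠ 0 →
    ∃ D : ℂ[X], D ≠ 0 ∧ (opX ^ l) (Finsupp.single l g) = Finsupp.single 0 D := by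
  induction l with
  | zero => exact fun g hg => ⟨g, hg, by simp⟩
  | succ l ih =>
    intro g hg
    rw [pow_succ, Module.End.mul_apply, opX_single]
    refine ih _ (mul_ne_zero hg (mul_ne_zero (by exact_mod_cast l.succ_ne_zero) ?_))
    have : (X - ((l + 1 : ℕ) : ℂ[X]) + 1) = X + C (-(l : ℂ)) := by
      push_cast; simp; ring
    rw [this]
    exact X_add_C_ne_zero _

theorem opY_pow_single (m : ℕ) (g : ℂ[X]) :
    (opY ^ m) (Finsupp.single 0 g) = Finsupp.single m g := by
  induction m with
  | zero => simp
  | succ m ih => rw [pow_succ', Module.End.mul_apply, ih, opY_single]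

theorem aeval_opH_single (f g : ℂ[X]) :
    (aeval opH f) (Finsupp.single 0 g) = Finsupp.single 0 (f * g) := by
  induction f using Polynomial.induction_on' generalizing g with
  | add f f' hf hf' => simp [hf, hf', add_mul]
  | monomial n c =>
    have h : ∀ n : ℕ, (opH ^ n) (Finsupp.single 0 g) = Finsupp.single 0 (X ^ n * g) := by
      intro n
      induction n with
      | zero => simp
      | succ n ih =>
        rw [pow_succ', Module.End.mul_apply, ih, opH_single]
        congr 1
        push_cast; ring
    rw [aeval_monomial, ← Algebra.smul_def, LinearMap.smul_apply, h, Finsupp.smul_single,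
      smul_eq_C_mul, ← C_mul_X_pow_eq_monomial, mul_assoc]

theorem vermaRep_divPow (u : UC) (m : ℕ) :
    vermaRep (divPow u m) = ((m.factorial : ℂ)⁻¹) • vermaRep u ^ m := by
  simp [divPow]

theorem vermaRep_intMono_of_lt {i : ℕ × ℕ × ℕ} {l : ℕ} (h : l < i.2.2) :
    vermaRep (intMono i : UC) (Finsupp.single l 1) = 0 := by
  change vermaRep (divPow genY i.1 * binomH 0 i.2.1 * divPow genX i.2.2) _ = 0
  rw [map_mul, Module.End.mul_apply, vermaRep_divPow, LinearMap.smul_apply, vermaRep_genX,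
    opX_pow_single_of_lt _ _ _ h]
  simp

theorem exists_vermaRep_intMono (l : ℕ) : ∃ D : ℂ[X], D ≠ 0 ∧ ∀ m n : ℕ,
    vermaRep (intMono (m, n, l) : UC) (Finsupp.single l 1) =
      Finsupp.single m (C ((m.factorial : ℂ)⁻¹) * (binomPoly 0 n * D)) := by
  obtain ⟨D, hD, h⟩ := opX_pow_single_self l 1 one_ne_zero
  refine ⟨C ((l.factorial : ℂ)⁻¹) * D, mul_ne_zero ?_ hD, fun m n => ?_⟩
  · rw [Ne, C_eq_zero]
    exact inv_ne_zero (by exact_mod_cast l.factorial_ne_zero)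
  · change vermaRep (divPow genY m * binomH 0 n * divPow genX l) _ = _
    rw [map_mul, map_mul, Module.End.mul_apply, Module.End.mul_apply, vermaRep_divPow,
      vermaRep_divPow, LinearMap.smul_apply, LinearMap.smul_apply, vermaRep_genX, vermaRep_genY, h,
      binomH,
      ← aeval_algHom_apply, vermaRep_genH, Finsupp.smul_single, aeval_opH_single,
      opY_pow_single, Finsupp.smul_single, smul_eq_C_mul, smul_eq_C_mul]

theorem binomPoly_sum_eq_zero {s : Finset ℕ} {g : ℕ → ℤ}
    (h : ∑ n ∈ s, C (g n : ℂ) * binomPoly 0 n = 0) : ∀ n ∈ s, g n = 0 := by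
  intro n
  induction n using Nat.strong_induction_on with
  | _ n ih =>
    intro hn
    have h1 := congrArg (fun f : ℂ[X] => f.eval (((n : ℤ)) : ℂ)) h
    simp only [eval_finsetSum, eval_mul, eval_C, binomPoly_eval_int, eval_zero, add_zero,
      Ring.choose_natCast] at h1
    rw [Finset.sum_eq_single_of_mem n hn] at h1
    · simpa using h1
    · intro k hk hkn
      rcases lt_or_gt_of_ne hkn with h2 | h2
      · simp [ih k h2 hk]
      · simp [Nat.choose_eq_zero_of_lt h2]

theorem linearIndependent_intMono : LinearIndependent ℤ intMono := by
  rw [linearIndependent_iff]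
  intro g hg
  have hg' : ∑ i ∈ g.support, (g i : ℂ) • (intMono i : UC) = 0 := by
    have := congrArg (fun u : UZ => (u : UC)) hg
    rw [Finsupp.linearCombination_apply, Finsupp.sum] at this
    simpa [Int.cast_smul_eq_zsmul] using this
  have key : ∀ l m n : ℕ, g (m, n, l) = 0 := by
    intro l
    induction l using Nat.strong_induction_on with
    | _ l ih =>
      intro m n
      obtain ⟨D, hD, h⟩ := exists_vermaRep_intMono l
      have h1 := congrArg (fun u : UC => vermaRep u (Finsupp.single l 1) m) hg'
      simp only [map_sum, map_smul, LinearMap.sum_apply, LinearMap.smul_apply, map_zero,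
        LinearMap.zero_apply, Finsupp.coe_zero, Pi.zero_apply, Finsupp.finsetSum_apply,
        Finsupp.smul_apply] at h1
      by_contra hne
      let t : Finset (ℕ × ℕ × ℕ) := g.support.filter fun i => i.1 = m ∧ i.2.2 = l
      let s : Finset ℕ := t.image fun i => i.2.1
      have hs : ∀ k ∈ s, (m, k, l) ∈ g.support := by
        intro k hk
        obtain ⟨i, hi, rfl⟩ := Finset.mem_image.1 hk
        obtain ⟨hi1, rfl, rfl⟩ := Finset.mem_filter.1 hi
        exact hi1
      have h3 : C ((m.factorial : ℂ)⁻¹) * D *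
          ∑ k ∈ s, C (g (m, k, l) : ℂ) * binomPoly 0 k = 0 := by
        rw [← h1, Finset.mul_sum]
        refine Finset.sum_of_injOn (fun k => (m, k, l)) (by intro a _ b _ hab; simpa using hab)
          (fun k hk => hs k hk) ?_ ?_
        · rintro ⟨m', n', l'⟩ hi hni
          rcases lt_trichotomy l' l with hl | rfl | hl
          · simp [ih l' hl m' n']
          · have hm : m' ≠ m := by
              rintro rfl
              exact hni ⟨n', Finset.mem_coe.2 (Finset.mem_image.2
                ⟨_, Finset.mem_filter.2 ⟨hi, rfl, rfl⟩, rfl⟩), rfl⟩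
            rw [h, Finsupp.single_eq_of_ne hm.symm, smul_zero]
          · rw [vermaRep_intMono_of_lt hl]; simp
        · intro k _
          rw [h, Finsupp.single_eq_same, smul_eq_C_mul]
          ring
      have h2 : ∑ k ∈ s, C (g (m, k, l) : ℂ) * binomPoly 0 k = 0 := by
        refine (mul_eq_zero.1 h3).resolve_left (mul_ne_zero ?_ hD)
        rw [Ne, C_eq_zero]
        exact inv_ne_zero (by exact_mod_cast m.factorial_ne_zero)
      exact hne (binomPoly_sum_eq_zero h2 n
        (Finset.mem_image.2 ⟨(m, n, l), Finset.mem_filter.2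
          ⟨Finsupp.mem_support_iff.2 hne, rfl, rfl⟩, rfl⟩))
  ext ⟨m, n, l⟩
  exact key l m n

/-- The basis of the integral form that consists of all `Y ^ (m) * binom(H, n) * X ^ (l)`. -/
def intBasis : Module.Basis (ℕ × ℕ × ℕ) ℤ UZ :=
  Module.Basis.mk linearIndependent_intMono span_intMono

theorem intBasis_apply (i : ℕ × ℕ × ℕ) : intBasis i = intMono i := by
  simp [intBasis]


/-! ### The hyperalgebra of `SL₂` -/

/-- The hyperalgebra of `SL₂` over `k`: the base change to `k` of the integral form. -/
abbrev U (k : Type*) [Field k] : Type _ := k ⊗[ℤ] UZ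

section Hyper

variable (k : Type*) [Field k]

/-- The natural map from the integral form to the hyperalgebra. -/
def toU : UZ →ₐ[ℤ] U k := Algebra.TensorProduct.includeRight

/-- `X ^ (m)` in the hyperalgebra. -/
def hypX (m : ℕ) : U k := toU k (intX m)

/-- `Y ^ (m)` in the hyperalgebra. -/
def hypY (m : ℕ) : U k := toU k (intY m)

/-- `binom(H + c, m)` in the hyperalgebra. -/
def hypH (c : ℤ) (m : ℕ) : U k := toU k (intH c m)

/-- The element `Y ^ (m) * binom(H, n) * X ^ (l)` of the hyperalgebra, for `i = (m, n, l)`. -/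
def hypMono (i : ℕ × ℕ × ℕ) : U k := hypY k i.1 * hypH k 0 i.2.1 * hypX k i.2.2

/-- The `k`-basis of the hyperalgebra that consists of all `Y ^ (m) * binom(H, n) * X ^ (l)`. -/
def hypBasis : Module.Basis (ℕ × ℕ × ℕ) k (U k) := intBasis.baseChange k

theorem hypBasis_apply (i : ℕ × ℕ × ℕ) : hypBasis k i = hypMono k i := by
  rw [hypBasis, Module.Basis.baseChange_apply, intBasis_apply, intMono, hypMono, hypY, hypH, hypX,
    ← map_mul, ← map_mul]
  rfl

/-- The `k`-linear map `Fr'`, which maps `Y ^ (m) * binom(H, n) * X ^ (l)` to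
`Y ^ (m p) * binom(H, n p) * X ^ (l p)`. -/
def frobSplit (p : ℕ) : U k →ₗ[k] U k :=
  (hypBasis k).constr k fun i => hypMono k (i.1 * p, i.2.1 * p, i.2.2 * p)

theorem frobSplit_hypMono (p m n l : ℕ) :
    frobSplit k p (hypMono k (m, n, l)) = hypMono k (m * p, n * p, l * p) := by
  rw [frobSplit, ← hypBasis_apply, Module.Basis.constr_basis]

/-- `μ_a = binom(H - a - 1, p - 1)`. -/
def mu (p : ℕ) (a : ℤ) : U k := hypH k (-a - 1) (p - 1)

end Hyper

/-! ### The elements `B` for one pair -/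

section Poly

variable (p : ℕ) [Fact p.Prime]

/-- The polynomial `φ_{a,m}(x) = ∏_{i < m} (x - i (i + a + 1))` over `𝔽_p`. -/
def phi (a : ℤ) (m : ℕ) : (ZMod p)[X] :=
  ∏ i ∈ Finset.range m, (X - C ((i : ZMod p) * ((i : ZMod p) + (a : ZMod p) + 1)))

/-- The polynomial `ψ(x) = ∏_{i ∈ 𝔽_p} (x - i²)` over `𝔽_p`. -/
def psiFull : (ZMod p)[X] := ∏ i : ZMod p, (X - C (i ^ 2))

/-- The polynomials `ψ_s^{(0)}` (for `ε = 0`) and `ψ_s^{(1)}` (for `ε = 1`) over `𝔽_p`. -/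
def psi (ε : ℕ) (s : ZMod p) : (ZMod p)[X] :=
  if ε = 0 then
    if s = 0 then ∏ i ∈ Finset.univ.erase (0 : ZMod p), (X - C (i ^ 2))
    else 2 * X * (X + C (s ^ 2)) *
      ∏ i ∈ Finset.univ \ ({0, s, -s} : Finset (ZMod p)), (X - C (i ^ 2))
  else psiFull p /ₘ (X - C (s ^ 2))

/-- The set `𝒫` of pairs `(a, j)`. -/
def labels : Set (ℕ × ℚ) :=
  if p = 2 then {(0, 1 / 2), (1, 0), (1, 1)}
  else {l | l.1 < p ∧ ∃ i : ℕ, i ≤ (p - 1) / 2 ∧ l.2 = (i : ℚ)}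

/-- The number `n^{(ε)}(a, j)`: for odd `p`, the largest `n` such that `φ_{a,n}(x)` divides
`ψ_j^{(ε)}(x + ((a + 1) / 2)²)`. -/
def lowIdx (ε a : ℕ) (j : ℚ) : ℕ :=
  if p = 2 then
    if a = 0 then (if ε = 0 then 0 else 1) else (if j = 0 then 1 else 0)
  else sSup {n : ℕ | phi p a n ∣
    (psi p ε (j : ZMod p)).comp (X + C ((((a : ZMod p) + 1) / 2) ^ 2))}

variable (k : Type*) [Field k] [CharP k p]

/-- The inclusion of the prime field. -/
def ofPrime : ZMod p →+* k := ZMod.castHom (dvd_refl p) k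

/-- The element `B^{(ε)}(a, j)` for a single pair `(a, j)` in `𝒫`. -/
def B₁ (ε a : ℕ) (j : ℚ) : U k :=
  if p = 2 then
    if a = 0 then (if ε = 0 then mu k p a else mu k p a * hypY k 1 * hypX k 1)
    else
      (if j = 0 then mu k p a * hypY k 1 * hypX k 1
        else mu k p a * hypY k 1 * hypX k 1 + mu k p a)
  else
    aeval (mu k p a * hypY k 1 * hypX k 1 + algebraMap k (U k) ((((a : k) + 1) / 2) ^ 2))
      ((psi p ε (j : ZMod p)).map (ofPrime p k)) * mu k p a

end Poly

/-! ### The expansion of `B^{(ε)}(a, j)` in the elements `μ_a Y ^ m X ^ m` -/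

theorem genY_mul_genX_pow (m : ℕ) : genY * genX ^ (m + 1) =
    genX ^ m * (genY * genX - (m : UC) * (genH + (m : UC) + 1)) := by
  have e1 : genH * genX = genX * (genH + 2) := by
    have := genX_mul_genH
    rw [map_neg, map_ofNat, add_mul] at this
    rw [mul_add, this, mul_two]
    noncomm_ring
  have e2 : genY * genX = genX * genY - genH := by rw [genX_mul_genY]; abel
  have e3 : genY * genX * genX = genX * (genY * genX - genH - 2) := by
    nth_rw 1 [e2]
    rw [sub_mul, e1]
    noncomm_ring
  induction m with
  | zero => simp
  | succ m ih =>
    have hc : (m : UC) * genX = genX * m := Nat.cast_commute m genX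
    have e4 : (m : UC) * (genH + (m : UC) + 1) * genX = genX * ((m : UC) * (genH + m + 3)) := by
      rw [mul_assoc, add_mul, add_mul, e1, hc, one_mul,
        show genX * (genH + 2) + genX * (m : UC) + genX = genX * (genH + m + 3) by noncomm_ring,
        ← mul_assoc, hc, mul_assoc]
    rw [pow_succ, ← mul_assoc, ih, mul_assoc, sub_mul, e3, e4, ← mul_sub, ← mul_assoc, ← pow_succ]
    congr 1
    push_cast
    simp only [show (3 : UC) = 1 + 1 + 1 by norm_num, show (2 : UC) = 1 + 1 by norm_num]
    noncomm_ring

theorem commute_binomH (c : ℤ) (n m : ℕ) :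
    Commute (binomH c n) (genY ^ m * genX ^ m) := by
  have h1 := semiconj_pow genX_mul_genH m
  have h2 := (semiconj_pow genY_mul_genH m).add_right
    (Algebra.commutes (-2 * (m : ℂ)) (genY ^ m)).symm
  have h3 := h2.mul_left h1
  rw [add_assoc, ← map_add, ← add_mul, add_neg_cancel, zero_mul, map_zero, add_zero] at h3
  exact (semiconj_aeval h3 (binomPoly c n)).symm

theorem sub_mul_binomPoly (a : ℤ) (n : ℕ) :
    (X - C (a : ℂ)) * binomPoly (-a - 1) n = C ((n : ℂ) + 1) * binomPoly (-a) (n + 1) := by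
  rw [binomPoly, binomPoly, Finset.prod_range_succ', ← mul_assoc (C ((n : ℂ) + 1)), ← C_mul,
    inv_factorial_succ]
  have : ∀ i : ℕ, ((-a : ℤ) : ℂ) - ((i + 1 : ℕ) : ℂ) = ((-a - 1 : ℤ) : ℂ) - i := fun i => by
    push_cast; ring
  simp only [this]
  push_cast
  simp only [C_neg, sub_zero]
  ring

/-- `H` in the integral form. -/
def intGenH : UZ := ⟨genH, by
  have := aeval_genH_mem (f := X) fun z => ⟨z, by simp⟩
  simpa using this⟩

theorem intGenH_sub_mul (a : ℤ) (n : ℕ) :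
    (intGenH - (a : UZ)) * intH (-a - 1) n = ((n + 1 : ℕ) : UZ) * intH (-a) (n + 1) := by
  apply Subtype.ext
  have h := congrArg (aeval genH) (sub_mul_binomPoly a n)
  simp only [map_mul, map_sub, aeval_X, map_add, map_natCast, map_one, map_intCast] at h
  push_cast
  exact h

theorem factorial_mul_intH (c : ℤ) (n : ℕ) : (n.factorial : UZ) * intH c n =
    aeval intGenH (∏ i ∈ Finset.range n, (X + C (c - (i : ℤ))) : ℤ[X]) := by
  induction n with
  | zero =>
    apply Subtype.ext
    simp [intH, binomH, binomPoly_zero]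
  | succ n ih =>
    have h : (((n + 1 : ℕ) : UZ)) * intH c (n + 1) =
        (intGenH + ((c - (n : ℤ) : ℤ) : UZ)) * intH c n := by
      apply Subtype.ext
      have h := congrArg (aeval genH) (binomPoly_succ c n)
      simp only [map_mul, map_sub, aeval_X, map_add, map_natCast, map_one, map_intCast] at h
      push_cast
      exact h
    rw [Nat.factorial_succ, Nat.mul_comm, Nat.cast_mul, mul_assoc, h, Finset.prod_range_succ,
      mul_comm (∏ i ∈ _, _), map_mul, ← ih, ← mul_assoc, ← mul_assoc, (Nat.cast_commute _ _).eq]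
    simp

section Expansion

theorem natCast_U_eq_zero (p : ℕ) (k : Type*) [Field k] [CharP k p] : ((p : ℕ) : U k) = 0 := by
  rw [← map_natCast (algebraMap k (U k)), CharP.cast_eq_zero, map_zero]

/-- `Y X` in the hyperalgebra. -/
def hypYX (k : Type*) [Field k] : U k := hypY k 1 * hypX k 1

theorem hypYX_eq (k : Type*) [Field k] : hypYX k = toU k (intY 1 * intX 1) := by
  rw [hypYX, hypY, hypX, map_mul]

theorem commute_mu_pow (p : ℕ) (k : Type*) [Field k] (a : ℤ) (m : ℕ) :
    Commute (mu k p a) (hypY k 1 ^ m * hypX k 1 ^ m) := by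
  rw [hypY, hypX, ← map_pow, ← map_pow, ← map_mul, mu, hypH]
  refine Commute.map (f := toU k) (Subtype.ext ?_)
  have := commute_binomH (-a - 1) (p - 1) m
  simpa [intY, intX, intH, divPow_one] using this.eq

theorem commute_mu_hypYX (p : ℕ) (k : Type*) [Field k] (a : ℤ) :
    Commute (mu k p a) (hypYX k) := by
  have := commute_mu_pow p k a 1
  rwa [pow_one, pow_one] at this

variable (p : ℕ) [hp : Fact p.Prime] (k : Type*) [Field k] [CharP k p]

theorem toU_H_mul_mu (a : ℤ) : toU k intGenH * mu k p a = (a : k) • mu k p a := by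
  have h := congrArg (toU k) (intGenH_sub_mul a (p - 1))
  rw [Nat.sub_add_cancel hp.out.one_le, map_mul, map_mul, map_natCast, natCast_U_eq_zero p k,
    zero_mul, map_sub, sub_mul, map_intCast, sub_eq_zero] at h
  rw [Int.cast_smul_eq_zsmul, zsmul_eq_mul]
  exact h

theorem aeval_H_mul_mu (a : ℤ) (f : ℤ[X]) :
    aeval (toU k intGenH) f * mu k p a = ((f.eval a : ℤ) : k) • mu k p a := by
  induction f using Polynomial.induction_on' with
  | add f g hf hg => simp [add_mul, hf, hg, add_smul]
  | monomial n c =>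
    have h : ∀ n : ℕ, toU k intGenH ^ n * mu k p a = ((a : k) ^ n) • mu k p a := by
      intro n
      induction n with
      | zero => simp
      | succ n ih => rw [pow_succ', mul_assoc, ih, mul_smul_comm, toU_H_mul_mu, smul_smul, pow_succ]
    rw [aeval_monomial, mul_assoc, h, eval_monomial, ← Algebra.smul_def, Int.cast_mul, mul_smul,
      Int.cast_smul_eq_zsmul, Int.cast_pow]

theorem mu_mul_mu (hp2 : p ≠ 2) (a : ℤ) : mu k p a * mu k p a = mu k p a := by
  have hpp := hp.out
  have h := congrArg (toU k) (factorial_mul_intH (-a - 1) (p - 1))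
  rw [map_mul, map_natCast, ← aeval_algHom_apply] at h
  have h1 := aeval_H_mul_mu p k a (∏ i ∈ Finset.range (p - 1), (X + C (-a - 1 - (i : ℤ))))
  rw [← h, eval_prod] at h1
  have h2 : ∏ i ∈ Finset.range (p - 1), eval a (X + C (-a - 1 - (i : ℤ))) =
      (((p - 1).factorial : ℕ) : ℤ) := by
    have h3 : ∀ i : ℕ, eval a (X + C (-a - 1 - (i : ℤ))) = (-1) * ((i + 1 : ℕ) : ℤ) := by
      intro i; simp; ring
    simp only [h3, Finset.prod_mul_distrib, Finset.prod_const, Finset.card_range]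
    rw [(hpp.even_sub_one hp2).neg_one_pow, one_mul, ← Nat.cast_prod,
      Finset.prod_range_add_one_eq_factorial]
  rw [h2, Int.cast_natCast, mul_assoc, ← nsmul_eq_mul, ← Nat.cast_smul_eq_nsmul k] at h1
  have h4 : (((p - 1).factorial : ℕ) : k) ≠ 0 := by
    rw [Ne, CharP.cast_eq_zero_iff k p, hpp.dvd_factorial]
    have := hpp.pos
    omega
  have h5 := congrArg (fun u => (((p - 1).factorial : ℕ) : k)⁻¹ • u) h1
  simp only [smul_smul, inv_mul_cancel₀ h4, one_smul] at h5
  exact h5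

theorem hypY_pow_mul_hypX_pow_mul_mu (a : ℤ) (m : ℕ) :
    hypY k 1 ^ m * hypX k 1 ^ m * mu k p a =
      aeval (hypYX k) ((phi p a m).map (ofPrime p k)) * mu k p a := by
  induction m with
  | zero => simp [phi]
  | succ m ih =>
    have h0 : intY 1 ^ (m + 1) * intX 1 ^ (m + 1) = intY 1 ^ m * (intX 1 ^ m *
        (intY 1 * intX 1 - (m : UZ) * (intGenH + (m : UZ) + 1))) := by
      apply Subtype.ext
      have := genY_mul_genX_pow m
      push_cast
      simp only [intY, intX, intGenH, divPow_one]
      rw [← this, pow_succ, mul_assoc]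
    have h1 := congrArg (toU k) h0
    simp only [map_mul, map_pow, map_sub, map_natCast, map_add, map_one] at h1
    have h2 : (hypYX k - (m : U k) * (toU k intGenH + (m : U k) + 1)) * mu k p a =
        mu k p a * (hypYX k - algebraMap k (U k) ((m : k) * ((m : k) + (a : k) + 1))) := by
      rw [sub_mul, mul_sub, (commute_mu_hypYX p k a).eq, mul_assoc, add_mul, add_mul,
        toU_H_mul_mu, ← Algebra.commutes, ← Algebra.smul_def, mul_smul, add_smul, add_smul,
        one_smul, one_mul, Nat.cast_smul_eq_nsmul, Nat.cast_smul_eq_nsmul, nsmul_eq_mul,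
        nsmul_eq_mul]
      congr 2
      abel
    have h3 : hypY k 1 ^ (m + 1) * hypX k 1 ^ (m + 1) = hypY k 1 ^ m * (hypX k 1 ^ m *
        (hypYX k - (m : U k) * (toU k intGenH + (m : U k) + 1))) := h1
    have h5 : phi p a (m + 1) =
        phi p a m * (X - C ((m : ZMod p) * ((m : ZMod p) + (a : ZMod p) + 1))) := by
      rw [phi, phi, Finset.prod_range_succ]
    rw [h3, mul_assoc, mul_assoc, h2, ← mul_assoc, ← mul_assoc, ih, h5, Polynomial.map_mul,
      map_mul (aeval (hypYX k)), mul_assoc, mul_assoc]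
    congr 1
    have h4 : aeval (hypYX k) ((X - C ((m : ZMod p) * ((m : ZMod p) + (a : ZMod p) + 1))).map
        (ofPrime p k)) = hypYX k - algebraMap k (U k) ((m : k) * ((m : k) + (a : k) + 1)) := by
      rw [Polynomial.map_sub, map_X, map_C, map_sub, aeval_X, aeval_C]
      simp only [ofPrime, map_mul, map_add, map_natCast, map_intCast, map_one]
    rw [h4, mul_sub, sub_mul, (commute_mu_hypYX p k a).eq, Algebra.commutes]

theorem aeval_mul_mu (hp2 : p ≠ 2) (a : ℤ) (c : k) (f : k[X]) :
    aeval (mu k p a * hypY k 1 * hypX k 1 + algebraMap k (U k) c) f * mu k p a =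
      aeval (hypYX k) (f.comp (X + C c)) * mu k p a := by
  have h1 : Commute (mu k p a) (hypYX k + algebraMap k (U k) c) :=
    (commute_mu_hypYX p k a).add_right (Algebra.commutes c _).symm
  have h2 : (mu k p a * hypY k 1 * hypX k 1 + algebraMap k (U k) c) * mu k p a =
      (hypYX k + algebraMap k (U k) c) * mu k p a := by
    rw [add_mul, add_mul, mul_assoc (mu k p a)]
    change mu k p a * hypYX k * _ + _ = _
    rw [mul_assoc, ← (commute_mu_hypYX p k a).eq, ← mul_assoc, mu_mul_mu p k hp2]
  rw [aeval_comp]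
  simp only [map_add, aeval_X, aeval_C]
  induction f using Polynomial.induction_on' with
  | add f g hf hg => rw [map_add, map_add, add_mul, add_mul, hf, hg]
  | monomial n d =>
    rw [aeval_monomial, aeval_monomial, mul_assoc (algebraMap k (U k) d),
      mul_assoc (algebraMap k (U k) d)]
    refine congrArg (fun u => algebraMap k (U k) d * u) ?_
    induction n with
    | zero => simp
    | succ n ih => rw [pow_succ, mul_assoc, h2, ← h1.eq, ← mul_assoc, ih, mul_assoc, h1.eq,
        ← mul_assoc, ← pow_succ]

end Expansion

section Newton

variable (p : ℕ) [hp : Fact p.Prime]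

theorem monic_phi (a : ℤ) (m : ℕ) : (phi p a m).Monic :=
  monic_prod_of_monic _ _ fun _ _ => monic_X_sub_C _

theorem natDegree_phi (a : ℤ) (m : ℕ) : (phi p a m).natDegree = m := by
  rw [phi, natDegree_prod_of_monic _ _ fun _ _ => monic_X_sub_C _]
  simp only [natDegree_X_sub_C, Finset.sum_const, Finset.card_range, smul_eq_mul, mul_one]

theorem exists_newton (a : ℤ) (d n : ℕ) (f : (ZMod p)[X]) (hd : p ≤ n + d)
    (hf : f.natDegree < p) (hn : phi p a n ∣ f) :
    ∃ c : ℕ → ZMod p, f = ∑ m ∈ Finset.Ico n p, C (c m) * phi p a m := by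
  induction d generalizing n f with
  | zero =>
    refine ⟨0, ?_⟩
    rw [Finset.Ico_eq_empty (by omega), Finset.sum_empty]
    by_contra h0
    have := natDegree_le_of_dvd hn h0
    rw [natDegree_phi] at this
    omega
  | succ d ih =>
    rcases le_or_gt p n with hpn | hpn
    · refine ⟨0, ?_⟩
      rw [Finset.Ico_eq_empty (by omega), Finset.sum_empty]
      by_contra h0
      have := natDegree_le_of_dvd hn h0
      rw [natDegree_phi] at this
      omega
    · obtain ⟨g, hg⟩ := hn
      let t : ZMod p := (n : ZMod p) * ((n : ZMod p) + (a : ZMod p) + 1)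
      obtain ⟨q, hq⟩ : X - C t ∣ g - C (g.eval t) := by
        rw [dvd_iff_isRoot]; simp [IsRoot]
      obtain ⟨c, hc⟩ := ih (n + 1) (f - C (g.eval t) * phi p a n) (by omega) (by
          refine lt_of_le_of_lt (natDegree_sub_le _ _) (max_lt hf ?_)
          exact lt_of_le_of_lt (natDegree_C_mul_le _ _) (by rwa [natDegree_phi])) ⟨q, by
          have h5 : phi p a (n + 1) = phi p a n * (X - C t) := by
            rw [phi, phi, Finset.prod_range_succ]
          rw [h5, mul_assoc, ← hq, hg]
          ring⟩
      refine ⟨Function.update c n (g.eval t), ?_⟩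
      rw [Finset.sum_eq_sum_Ico_succ_bot hpn, Function.update_self, ← sub_eq_iff_eq_add', hc]
      refine Finset.sum_congr rfl fun m hm => ?_
      rw [Function.update_of_ne]
      have := (Finset.mem_Ico.1 hm).1
      omega

theorem psi_ne_zero_and_natDegree_lt (hp2 : p ≠ 2) (ε : ℕ) (s : ZMod p) :
    psi p ε s ≠ 0 ∧ (psi p ε s).natDegree < p := by
  have hpp := hp.out
  have hpos := hpp.pos
  have hdeg : ∀ S : Finset (ZMod p), (∏ i ∈ S, (X - C (i ^ 2))).natDegree = S.card := fun S => by
    rw [natDegree_prod_of_monic _ _ fun _ _ => monic_X_sub_C _]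
    simp only [natDegree_X_sub_C, Finset.sum_const, smul_eq_mul, mul_one]
  have hne : ∀ S : Finset (ZMod p), (∏ i ∈ S, (X - C (i ^ 2))) ≠ 0 := fun S =>
    (monic_prod_of_monic _ _ fun _ _ => monic_X_sub_C _).ne_zero
  have h2 : (2 : ZMod p) ≠ 0 := by
    intro h
    have : ((2 : ℕ) : ZMod p) = 0 := by exact_mod_cast h
    rw [ZMod.natCast_eq_zero_iff] at this
    exact hp2 ((Nat.prime_dvd_prime_iff_eq hpp Nat.prime_two).1 this)
  unfold psi
  split_ifs with h0 hs
  · refine ⟨hne _, ?_⟩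
    rw [hdeg, Finset.card_erase_of_mem (Finset.mem_univ _), Finset.card_univ, ZMod.card]
    omega
  · have h3 : (2 * X * (X + C (s ^ 2)) : (ZMod p)[X]) ≠ 0 := by
      refine mul_ne_zero (mul_ne_zero ?_ X_ne_zero) (X_add_C_ne_zero _)
      rw [← C_ofNat, Ne, C_eq_zero]
      exact h2
    refine ⟨mul_ne_zero h3 (hne _), ?_⟩
    have h4 : (2 * X * (X + C (s ^ 2)) : (ZMod p)[X]).natDegree ≤ 2 := by
      rw [← C_ofNat]
      compute_degree
    have h5 : ({0, s, -s} : Finset (ZMod p)).card = 3 := by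
      rw [Finset.card_eq_three]
      refine ⟨0, s, -s, Ne.symm hs, ?_, ?_, rfl⟩
      · simpa [eq_comm] using hs
      · intro h
        have : (2 : ZMod p) * s = 0 := by linear_combination h
        exact (mul_ne_zero h2 hs) this
    have h6 := Finset.card_le_univ ({0, s, -s} : Finset (ZMod p))
    rw [ZMod.card] at h6
    refine lt_of_le_of_lt natDegree_mul_le ?_
    rw [hdeg, Finset.card_sdiff_of_subset (Finset.subset_univ _), Finset.card_univ, ZMod.card, h5]
    omega
  · have h3 : (X - C (s ^ 2)) ∣ psiFull p := Finset.dvd_prod_of_mem _ (Finset.mem_univ s)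
    have h4 : (X - C (s ^ 2)) * (psiFull p /ₘ (X - C (s ^ 2))) = psiFull p := by
      rw [mul_divByMonic_eq_iff_isRoot, ← dvd_iff_isRoot]
      exact h3
    refine ⟨fun h => hne Finset.univ ?_, ?_⟩
    · rw [h, mul_zero] at h4; exact h4.symm
    · rw [natDegree_divByMonic _ (monic_X_sub_C _), psiFull, hdeg, natDegree_X_sub_C,
        Finset.card_univ, ZMod.card]
      omega

variable (k : Type*) [Field k] [CharP k p]

/-- `B^{(ε)}(a, j)` is `μ_a` times a combination of the `Y ^ m X ^ m` with
`n^{(ε)}(a, j) ≤ m ≤ p - 1`, with coefficients in the prime field. -/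
theorem exists_expansion (ε a : ℕ) (j : ℚ) : ∃ c : ℕ → ZMod p,
    B₁ p k ε a j = mu k p a * ∑ m ∈ Finset.Icc (lowIdx p ε a j) (p - 1),
      ofPrime p k (c m) • (hypY k 1 ^ m * hypX k 1 ^ m) := by
  have hpos := hp.out.pos
  by_cases hp2 : p = 2
  · have h2 : Finset.Icc 0 (p - 1) = {0, 1} := by subst hp2; rfl
    have h3 : Finset.Icc 1 (p - 1) = {1} := by subst hp2; rfl
    unfold B₁ lowIdx
    rw [if_pos hp2, if_pos hp2]
    split_ifs
    · exact ⟨fun m => if m = 0 then 1 else 0, by rw [h2]; simp⟩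
    · exact ⟨1, by rw [h3]; simp [mul_assoc]⟩
    · exact ⟨1, by rw [h3]; simp [mul_assoc]⟩
    · exact ⟨1, by rw [h2]; simp [mul_assoc, mul_add, add_comm]⟩
  · obtain ⟨hne, hdeg⟩ := psi_ne_zero_and_natDegree_lt p hp2 ε (j : ZMod p)
    let t : ZMod p := (((a : ZMod p) + 1) / 2) ^ 2
    let f : (ZMod p)[X] := (psi p ε (j : ZMod p)).comp (X + C t)
    have hf : f.natDegree < p := by
      rw [natDegree_comp, natDegree_X_add_C, mul_one]; exact hdeg
    have hf0 : f ≠ 0 := by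
      intro h
      refine hne ?_
      have : (f.comp (X - C t)) = psi p ε (j : ZMod p) := by
        simp [f, comp_assoc]
      rw [← this, h, zero_comp]
    have hmem : phi p a (lowIdx p ε a j) ∣ f := by
      have h1 : lowIdx p ε a j = sSup {n : ℕ | phi p a n ∣ f} := by
        rw [lowIdx, if_neg hp2]
      rw [h1]
      refine Nat.sSup_mem (s := {n : ℕ | phi p a n ∣ f}) ⟨0, by simp [phi]⟩ ⟨p, fun n hn => ?_⟩
      have := natDegree_le_of_dvd hn hf0
      rw [natDegree_phi] at this
      omega
    obtain ⟨c, hc⟩ := exists_newton p a p _ f (Nat.le_add_left _ _) hf hmem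
    refine ⟨c, ?_⟩
    have h2 : f.map (ofPrime p k) = ((psi p ε (j : ZMod p)).map (ofPrime p k)).comp
        (X + C ((((a : k) + 1) / 2) ^ 2)) := by
      have h0 : ofPrime p k 2 = 2 := map_ofNat (ofPrime p k) 2
      have ht : ofPrime p k t = (((a : k) + 1) / 2) ^ 2 := by simp [t, h0]
      rw [Polynomial.map_comp, Polynomial.map_add, map_X, map_C, ht]
    have h3 := aeval_mul_mu p k hp2 a ((((a : k) + 1) / 2) ^ 2)
      ((psi p ε (j : ZMod p)).map (ofPrime p k))
    rw [B₁, if_neg hp2, h3, ← h2, hc, Polynomial.map_sum, map_sum, Finset.sum_mul, Finset.mul_sum]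
    have h4 : Finset.Ico (lowIdx p ε a j) p = Finset.Icc (lowIdx p ε a j) (p - 1) := by
      ext m; simp only [Finset.mem_Ico, Finset.mem_Icc]; omega
    rw [h4]
    refine Finset.sum_congr rfl fun m _ => ?_
    have h5 : Commute (mu k p a) (aeval (hypYX k) ((phi p a m).map (ofPrime p k))) :=
      semiconj_aeval (commute_mu_hypYX p k a) _
    rw [Polynomial.map_mul, map_mul (aeval (hypYX k)), Polynomial.map_C, aeval_C, mul_assoc,
      ← hypY_pow_mul_hypX_pow_mul_mu, ← Algebra.smul_def, mul_smul_comm]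
    congr 1
    exact (commute_mu_pow p k a m).eq.symm

end Newton

/-! ### The elements `B` for a tuple of pairs -/

section Main

variable (p : ℕ) [Fact p.Prime] (k : Type*) [Field k] [CharP k p]

/-- The coefficients `c_m^{(ε)}` in the expansion
`B^{(ε)}(a, j) = μ_a ∑_m c_m^{(ε)} Y ^ m X ^ m`, where `n^{(ε)}(a, j) ≤ m ≤ p - 1`. They are
determined by the expansion, since the elements `μ_a Y ^ m X ^ m` with `m ≤ p - 1` are linearly
independent. -/
def coeffB (ε a : ℕ) (j : ℚ) : ℕ → ZMod p := Classical.choose (exists_expansion p k ε a j)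

theorem B₁_eq_sum (ε a : ℕ) (j : ℚ) :
    B₁ p k ε a j = mu k p a * ∑ m ∈ Finset.Icc (lowIdx p ε a j) (p - 1),
      ofPrime p k (coeffB p k ε a j m) • (hypY k 1 ^ m * hypX k 1 ^ m) :=
  Classical.choose_spec (exists_expansion p k ε a j)

/-- Condition (A): `a` is even and `(p - a + 1) / 2 ≤ j ≤ (p - 1) / 2`. -/
def CondA (p a : ℕ) (j : ℚ) : Prop :=
  Even a ∧ ((p : ℚ) - a + 1) / 2 ≤ j ∧ j ≤ ((p : ℚ) - 1) / 2

/-- Condition (C): `a` is odd and `0 ≤ j ≤ (a - 1) / 2`. -/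
def CondC (a : ℕ) (j : ℚ) : Prop := Odd a ∧ 0 ≤ j ∧ j ≤ ((a : ℚ) - 1) / 2

/-- The integer `s(a, j)`, which is used under (A) or (C). -/
def shiftExp (p a : ℕ) : ℕ :=
  if p = 2 then 1 else if Even a then (p - a + 1) / 2 else (p - a) / 2

open Classical in
/-- The element `Z^{(ε)}(z; (a, j))`. For odd `p`, the pairs in `𝒫` that satisfy neither (A) nor (C)
are those with `a` even and `0 ≤ j ≤ (p - a - 1) / 2`, or `a` odd and `(a + 1) / 2 ≤ j`. The exponents
`m - s(a, j)` are nonnegative for the pairs in `𝒫`. -/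
def Z (ε a : ℕ) (j : ℚ) (z : U k) : U k :=
  if CondA p a j ∨ CondC a j then
    mu k p a * ∑ m ∈ Finset.Icc (lowIdx p ε a j) (p - 1),
      ofPrime p k (coeffB p k ε a j m) •
        (hypY k 1 ^ m * hypX k 1 ^ (m - shiftExp p a) * frobSplit k p z *
          hypX k 1 ^ shiftExp p a)
  else frobSplit k p z * B₁ p k ε a j

/-- The element `B^{(ε)}(a, j)` for an `r`-tuple `ε` and an `r`-tuple `l` of pairs `(a_i, j_i)`,
where `r ≥ 1`; the value for `r = 0` is a convention that is not used. -/
def B : (r : ℕ) → (Fin r → ℕ) → (Fin r → ℕ × ℚ) → U k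
  | 0, _, _ => 1
  | 1, ε, l => B₁ p k (ε 0) (l 0).1 (l 0).2
  | r + 2, ε, l => Z p k (ε 0) (l 0).1 (l 0).2 (B (r + 1) (Fin.tail ε) (Fin.tail l))

/-- The subset `𝒳_r(a, j)` of `{0, 1}^r`. -/
def XSet (p : ℕ) {r : ℕ} (l : Fin r → ℕ × ℚ) : Set (Fin r → ℕ) :=
  {ε | (∀ i, ε i = 0 ∨ ε i = 1) ∧
    ∀ i, (if p = 2 then (l i).1 = 1 else (l i).2 = 0) → ε i = 0}

end Main

end Hyperalgebra

end

/-!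
In `𝒰` one has `φ_{a,m}(YX) μ_a = Y^m X^m μ_a` and `X^p = 0`, so `f(YX) μ_a` depends only on `f`
modulo `φ_{a,p}`, and `φ_{a,p}(x) = ψ(x + ((a+1)/2)²)` for odd `p`. For `r = 1` the claim is thus
about polynomials modulo `ψ`: there, for `j ≠ 0`, `ψ^{(1)}_j` squares to zero, and `ψ^{(0)}_j` is
an idempotent fixing `ψ^{(1)}_j` because it is congruent to `1` to second order at `j²`.

For `r ≥ 2`, `Fr'(z)` commutes with `YX` and `μ_a`, and `Fr'` becomes multiplicative after right
multiplication by `G = f(YX) μ_b` as soon as `φ_{b,p}` divides `φ_{b,p-b} f` (`0 ≤ b < p`): the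
terms of `X^(rp) Y^(sp)` that do not come from `X^(r) Y^(s)` contain a factor
`Y^v binom(H + c, i) X^v` with `0 < v < p`, and this kills `G`, by divisibility if `v ≥ p - b` and
because the binomial coefficient vanishes on the weight `b` otherwise. Each `Z^{(ε)}(z; (a, j))` is
`Y^s Fr'(z) Q(YX) μ_b X^s` with `b ≡ a + 2s` modulo `p`, where `G = X^s Y^s Q(YX) μ_b` satisfies
this condition. A product of two such elements is therefore `Fr'(z z')` surrounded by a product of
polynomials, and the claim follows by induction.
-/

noncomputable section

namespace Hyperalgebra

/-- The ring of integer-valued polynomials. It plays the role of the Cartan part of the integral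
form: `f` stands for the element `f(H)`. -/
def intValuedPoly : Subring ℂ[X] where
  carrier := {f | IntValued f}
  mul_mem' hf hg := IntValued.mul hf hg
  one_mem' _ := ⟨1, by simp⟩
  zero_mem' _ := ⟨0, by simp⟩
  add_mem' {f g} hf hg z := by
    obtain ⟨u, hu⟩ := hf z
    obtain ⟨v, hv⟩ := hg z
    exact ⟨u + v, by simp [hu, hv]⟩
  neg_mem' {f} hf z := by
    obtain ⟨u, hu⟩ := hf z
    exact ⟨-u, by simp [hu]⟩

theorem dvd_coeff_of_dvd_sum_choose {q : ℤ} {d : ℕ} {c : ℕ → ℤ}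
    (h : ∀ n : ℕ, q ∣ ∑ i ∈ Finset.range d, c i * (n.choose i : ℤ)) {n : ℕ} (hn : n < d) :
    q ∣ c n := by
  induction n using Nat.strong_induction_on with
  | _ n ih =>
    have hsum := h n
    rw [← Finset.add_sum_erase _ _ (Finset.mem_range.2 hn), Nat.choose_self, Nat.cast_one,
      mul_one] at hsum
    refine (dvd_add_left (Finset.dvd_sum fun i hi => ?_)).1 hsum
    obtain ⟨hne, hi⟩ := Finset.mem_erase.1 hi
    rcases lt_or_gt_of_ne hne with hlt | hgt
    · exact (ih i hlt (Finset.mem_range.1 hi)).mul_right _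
    · rw [Nat.choose_eq_zero_of_lt hgt, Nat.cast_zero, mul_zero]
      exact dvd_zero q

namespace intValuedPoly

/-- Evaluation of an integer-valued polynomial at an integer, as an integer. -/
def val (z : ℤ) : intValuedPoly →+* ℤ where
  toFun f := (f.2 z).choose
  map_one' := Int.cast_injective (α := ℂ) (by
    rw [← (intValuedPoly.one_mem z).choose_spec]; simp)
  map_zero' := Int.cast_injective (α := ℂ) (by
    rw [← (intValuedPoly.zero_mem z).choose_spec]; simp)
  map_mul' f g := Int.cast_injective (α := ℂ) (by
    rw [Int.cast_mul, ← (f.2 z).choose_spec, ← (g.2 z).choose_spec,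
      ← ((f * g).2 z).choose_spec, Subring.coe_mul, eval_mul])
  map_add' f g := Int.cast_injective (α := ℂ) (by
    rw [Int.cast_add, ← (f.2 z).choose_spec, ← (g.2 z).choose_spec,
      ← ((f + g).2 z).choose_spec, Subring.coe_add, eval_add])

theorem cast_val (z : ℤ) (f : intValuedPoly) : (val z f : ℂ) = (f : ℂ[X]).eval (z : ℂ) :=
  (f.2 z).choose_spec.symm

theorem val_eq_of_eval_eq {f : intValuedPoly} {z w : ℤ}
    (h : (f : ℂ[X]).eval (z : ℂ) = (w : ℂ)) : val z f = w :=
  Int.cast_injective ((cast_val z f).trans h)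

theorem ext_val {f g : intValuedPoly} (h : ∀ n : ℕ, val n f = val n g) : f = g := by
  refine Subtype.ext (Polynomial.eq_of_infinite_eval_eq _ _ (Set.infinite_of_injective_forall_mem
    (f := fun n : ℕ => (((n : ℤ)) : ℂ)) (fun a b h => by simpa using h) fun n => ?_))
  rw [Set.mem_ofPred_eq, ← cast_val, ← cast_val, h]

/-- The integer-valued polynomial `binom(T + c, m)`. -/
def binom (c : ℤ) (m : ℕ) : intValuedPoly := ⟨binomPoly c m, intValued_binomPoly c m⟩

theorem val_binom (z c : ℤ) (m : ℕ) : val z (binom c m) = Ring.choose (z + c) m :=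
  val_eq_of_eval_eq (binomPoly_eval_int c m z)

theorem binom_zero_right (c : ℤ) : binom c 0 = 1 := Subtype.ext (binomPoly_zero c)

/-- The substitution `f(T) ↦ f(T + c)`. -/
def shift (c : ℤ) : intValuedPoly →+* intValuedPoly :=
  (compRingHom (X + C (c : ℂ))).restrict _ _ fun _ hf => IntValued.shift hf c

theorem coe_shift (c : ℤ) (f : intValuedPoly) :
    (shift c f : ℂ[X]) = (f : ℂ[X]).comp (X + C (c : ℂ)) := rfl

theorem val_shift (z c : ℤ) (f : intValuedPoly) : val z (shift c f) = val (z + c) f :=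
  val_eq_of_eval_eq (by simp [coe_shift, cast_val])

theorem shift_shift (c d : ℤ) (f : intValuedPoly) : shift c (shift d f) = shift (c + d) f :=
  ext_val fun n => by simp only [val_shift, add_assoc]

theorem shift_zero (f : intValuedPoly) : shift 0 f = f :=
  ext_val fun n => by rw [val_shift, add_zero]

theorem shift_binom (c d : ℤ) (m : ℕ) : shift c (binom d m) = binom (d + c) m :=
  ext_val fun n => by rw [val_shift, val_binom, val_binom, add_assoc, add_comm c]

theorem exists_eq_sum (f : intValuedPoly) : ∃ (d : ℕ) (c : ℕ → ℤ),
    f = ∑ n ∈ Finset.range d, (c n : intValuedPoly) * binom 0 n := by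
  obtain ⟨c, hc⟩ := IntValued.exists_sum f.2 le_rfl
  refine ⟨(f : ℂ[X]).natDegree + 1, c, Subtype.ext (hc.trans ?_)⟩
  push_cast
  exact Finset.sum_congr rfl fun n _ => by simp only [binom, map_intCast]

theorem dvd_of_forall_dvd_val {q : ℤ} {f : intValuedPoly} (N : ℕ)
    (h : ∀ n : ℕ, N ≤ n → q ∣ val n f) : (q : intValuedPoly) ∣ f := by
  obtain ⟨d, c, hc⟩ := exists_eq_sum (shift N f)
  have hval (n : ℕ) : q ∣ ∑ i ∈ Finset.range d, c i * (n.choose i : ℤ) := by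
    have hn := congrArg (val n) hc
    simp only [map_sum, val_shift, map_mul, map_intCast, val_binom, add_zero,
      Ring.choose_natCast, Int.cast_id] at hn
    rw [← hn]
    exact_mod_cast h (n + N) (Nat.le_add_left _ _)
  have hshift : (q : intValuedPoly) ∣ shift N f := by
    rw [hc]
    exact Finset.dvd_sum fun n hn => ((map_dvd (Int.castRingHom intValuedPoly)
      (dvd_coeff_of_dvd_sum_choose hval (Finset.mem_range.1 hn))).mul_right _)
  simpa [shift_shift, shift_zero] using map_dvd (shift (-N)) hshift

end intValuedPoly

open intValuedPoly

theorem intCast_choose_eq (p : ℕ) [Fact p.Prime] {z : ℤ} (hz : 0 ≤ z) (m : ℕ) :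
    ((Ring.choose z m : ℤ) : ZMod p) =
      (Ring.choose (z % p) (m % p) : ℤ) * (Ring.choose (z / p) (m / p) : ℤ) := by
  lift z to ℕ using hz
  have h := Choose.choose_modEq_choose_mod_mul_choose_div (n := z) (k := m) (p := p)
  rw [← ZMod.intCast_eq_intCast_iff] at h
  rw [Ring.choose_natCast, ← Int.natCast_mod, ← Int.natCast_ediv, Ring.choose_natCast,
    Ring.choose_natCast]
  exact_mod_cast h

/-- A divided power sequence, that is, a sequence behaving like `d m = x ^ m / m!`; the instances
of interest are `X^(m)` and `Y^(m)`. -/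
structure IsDividedPowerSeq {A : Type*} [Semiring A] (d : ℕ → A) : Prop where
  zero : d 0 = 1
  mul (m n : ℕ) : d m * d n = ((m + n).choose m : A) * d (m + n)

namespace IsDividedPowerSeq

section Semiring

variable {A : Type*} [Semiring A] {d : ℕ → A} (hd : IsDividedPowerSeq d)
include hd

theorem commute (m n : ℕ) : Commute (d m) (d n) := by
  rw [Commute, SemiconjBy, hd.mul, hd.mul, add_comm n, Nat.choose_symm_add]

theorem mul_one (n : ℕ) : d n * d 1 = ((n + 1 : ℕ) : A) * d (n + 1) := by
  rw [hd.mul, Nat.choose_symm_add, Nat.choose_one_right]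

theorem one_pow (m : ℕ) : d 1 ^ m = (m.factorial : A) * d m := by
  induction m with
  | zero => rw [pow_zero, hd.zero, Nat.factorial_zero, Nat.cast_one, _root_.mul_one]
  | succ m ih =>
    rw [pow_succ, ih, mul_assoc, hd.mul_one, ← mul_assoc, Nat.factorial_succ, mul_comm (m + 1),
      Nat.cast_mul]

end Semiring

section CharP

variable {A : Type*} [Ring A] {d : ℕ → A} (hd : IsDividedPowerSeq d) {p : ℕ} [Fact p.Prime]
  [CharP A p]
include hd

theorem mul_of_lt (u : ℕ) {v : ℕ} (hv : v < p) : d v * d (u * p) = d (u * p + v) := by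
  have hchoose : (((v + u * p).choose v : ℕ) : A) = (1 : ℕ) := by
    refine (CharP.natCast_eq_natCast A p).2
      (Choose.choose_modEq_choose_mod_mul_choose_div_nat.trans ?_)
    simp [Nat.mod_eq_of_lt hv, Nat.div_eq_of_lt hv, Nat.ModEq.refl]
  rw [hd.mul, hchoose, Nat.cast_one, one_mul, add_comm]

theorem mul_char_mul (m n : ℕ) :
    d (m * p) * d (n * p) = ((m + n).choose m : A) * d ((m + n) * p) := by
  have hchoose : (((m + n) * p).choose (m * p) : A) = (m + n).choose m := by
    refine (CharP.natCast_eq_natCast A p).2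
      (Choose.choose_modEq_choose_mod_mul_choose_div_nat.trans ?_)
    simp [(Fact.out : p.Prime).pos, Nat.ModEq.refl]
  rw [hd.mul, ← add_mul, hchoose]

theorem one_pow_char : d 1 ^ p = 0 := by
  rw [hd.one_pow, (CharP.cast_eq_zero_iff A p _).2
    (Nat.dvd_factorial (Fact.out : p.Prime).pos le_rfl), zero_mul]

end CharP

end IsDividedPowerSeq

section BaseChange

variable (k : Type*) [Field k]

instance charP_U (p : ℕ) [CharP k p] : CharP (U k) p :=
  have : Nontrivial (U k) := ⟨_, _, (hypBasis k).ne_zero default⟩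
  charP_of_injective_algebraMap (algebraMap k (U k)).injective p

theorem natCast_smul_U (n : ℕ) (u : U k) : (n : k) • u = (n : U k) * u := by
  rw [Nat.cast_smul_eq_nsmul, nsmul_eq_mul]

/-- The map `f ↦ f(H)` from integer-valued polynomials to the hyperalgebra. -/
def hypPoly : intValuedPoly →+* U k :=
  (toU k : UZ →+* U k).comp
    ((((aeval genH : ℂ[X] →ₐ[ℂ] UC) : ℂ[X] →+* UC).comp intValuedPoly.subtype).codRestrict UZ
      fun f => aeval_genH_mem f.2)

theorem hypPoly_binom (c : ℤ) (m : ℕ) : hypPoly k (binom c m) = hypH k c m := rfl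

theorem hypH_zero_right (c : ℤ) : hypH k c 0 = 1 := by
  rw [← hypPoly_binom, binom_zero_right, map_one]

theorem isDividedPowerSeq_hypX : IsDividedPowerSeq (hypX k) where
  zero := by rw [hypX, show intX 0 = 1 from Subtype.ext (divPow_zero _), map_one]
  mul m n := by
    have h : intX m * intX n = ((m + n).choose m : UZ) * intX (m + n) :=
      Subtype.ext (by simpa [intX] using divPow_mul genX m n)
    rw [hypX, hypX, ← map_mul, h, map_mul, map_natCast, hypX]

theorem isDividedPowerSeq_hypY : IsDividedPowerSeq (hypY k) where
  zero := by rw [hypY, show intY 0 = 1 from Subtype.ext (divPow_zero _), map_one]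
  mul m n := by
    have h : intY m * intY n = ((m + n).choose m : UZ) * intY (m + n) :=
      Subtype.ext (by simpa [intY] using divPow_mul genY m n)
    rw [hypY, hypY, ← map_mul, h, map_mul, map_natCast, hypY]

theorem hypX_mul_hypPoly (m : ℕ) (f : intValuedPoly) :
    hypX k m * hypPoly k f = hypPoly k (shift (-2 * m) f) * hypX k m := by
  simp only [hypX, hypPoly, RingHom.comp_apply, RingHom.coe_coe]
  rw [← map_mul, ← map_mul]
  refine congrArg (toU k) (Subtype.ext ?_)
  have h := divPowInt_mul_aeval genX_mul_genH m (f : ℂ[X])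
  rw [divPowInt_natCast] at h
  change divPow genX m * aeval genH (f : ℂ[X]) =
    aeval genH ((f : ℂ[X]).comp (X + C ((-2 * m : ℤ) : ℂ))) * divPow genX m
  push_cast at h ⊢
  exact h

theorem hypY_mul_hypPoly (m : ℕ) (f : intValuedPoly) :
    hypY k m * hypPoly k f = hypPoly k (shift (2 * m) f) * hypY k m := by
  simp only [hypY, hypPoly, RingHom.comp_apply, RingHom.coe_coe]
  rw [← map_mul, ← map_mul]
  refine congrArg (toU k) (Subtype.ext ?_)
  have h := divPowInt_mul_aeval genY_mul_genH m (f : ℂ[X])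
  rw [divPowInt_natCast] at h
  change divPow genY m * aeval genH (f : ℂ[X]) =
    aeval genH ((f : ℂ[X]).comp (X + C ((2 * m : ℤ) : ℂ))) * divPow genY m
  push_cast at h ⊢
  exact h

theorem intX_mul_intY (r s : ℕ) : intX r * intY s =
    ∑ i ∈ Finset.range (r + 1), if i ≤ s then
      intY (s - i) * intH (2 * i - r - s) i * intX (r - i) else 0 := by
  refine Subtype.ext ?_
  have h := divPow_mul_divPow genX_mul_genH genY_mul_genH genX_mul_genY r s
  rw [divPowInt_natCast, divPowInt_natCast] at h
  push_cast
  refine h.trans (Finset.sum_congr rfl fun i hi => ?_)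
  have hir : i ≤ r := Finset.mem_range_succ_iff.1 hi
  split_ifs with his
  · rw [← Nat.cast_sub his, ← Nat.cast_sub hir, divPowInt_natCast, divPowInt_natCast]
    rfl
  · rw [divPowInt_of_neg _ (by omega), zero_mul, zero_mul]
    rfl

theorem hypX_mul_hypY (r s : ℕ) : hypX k r * hypY k s =
    ∑ i ∈ Finset.range (r + 1), if i ≤ s then
      hypY k (s - i) * hypPoly k (binom (2 * i - r - s) i) * hypX k (r - i) else 0 := by
  rw [hypX, hypY, ← map_mul, intX_mul_intY, map_sum]
  refine Finset.sum_congr rfl fun i _ => ?_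
  rw [apply_ite (toU k), map_mul, map_mul, map_zero]
  rfl

variable (p : ℕ) [Fact p.Prime] [CharP k p]

theorem hypPoly_congr {f g : intValuedPoly} (N : ℕ)
    (h : ∀ n : ℕ, N ≤ n → (val n f : ZMod p) = val n g) : hypPoly k f = hypPoly k g := by
  obtain ⟨e, he⟩ := dvd_of_forall_dvd_val (q := p) (f := f - g) N fun n hn => by
    rw [← ZMod.intCast_zmod_eq_zero_iff_dvd, map_sub, Int.cast_sub, h n hn, sub_self]
  rw [← sub_eq_zero, ← map_sub, he, map_mul, map_intCast, Int.cast_natCast,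
    CharP.cast_eq_zero, zero_mul]

theorem frobSplit_hypY_mul_hypPoly_mul_hypX {f F : intValuedPoly} (N : ℕ)
    (h : ∀ n : ℕ, N ≤ n → (val n F : ZMod p) = val ((n : ℤ) / p) f) (m l : ℕ) :
    frobSplit k p (hypY k m * hypPoly k f * hypX k l) =
      hypY k (m * p) * hypPoly k F * hypX k (l * p) := by
  obtain ⟨d, c, rfl⟩ := exists_eq_sum f
  have hF : hypPoly k F = hypPoly k (∑ n ∈ Finset.range d,
      (c n : intValuedPoly) * binom 0 (n * p)) := by
    refine hypPoly_congr k p N fun n hn => ?_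
    rw [h n hn]
    simp only [map_sum, map_mul, map_intCast, val_binom, add_zero, Int.cast_sum, Int.cast_mul]
    refine Finset.sum_congr rfl fun i _ => ?_
    rw [intCast_choose_eq p (Int.natCast_nonneg n)]
    simp [(Fact.out : p.Prime).pos]
  have hsmul (i : ℕ) (u v w : U k) : u * ((c i : U k) * v) * w = (c i : k) • (u * v * w) := by
    rw [← map_intCast (algebraMap k (U k)), ← Algebra.smul_def, mul_smul_comm, smul_mul_assoc]
  simp only [hF, map_sum, map_mul, map_intCast, hypPoly_binom, Finset.mul_sum, Finset.sum_mul,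
    hsmul, map_smul]
  exact Finset.sum_congr rfl fun i _ => congrArg _ (frobSplit_hypMono k p m i l)

end BaseChange

/-! ### Commutation relations -/

section Relations

variable (k : Type*) [Field k]

theorem hypPoly_commute (f g : intValuedPoly) : Commute (hypPoly k f) (hypPoly k g) :=
  (Commute.all f g).map (hypPoly k)

theorem hypYX_commute_hypPoly (f : intValuedPoly) : Commute (hypYX k) (hypPoly k f) := by
  rw [Commute, SemiconjBy, hypYX, mul_assoc, hypX_mul_hypPoly, ← mul_assoc, hypY_mul_hypPoly,
    shift_shift, mul_assoc]
  simp [shift_zero]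

theorem hypX_mul_hypY_one (n : ℕ) : hypX k (n + 1) * hypY k 1 =
    hypY k 1 * hypX k (n + 1) + hypPoly k (binom (-n) 1) * hypX k n := by
  rw [hypX_mul_hypY, ← Finset.sum_subset (Finset.range_mono (show 2 ≤ n + 1 + 1 by omega))
    (fun i _ hi => if_neg fun h => hi (Finset.mem_range.2 (by omega))),
    Finset.sum_range_succ, Finset.sum_range_one]
  simp only [binom_zero_right, map_one, mul_one, (isDividedPowerSeq_hypY k).zero, one_mul, if_pos,
    Nat.zero_le, le_refl, Nat.sub_zero, Nat.sub_self, Nat.add_sub_cancel]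
  congr 5
  push_cast
  ring

theorem hypX_one_mul_hypY (n : ℕ) : hypX k 1 * hypY k (n + 1) =
    hypY k (n + 1) * hypX k 1 + hypY k n * hypPoly k (binom (-n) 1) := by
  rw [hypX_mul_hypY, Finset.sum_range_succ, Finset.sum_range_one]
  simp only [binom_zero_right, map_one, mul_one, (isDividedPowerSeq_hypX k).zero, if_pos,
    Nat.zero_le, le_add_iff_nonneg_left, Nat.sub_zero, Nat.sub_self, Nat.add_sub_cancel]
  congr 5
  push_cast
  ring

theorem hypX_mul_hypYX (n : ℕ) : hypX k n * hypYX k =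
    hypYX k * hypX k n + (n : U k) * hypPoly k (binom (1 - n) 1) * hypX k n := by
  have hX := isDividedPowerSeq_hypX k
  rcases n with _ | n
  · simp [hX.zero]
  · rw [hypYX, ← mul_assoc, hypX_mul_hypY_one, add_mul, mul_assoc, mul_assoc, mul_assoc,
      hX.mul_one n, (hX.commute 1 (n + 1)).eq, ← mul_assoc, ← mul_assoc,
      (Nat.cast_commute (n + 1) (hypPoly k _)).eq]
    congr 5
    push_cast
    ring

theorem hypYX_mul_hypY (n : ℕ) : hypYX k * hypY k n =
    hypY k n * hypYX k + (n : U k) * hypY k n * hypPoly k (binom (1 - n) 1) := by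
  have hY := isDividedPowerSeq_hypY k
  rcases n with _ | n
  · simp [hY.zero]
  · rw [hypYX, mul_assoc, hypX_one_mul_hypY, mul_add, ← mul_assoc, ← mul_assoc, ← mul_assoc,
      (hY.commute 1 n).eq, hY.mul_one n, (hY.commute 1 (n + 1)).eq]
    congr 5
    push_cast
    ring

theorem adjoin_range_hypX_union_range_hypY :
    Algebra.adjoin k (Set.range (hypX k) ∪ Set.range (hypY k)) = ⊤ := by
  set S := Algebra.adjoin k (Set.range (hypX k) ∪ Set.range (hypY k))
  have hZ : UZ ≤ Subring.map UZ.subtype (S.toSubring.comap (toU k : UZ →+* U k)) := by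
    refine Subring.closure_le.2 ?_
    rintro _ (⟨m, rfl⟩ | ⟨m, rfl⟩)
    · exact ⟨intX m, Algebra.subset_adjoin (Or.inl ⟨m, rfl⟩), rfl⟩
    · exact ⟨intY m, Algebra.subset_adjoin (Or.inr ⟨m, rfl⟩), rfl⟩
  refine Algebra.eq_top_iff.2 fun u => ?_
  induction u using TensorProduct.induction_on with
  | zero => exact zero_mem S
  | add u v hu hv => exact add_mem hu hv
  | tmul c w =>
    obtain ⟨w', hw', hww'⟩ := hZ w.2
    obtain rfl : w' = w := Subtype.ext hww'
    have htmul : c ⊗ₜ[ℤ] w' = c • toU k w' := by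
      rw [toU, Algebra.TensorProduct.includeRight_apply, TensorProduct.smul_tmul', smul_eq_mul,
        mul_one]
    exact htmul ▸ S.smul_mem hw' c

end Relations

/-! ### The splitting map and the elements `μ_a` -/

section FrobSplit

variable (k : Type*) [Field k] (p : ℕ)

theorem mu_eq_hypPoly (a : ℤ) : mu k p a = hypPoly k (binom (-a - 1) (p - 1)) := rfl

theorem mu_commute_hypPoly (a : ℤ) (f : intValuedPoly) : Commute (mu k p a) (hypPoly k f) :=
  mu_eq_hypPoly k p a ▸ hypPoly_commute k _ f

theorem hypX_mul_mu (m : ℕ) (a : ℤ) : hypX k m * mu k p a = mu k p (a + 2 * m) * hypX k m := by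
  rw [mu_eq_hypPoly, hypX_mul_hypPoly, shift_binom, mu_eq_hypPoly]
  congr 3
  ring

theorem hypY_mul_mu (m : ℕ) (a : ℤ) : hypY k m * mu k p (a + 2 * m) = mu k p a * hypY k m := by
  rw [mu_eq_hypPoly, hypY_mul_hypPoly, shift_binom, mu_eq_hypPoly]
  congr 3
  ring

theorem frobSplit_commute {u : U k} (hX : ∀ m, Commute (hypX k (m * p)) u)
    (hY : ∀ m, Commute (hypY k (m * p)) u) (hH : ∀ f, Commute (hypPoly k f) u) (z : U k) :
    Commute (frobSplit k p z) u := by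
  suffices h : (LinearMap.mulRight k u).comp (frobSplit k p) =
      (LinearMap.mulLeft k u).comp (frobSplit k p) from LinearMap.congr_fun h z
  refine (hypBasis k).ext fun ⟨m, n, l⟩ => ?_
  rw [LinearMap.comp_apply, LinearMap.comp_apply, hypBasis_apply, frobSplit_hypMono]
  exact ((hY m).mul_left (hH (binom 0 (n * p)))).mul_left (hX l)

theorem frobSplit_hypX (m : ℕ) : frobSplit k p (hypX k m) = hypX k (m * p) := by
  simpa [hypMono, (isDividedPowerSeq_hypY k).zero, hypH_zero_right] using
    frobSplit_hypMono k p 0 0 m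

theorem frobSplit_hypY (m : ℕ) : frobSplit k p (hypY k m) = hypY k (m * p) := by
  simpa [hypMono, (isDividedPowerSeq_hypX k).zero, hypH_zero_right] using
    frobSplit_hypMono k p m 0 0

theorem frobSplit_one : frobSplit k p 1 = 1 := by
  simpa [(isDividedPowerSeq_hypX k).zero] using frobSplit_hypX k p 0

theorem frobSplit_commute_hypYX [CharP k p] (z : U k) : Commute (frobSplit k p z) (hypYX k) := by
  refine frobSplit_commute k p (fun m => ?_) (fun m => ?_)
    (fun f => (hypYX_commute_hypPoly k f).symm) z
  · rw [Commute, SemiconjBy, hypX_mul_hypYX, Nat.cast_mul, CharP.cast_eq_zero (U k) p, mul_zero,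
      zero_mul, zero_mul, add_zero]
  · rw [Commute, SemiconjBy, hypYX_mul_hypY, Nat.cast_mul, CharP.cast_eq_zero (U k) p, mul_zero,
      zero_mul, zero_mul, add_zero]

end FrobSplit

section Mu

theorem natCast_choose_pred (p : ℕ) [Fact p.Prime] (t : ℕ) :
    ((t.choose (p - 1) : ℕ) : ZMod p) = if p ∣ t + 1 then 1 else 0 := by
  have hp := (Fact.out : p.Prime).pos
  have hlucas := (ZMod.natCast_eq_natCast_iff _ _ p).2
    (Choose.choose_modEq_choose_mod_mul_choose_div_nat (n := t) (k := p - 1) (p := p))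
  rw [Nat.mod_eq_of_lt (Nat.sub_one_lt hp.ne'), Nat.div_eq_of_lt (Nat.sub_one_lt hp.ne'),
    Nat.choose_zero_right, mul_one] at hlucas
  have hdvd : p ∣ t + 1 ↔ p ∣ t % p + 1 := by
    rw [← Nat.mod_add_div t p, add_right_comm, Nat.dvd_add_left (Dvd.intro _ rfl)]
    simp
  have hlt := Nat.mod_lt t hp
  rw [hlucas]
  split_ifs with h
  · have := Nat.le_of_dvd (Nat.succ_pos _) (hdvd.1 h)
    rw [show t % p = p - 1 by omega, Nat.choose_self, Nat.cast_one]
  · have hne : t % p ≠ p - 1 := fun he => h (hdvd.2 (by rw [he, Nat.sub_add_cancel hp]))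
    rw [Nat.choose_eq_zero_of_lt (by omega), Nat.cast_zero]

variable (k : Type*) [Field k] (p : ℕ) [Fact p.Prime]

theorem val_mu (a : ℤ) {n : ℕ} (hn : a < n) :
    (val n (binom (-a - 1) (p - 1)) : ZMod p) = if (n : ZMod p) = a then 1 else 0 := by
  obtain ⟨t, ht⟩ := Int.eq_ofNat_of_zero_le (show 0 ≤ (n : ℤ) + (-a - 1) by omega)
  have hdvd : p ∣ t + 1 ↔ (n : ZMod p) = a := by
    rw [← CharP.cast_eq_zero_iff (ZMod p), ← sub_eq_zero (a := (n : ZMod p))]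
    have := congrArg (Int.cast : ℤ → ZMod p) ht
    push_cast at this ⊢
    rw [← this]
    ring_nf
  rw [val_binom, ht, Ring.choose_natCast]
  simp only [Int.cast_natCast, natCast_choose_pred, hdvd]

variable [CharP k p]

theorem hypPoly_mul_mu_congr {f g : intValuedPoly} (a : ℤ) (N : ℕ)
    (h : ∀ n : ℕ, N ≤ n → (n : ZMod p) = a → (val n f : ZMod p) = val n g) :
    hypPoly k f * mu k p a = hypPoly k g * mu k p a := by
  rw [mu_eq_hypPoly, ← map_mul, ← map_mul]
  refine hypPoly_congr k p (max N (a.toNat + 1)) fun n hn => ?_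
  rw [map_mul, map_mul, Int.cast_mul, Int.cast_mul, val_mu p a (by omega)]
  split_ifs with hna
  · rw [h n (by omega) hna]
  · rw [mul_zero, mul_zero]

theorem mu_congr {a b : ℤ} (h : (a : ZMod p) = b) : mu k p a = mu k p b := by
  rw [mu_eq_hypPoly, mu_eq_hypPoly]
  refine hypPoly_congr k p (max (a.toNat + 1) (b.toNat + 1)) fun n hn => ?_
  rw [val_mu p a (by omega), val_mu p b (by omega), h]

theorem mu_mul_self (a : ℤ) : mu k p a * mu k p a = mu k p a := by
  have h := hypPoly_mul_mu_congr k p (f := binom (-a - 1) (p - 1)) (g := 1) a (a.toNat + 1)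
    fun n hn hna => by rw [val_mu p a (by omega), if_pos hna, map_one, Int.cast_one]
  rwa [map_one, one_mul] at h

theorem frobSplit_commute_mu (a : ℤ) (z : U k) : Commute (frobSplit k p z) (mu k p a) := by
  refine frobSplit_commute k p (fun m => ?_) (fun m => ?_)
    (fun f => (mu_commute_hypPoly k p a f).symm) z
  · rw [Commute, SemiconjBy, hypX_mul_mu, mu_congr k p (b := a) (by simp)]
  · rw [Commute, SemiconjBy, ← hypY_mul_mu, mu_congr k p (a := a + _) (b := a) (by simp)]

theorem hypPoly_binom_mul_mu_eq_zero (b : ℕ) {c : ℤ} {j : ℕ} (hj : b % p < j % p)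
    (hc : (c : ZMod p) = 0) : hypPoly k (binom c j) * mu k p b = 0 := by
  have h := hypPoly_mul_mu_congr k p (f := binom c j) (g := 0) b c.natAbs fun n hn hnb => by
    have hmod : ((n : ℤ) + c) % p = (b % p : ℕ) := by
      rw [Int.natCast_mod, ← ZMod.intCast_eq_intCast_iff']
      push_cast at hnb ⊢
      rw [hnb, hc, add_zero]
    rw [map_zero, val_binom, intCast_choose_eq p (by omega), hmod, Ring.choose_natCast,
      Nat.choose_eq_zero_of_lt hj, Nat.cast_zero, Int.cast_zero, zero_mul]
  rwa [map_zero, zero_mul] at h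

end Mu

/-! ### Multiplicativity of the splitting map -/

theorem exists_mul_sub_eq {p j s : ℕ} (hj : j ≤ s * p) (h : 0 < j % p) :
    ∃ u, s * p - j = u * p + (p - j % p) := by
  have hp : 0 < p := Nat.pos_of_ne_zero fun h0 => by
    rw [h0, Nat.mod_zero] at h
    rw [h0, mul_zero] at hj
    omega
  have hlt := Nat.mod_lt j hp
  have hdiv := Nat.div_add_mod' j p
  obtain ⟨d, rfl⟩ : ∃ d, s = j / p + d + 1 := by
    refine Nat.exists_eq_add_of_lt (not_le.1 fun hs => ?_)
    have := Nat.mul_le_mul_right p hs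
    omega
  refine ⟨d, ?_⟩
  have : (j / p + d + 1) * p = j / p * p + d * p + p := by ring
  omega

section FrobSplitMul

variable (k : Type*) [Field k] (p : ℕ)

/-- The terms of the commutation formula `hypX_mul_hypY` for `X^(rp) Y^(sp)` whose index is
divisible by `p`; they are the image under `Fr'` of the formula for `X^(r) Y^(s)`. -/
def stretchedCommutator (r s : ℕ) : U k :=
  ∑ i ∈ Finset.range (r + 1), if i ≤ s then
    hypY k ((s - i) * p) * hypPoly k (binom ((2 * i - r - s) * p) (i * p)) * hypX k ((r - i) * p)
  else 0

variable [Fact p.Prime]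

theorem intCast_choose_add_mul {z c : ℤ} (h : 0 ≤ z + c * p) (m : ℕ) :
    ((Ring.choose (z + c * p) (m * p) : ℤ) : ZMod p) = (Ring.choose (z / p + c) m : ℤ) := by
  have hp := (Fact.out : p.Prime)
  rw [intCast_choose_eq p h, Nat.mul_mod_left, Ring.choose_zero_right, Int.cast_one, one_mul,
    Nat.mul_div_cancel _ hp.pos, Int.add_mul_ediv_right _ _ (by exact_mod_cast hp.ne_zero)]

variable [CharP k p]

theorem frobSplit_hypX_mul_hypMono (r s n l : ℕ) :
    frobSplit k p (hypX k r * hypMono k (s, n, l)) =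
      stretchedCommutator k p r s * (hypPoly k (binom 0 (n * p)) * hypX k (l * p)) := by
  have hX := isDividedPowerSeq_hypX k
  have hmono : hypX k r * hypMono k (s, n, l) = hypX k r * hypY k s *
      (hypPoly k (binom 0 n) * hypX k l) := by
    simp only [hypMono, hypPoly_binom, mul_assoc]
  have hmove (y x : U k) (f g : intValuedPoly) (m : ℕ) :
      y * hypPoly k f * hypX k m * (hypPoly k g * x) =
        y * hypPoly k (f * shift (-2 * m) g) * (hypX k m * x) := by
    rw [← mul_assoc, mul_assoc _ (hypX k m), hypX_mul_hypPoly, map_mul]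
    simp only [mul_assoc]
  rw [hmono, hypX_mul_hypY, stretchedCommutator, Finset.sum_mul, Finset.sum_mul, map_sum]
  refine Finset.sum_congr rfl fun i hi => ?_
  split_ifs with his
  swap
  · rw [zero_mul, zero_mul, map_zero]
  rw [hmove, hmove, hX.mul, hX.mul_char_mul, ← natCast_smul_U, ← natCast_smul_U, mul_smul_comm,
    mul_smul_comm, map_smul]
  congr 1
  refine frobSplit_hypY_mul_hypPoly_mul_hypX k p (2 * (r * p) + s * p) (fun t ht => ?_) _ _
  have hir : (i : ℤ) ≤ r := by exact_mod_cast Finset.mem_range_succ_iff.1 hi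
  have hp : (0 : ℤ) ≤ p := Int.natCast_nonneg p
  have ht : (2 * (r * p) + s * p : ℤ) ≤ t := by exact_mod_cast ht
  have hshift : (t : ℤ) + -2 * ((r - i : ℕ) * p : ℕ) = t + (-2 * (r - i : ℕ)) * p := by
    push_cast
    ring
  simp only [map_mul, val_shift, val_binom, add_zero, Int.cast_mul]
  rw [hshift, intCast_choose_add_mul, intCast_choose_add_mul]
  · rw [Nat.cast_sub (Finset.mem_range_succ_iff.1 hi)]
    nlinarith [hir, hp, ht]
  · nlinarith [hir, hp, ht]

theorem frobSplit_hypY_mul (m : ℕ) (z : U k) :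
    frobSplit k p (hypY k m * z) = hypY k (m * p) * frobSplit k p z := by
  have hY := isDividedPowerSeq_hypY k
  suffices h : (frobSplit k p).comp (LinearMap.mulLeft k (hypY k m)) =
      (LinearMap.mulLeft k (hypY k (m * p))).comp (frobSplit k p) from LinearMap.congr_fun h z
  refine (hypBasis k).ext fun ⟨s, n, l⟩ => ?_
  have hmono : hypY k m * hypMono k (s, n, l) =
      ((m + s).choose m : k) • hypMono k (m + s, n, l) := by
    simp only [hypMono]
    rw [← mul_assoc, ← mul_assoc, hY.mul, natCast_smul_U]
    simp only [mul_assoc]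
  simp only [LinearMap.comp_apply, LinearMap.mulLeft_apply, hypBasis_apply, hmono, map_smul,
    frobSplit_hypMono]
  simp only [hypMono]
  rw [← mul_assoc, ← mul_assoc, hY.mul_char_mul, natCast_smul_U]
  simp only [mul_assoc]

variable {k p} {G : U k} {b : ℕ} (hμ : mu k p b * G = G)
  (hG : ∀ v, p - b % p ≤ v → v < p → hypY k v * hypX k v * G = 0)
include hμ hG

theorem hypY_mul_hypPoly_mul_hypX_mul_eq_zero_of_lt {c : ℤ} {j v : ℕ} (hvp : v < p)
    (hj : j % p + v = p) (hc : (c : ZMod p) = 2 * j) :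
    hypY k v * hypPoly k (binom c j) * hypX k v * G = 0 := by
  rw [hypY_mul_hypPoly, shift_binom, mul_assoc, mul_assoc, ← mul_assoc (hypY k v)]
  rcases le_or_gt (p - b % p) v with hbv | hbv
  · rw [hG v hbv hvp, mul_zero]
  have hweight : hypY k v * hypX k v * G = mu k p b * (hypY k v * hypX k v * G) := by
    conv_lhs => rw [← hμ]
    rw [← mul_assoc, mul_assoc (hypY k v), hypX_mul_mu, ← mul_assoc, hypY_mul_mu]
    simp only [mul_assoc]
  have hv : (v : ZMod p) = -j := by
    have := congrArg (Nat.cast : ℕ → ZMod p) hj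
    rw [Nat.cast_add, ZMod.natCast_mod, CharP.cast_eq_zero (ZMod p) p] at this
    linear_combination this
  rw [hweight, ← mul_assoc, hypPoly_binom_mul_mu_eq_zero k p b (by omega), zero_mul]
  push_cast
  rw [hc, hv]
  ring

theorem hypY_mul_hypPoly_mul_hypX_mul_eq_zero (hX : ∀ m, Commute (hypX k (m * p)) G)
    (u u' : ℕ) {c : ℤ} {j v : ℕ} (hvp : v < p) (hj : j % p + v = p)
    (hc : (c : ZMod p) = 2 * j) :
    hypY k (u * p + v) * hypPoly k (binom c j) * hypX k (u' * p + v) * G = 0 := by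
  rw [← (isDividedPowerSeq_hypY k).mul_of_lt u hvp, ← (isDividedPowerSeq_hypX k).mul_of_lt u' hvp,
    ((isDividedPowerSeq_hypY k).commute v (u * p)).eq]
  calc _ = hypY k (u * p) * (hypY k v * hypPoly k (binom c j) * hypX k v *
        (hypX k (u' * p) * G)) := by simp only [mul_assoc]
    _ = hypY k (u * p) * (hypY k v * hypPoly k (binom c j) * hypX k v * G *
        hypX k (u' * p)) := by rw [(hX u').eq]; simp only [mul_assoc]
    _ = 0 := by
      rw [hypY_mul_hypPoly_mul_hypX_mul_eq_zero_of_lt hμ hG hvp hj hc, zero_mul, mul_zero]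

theorem hypX_mul_hypY_mul_eq_stretchedCommutator_mul (hX : ∀ m, Commute (hypX k (m * p)) G)
    (r s : ℕ) :
    hypX k (r * p) * hypY k (s * p) * G = stretchedCommutator k p r s * G := by
  have hp := (Fact.out : p.Prime)
  rw [hypX_mul_hypY, stretchedCommutator, Finset.sum_mul, Finset.sum_mul]
  refine (Finset.sum_of_injOn (fun i => i * p)
    (fun i _ j _ h => Nat.eq_of_mul_eq_mul_right hp.pos h) (fun i hi => ?_) (fun j hj hj' => ?_)
    fun i _ => ?_).symm
  · exact Finset.mem_coe.2 (Finset.mem_range_succ_iff.2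
      (Nat.mul_le_mul_right p (Finset.mem_range_succ_iff.1 hi)))
  · split_ifs with hjs
    · have hjr : j ≤ r * p := Finset.mem_range_succ_iff.1 hj
      have hpos : 0 < j % p := by
        refine Nat.pos_of_ne_zero fun h0 => hj' ?_
        obtain ⟨i, rfl⟩ := Nat.dvd_of_mod_eq_zero h0
        exact ⟨i, Finset.mem_range_succ_iff.2 (Nat.le_of_mul_le_mul_left
          (mul_comm r p ▸ hjr) hp.pos), mul_comm _ _⟩
      have hlt := Nat.mod_lt j hp.pos
      obtain ⟨u, hu⟩ := exists_mul_sub_eq hjs hpos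
      obtain ⟨u', hu'⟩ := exists_mul_sub_eq hjr hpos
      rw [hu, hu']
      exact hypY_mul_hypPoly_mul_hypX_mul_eq_zero hμ hG hX _ _ (by omega) (by omega) (by simp)
    · rw [zero_mul]
  · simp only [Nat.mul_le_mul_right_iff hp.pos, Nat.sub_mul]
    split_ifs
    · congr 6
      push_cast
      ring
    · rfl

theorem frobSplit_hypX_mul (hz : ∀ z, Commute (frobSplit k p z) G) (r : ℕ) (z : U k) :
    hypX k (r * p) * frobSplit k p z * G = frobSplit k p (hypX k r * z) * G := by
  suffices h : (LinearMap.mulRight k G).comp ((LinearMap.mulLeft k (hypX k (r * p))).comp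
      (frobSplit k p)) = (LinearMap.mulRight k G).comp ((frobSplit k p).comp
        (LinearMap.mulLeft k (hypX k r))) from LinearMap.congr_fun h z
  refine (hypBasis k).ext fun ⟨s, n, l⟩ => ?_
  simp only [LinearMap.comp_apply, LinearMap.mulLeft_apply, LinearMap.mulRight_apply,
    hypBasis_apply, frobSplit_hypMono]
  have hcomm : Commute (hypPoly k (binom 0 (n * p)) * hypX k (l * p)) G := by
    have := hz (hypMono k (0, n, l))
    rwa [frobSplit_hypMono, hypMono, zero_mul, (isDividedPowerSeq_hypY k).zero, one_mul] at this
  rw [frobSplit_hypX_mul_hypMono, mul_assoc (stretchedCommutator k p r s) _ G, hcomm.eq,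
    ← mul_assoc (stretchedCommutator k p r s), ← hypX_mul_hypY_mul_eq_stretchedCommutator_mul hμ hG
      fun m => frobSplit_hypX k p m ▸ hz (hypX k m), mul_assoc _ G, ← hcomm.eq]
  simp only [hypMono, hypPoly_binom, mul_assoc]

theorem frobSplit_mul (hz : ∀ z, Commute (frobSplit k p z) G) (z z' : U k) :
    frobSplit k p z * frobSplit k p z' * G = frobSplit k p (z * z') * G := by
  have hmem : z ∈ Algebra.adjoin k (Set.range (hypX k) ∪ Set.range (hypY k)) :=
    adjoin_range_hypX_union_range_hypY k ▸ Algebra.mem_top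
  induction hmem using Algebra.adjoin_induction generalizing z' with
  | mem z hmem =>
    rcases hmem with ⟨r, rfl⟩ | ⟨r, rfl⟩
    · rw [frobSplit_hypX, frobSplit_hypX_mul hμ hG hz]
    · rw [frobSplit_hypY, frobSplit_hypY_mul]
  | algebraMap c =>
    rw [Algebra.algebraMap_eq_smul_one, smul_one_mul, map_smul, map_smul, frobSplit_one,
      smul_one_mul]
  | add u v _ _ hu hv => rw [map_add, add_mul, add_mul, hu, hv, add_mul, map_add, add_mul]
  | mul u v _ _ hu hv =>
    calc frobSplit k p (u * v) * frobSplit k p z' * G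
        = frobSplit k p u * frobSplit k p v * G * frobSplit k p z' := by
          rw [mul_assoc, (hz z').eq, ← mul_assoc, hu]
      _ = frobSplit k p u * (frobSplit k p v * frobSplit k p z' * G) := by
          rw [mul_assoc, ← (hz z').eq]
          simp only [mul_assoc]
      _ = frobSplit k p (u * v * z') * G := by
          rw [hv, ← mul_assoc, hu, mul_assoc u]

end FrobSplitMul

/-! ### Polynomials in `Y X` -/

section Coordinates

variable (k : Type*) [Field k]

theorem repr_hypMono (i j : ℕ × ℕ × ℕ) :
    (hypBasis k).repr (hypMono k i) j = if i = j then 1 else 0 := by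
  rw [← hypBasis_apply, Module.Basis.repr_self, Finsupp.single_apply]

theorem hypH_eq_sum (c : ℤ) (m : ℕ) : hypH k c m =
    ∑ i ∈ Finset.HasAntidiagonal.antidiagonal m, ((Ring.choose c i.2 : ℤ) : k) • hypH k 0 i.1 := by
  have vandermonde : binom c m = ∑ i ∈ Finset.HasAntidiagonal.antidiagonal m,
      ((Ring.choose c i.2 : ℤ) : intValuedPoly) * binom 0 i.1 := by
    refine ext_val fun n => ?_
    simp only [map_sum, map_mul, map_intCast, val_binom, add_zero, Int.cast_id]
    rw [Ring.add_choose_eq _ (Commute.all _ _)]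
    exact Finset.sum_congr rfl fun i _ => mul_comm _ _
  rw [← hypPoly_binom, vandermonde, map_sum]
  refine Finset.sum_congr rfl fun i _ => ?_
  rw [map_mul, map_intCast, hypPoly_binom, ← map_intCast (algebraMap k (U k)), ← Algebra.smul_def]

theorem repr_hypY_mul_hypH_mul_hypX (c : ℤ) (m m' q : ℕ) :
    (hypBasis k).repr (hypY k m * hypH k c q * hypX k m) (m', q, m') =
      if m = m' then 1 else 0 := by
  have hmono : ∀ n, hypY k m * hypH k 0 n * hypX k m = hypMono k (m, n, m) := fun _ => rfl
  simp only [hypH_eq_sum k c, Finset.mul_sum, Finset.sum_mul, mul_smul_comm, smul_mul_assoc, hmono,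
    map_sum, map_smul, Finsupp.finsetSum_apply, Finsupp.smul_apply, repr_hypMono]
  rw [Finset.sum_eq_single_of_mem (q, 0) (Finset.HasAntidiagonal.mem_antidiagonal.2 (add_zero q))]
  · simp
  · rintro ⟨i, j⟩ hi hij
    rw [if_neg, smul_zero]
    simp only [Prod.mk.injEq]
    rintro ⟨-, rfl, -⟩
    exact hij (by simpa using Finset.HasAntidiagonal.mem_antidiagonal.1 hi)

theorem repr_hypY_mul_hypX_mul_mu (p : ℕ) (a : ℤ) (m m' : ℕ) :
    (hypBasis k).repr (hypY k m * hypX k m * mu k p a) (m', p - 1, m') =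
      if m = m' then 1 else 0 := by
  rw [mul_assoc, hypX_mul_mu, ← mul_assoc]
  exact repr_hypY_mul_hypH_mul_hypX k _ m m' (p - 1)

theorem hypY_pow_mul_hypX_pow (m : ℕ) :
    hypY k 1 ^ m * hypX k 1 ^ m = (m.factorial * m.factorial : k) • (hypY k m * hypX k m) := by
  rw [(isDividedPowerSeq_hypX k).one_pow, (isDividedPowerSeq_hypY k).one_pow, ← natCast_smul_U,
    ← natCast_smul_U, smul_mul_smul_comm]

theorem hypX_pow_mul_mu (p m : ℕ) (a : ℤ) :
    hypX k 1 ^ m * mu k p a = mu k p (a + 2 * m) * hypX k 1 ^ m := by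
  rw [(isDividedPowerSeq_hypX k).one_pow, mul_assoc, hypX_mul_mu, ← mul_assoc,
    (Nat.cast_commute _ _).eq, mul_assoc]

theorem hypY_pow_mul_mu (p m : ℕ) (a : ℤ) :
    hypY k 1 ^ m * mu k p (a + 2 * m) = mu k p a * hypY k 1 ^ m := by
  rw [(isDividedPowerSeq_hypY k).one_pow, mul_assoc, hypY_mul_mu, ← mul_assoc,
    (Nat.cast_commute _ _).eq, mul_assoc]

theorem factorial_cast_ne_zero {p : ℕ} [Fact p.Prime] [CharP k p] {m : ℕ} (hm : m < p) :
    (m.factorial : k) ≠ 0 := by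
  rwa [Ne, CharP.cast_eq_zero_iff k p, (Fact.out : p.Prime).dvd_factorial, not_le]

end Coordinates

section EvalYX

variable (k : Type*) [Field k] (p : ℕ) [Fact p.Prime] [CharP k p]

/-- Evaluation of polynomials over the prime field at `Y X`. -/
def evalYX : (ZMod p)[X] →+* U k :=
  ((aeval (hypYX k) : k[X] →ₐ[k] U k) : k[X] →+* U k).comp (mapRingHom (ofPrime p k))

theorem evalYX_apply (f : (ZMod p)[X]) : evalYX k p f = aeval (hypYX k) (f.map (ofPrime p k)) := rfl

theorem evalYX_X : evalYX k p X = hypYX k := by rw [evalYX_apply, map_X, aeval_X]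

theorem evalYX_C (c : ZMod p) : evalYX k p (C c) = algebraMap k (U k) (ofPrime p k c) := by
  rw [evalYX_apply, map_C, aeval_C]

theorem evalYX_C_mul (c : ZMod p) (f : (ZMod p)[X]) :
    evalYX k p (C c * f) = ofPrime p k c • evalYX k p f := by
  rw [map_mul, evalYX_C, ← Algebra.smul_def]

theorem evalYX_C_intCast (n : ℤ) : evalYX k p (C (n : ZMod p)) = (n : U k) := by
  rw [evalYX_C, map_intCast, map_intCast]

variable {k} in
theorem commute_evalYX {u : U k} (h : Commute u (hypYX k)) (f : (ZMod p)[X]) :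
    Commute u (evalYX k p f) := by
  rw [evalYX_apply]
  exact semiconj_aeval h _

theorem mu_commute_evalYX (a : ℤ) (f : (ZMod p)[X]) : Commute (mu k p a) (evalYX k p f) :=
  commute_evalYX p (commute_mu_hypYX p k a) f

theorem hypPoly_binom_mul_mu (b : ℤ) : hypPoly k (binom 0 1) * mu k p b = (b : U k) * mu k p b := by
  have h := hypPoly_mul_mu_congr k p (f := binom 0 1) (g := (b : intValuedPoly)) b 0 fun n _ h => by
    rw [map_intCast, Int.cast_id, val_binom, add_zero, Ring.choose_one_right, ← h, Int.cast_natCast]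
  rwa [map_intCast] at h

theorem hypX_one_mul_hypYX_mul_mu (a : ℤ) :
    hypX k 1 * hypYX k * mu k p a =
      evalYX k p (X + C ((a + 2 : ℤ) : ZMod p)) * hypX k 1 * mu k p a := by
  rw [hypX_mul_hypYX, map_add, evalYX_X, evalYX_C_intCast, add_mul, add_mul, add_mul]
  simp only [Nat.cast_one, sub_self, one_mul]
  congr 1
  rw [mul_assoc, hypX_mul_mu, ← mul_assoc, hypPoly_binom_mul_mu, mul_assoc _ (hypX k 1),
    hypX_mul_mu, ← mul_assoc, Nat.cast_one, mul_one]

theorem hypX_one_mul_evalYX_mul_mu (f : (ZMod p)[X]) (a : ℤ) :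
    hypX k 1 * evalYX k p f * mu k p a =
      evalYX k p (taylor ((a + 2 : ℤ) : ZMod p) f) * hypX k 1 * mu k p a := by
  have hX : SemiconjBy (hypX k 1 * mu k p a) (hypYX k)
      (evalYX k p (X + C ((a + 2 : ℤ) : ZMod p))) := by
    rw [SemiconjBy, mul_assoc, (commute_mu_hypYX p k a).eq, ← mul_assoc, hypX_one_mul_hypYX_mul_mu,
      mul_assoc]
  have hf := semiconj_aeval hX (f.map (ofPrime p k))
  rw [evalYX_apply, ← aeval_comp, ← Polynomial.map_comp, ← taylor_apply, ← evalYX_apply,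
    ← evalYX_apply, SemiconjBy] at hf
  rw [mul_assoc, ← (mu_commute_evalYX k p a f).eq, ← mul_assoc, hf, mul_assoc]

theorem hypX_one_mul_hypY_one : hypX k 1 * hypY k 1 = hypYX k + hypPoly k (binom 0 1) := by
  rw [hypX_mul_hypY_one k 0, (isDividedPowerSeq_hypX k).zero, mul_one, Nat.cast_zero, neg_zero]
  rfl

omit [CharP k p] in
theorem taylor_phi_succ (a : ℤ) (s : ℕ) :
    taylor (((s + 1 : ℕ) : ZMod p) * ((s + 1 : ℕ) + a + 1)) (phi p a (s + 1)) =
      taylor ((a + 2 * s + 2 : ℤ) : ZMod p) (taylor ((s : ZMod p) * (s + a + 1)) (phi p a s)) *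
        (X + C ((a + 2 * s + 2 : ℤ) : ZMod p)) := by
  rw [taylor_taylor, phi, Finset.prod_range_succ, ← phi, taylor_mul, map_sub, taylor_X, taylor_C,
    add_sub_assoc, ← C_sub]
  congr 3 <;> push_cast <;> ring

theorem hypX_pow_mul_hypY_pow_mul_mu (s : ℕ) (a : ℤ) :
    hypX k 1 ^ s * hypY k 1 ^ s * mu k p (a + 2 * s) =
      evalYX k p (taylor ((s : ZMod p) * (s + a + 1)) (phi p a s)) * mu k p (a + 2 * s) := by
  induction s with
  | zero => simp [phi]
  | succ s ih =>
    set F := taylor ((s : ZMod p) * (s + a + 1)) (phi p a s)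
    set c := a + 2 * s + 2
    have hc : a + 2 * ((s + 1 : ℕ) : ℤ) = c := by push_cast; ring
    have hY : hypY k 1 * mu k p c = mu k p (a + 2 * s) * hypY k 1 := hypY_mul_mu k p 1 (a + 2 * s)
    have hXY : hypX k 1 * hypY k 1 * mu k p c =
        evalYX k p (X + C (c : ZMod p)) * mu k p c := by
      rw [hypX_one_mul_hypY_one, map_add, evalYX_X, evalYX_C_intCast, add_mul, add_mul,
        hypPoly_binom_mul_mu]
    rw [hc, taylor_phi_succ, map_mul]
    calc hypX k 1 ^ (s + 1) * hypY k 1 ^ (s + 1) * mu k p c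
        = hypX k 1 * (hypX k 1 ^ s * hypY k 1 ^ s * (hypY k 1 * mu k p c)) := by
          rw [pow_succ', pow_succ]
          simp only [mul_assoc]
      _ = hypX k 1 * evalYX k p F * mu k p (a + 2 * s) * hypY k 1 := by
          rw [hY, ← mul_assoc (_ * _), ih]
          simp only [mul_assoc]
      _ = evalYX k p (taylor (c : ZMod p) F) * (hypX k 1 * hypY k 1 * mu k p c) := by
          rw [hypX_one_mul_evalYX_mul_mu, mul_assoc, mul_assoc, ← hY]
          simp only [mul_assoc, c]
      _ = _ := by rw [hXY, mul_assoc]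

theorem evalYX_phi_mul_mu (a : ℤ) (m : ℕ) :
    evalYX k p (phi p a m) * mu k p a = hypY k 1 ^ m * hypX k 1 ^ m * mu k p a :=
  (hypY_pow_mul_hypX_pow_mul_mu p k a m).symm

theorem evalYX_mul_mu_eq_zero {f : (ZMod p)[X]} {a : ℤ} (h : phi p a p ∣ f) :
    evalYX k p f * mu k p a = 0 := by
  obtain ⟨g, rfl⟩ := h
  rw [mul_comm, map_mul, mul_assoc, evalYX_phi_mul_mu, (isDividedPowerSeq_hypX k).one_pow_char,
    mul_zero, zero_mul, mul_zero]

theorem repr_evalYX_phi_mul_mu (a : ℤ) (m m' : ℕ) :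
    (hypBasis k).repr (evalYX k p (phi p a m) * mu k p a) (m', p - 1, m') =
      if m = m' then (m.factorial * m.factorial : k) else 0 := by
  rw [evalYX_phi_mul_mu, hypY_pow_mul_hypX_pow, smul_mul_assoc, map_smul, Finsupp.smul_apply,
    repr_hypY_mul_hypX_mul_mu, smul_eq_mul, mul_ite, mul_one, mul_zero]

theorem eq_zero_of_evalYX_mul_mu {f : (ZMod p)[X]} {a : ℤ} (hf : f.natDegree < p)
    (h : evalYX k p f * mu k p a = 0) : f = 0 := by
  obtain ⟨d, hd⟩ := exists_newton p a p 0 f (zero_add p).ge hf (by simp [phi])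
  rw [hd] at h ⊢
  refine Finset.sum_eq_zero fun m hm => ?_
  have hcoord := congrArg (fun u => (hypBasis k).repr u (m, p - 1, m)) h
  simp only [map_sum, Finset.sum_mul, evalYX_C_mul, smul_mul_assoc, map_smul,
    Finsupp.finsetSum_apply, Finsupp.smul_apply, repr_evalYX_phi_mul_mu, smul_eq_mul, mul_ite,
    mul_zero, map_zero, Finsupp.zero_apply, Finset.sum_ite_eq', hm, if_true] at hcoord
  have hm! := factorial_cast_ne_zero k (Finset.mem_Ico.1 hm).2
  have hdm : d m = 0 := by simpa [hm!] using hcoord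
  rw [hdm, C_0, zero_mul]

theorem phi_dvd_phi (a : ℤ) {m n : ℕ} (h : m ≤ n) : phi p a m ∣ phi p a n :=
  Finset.prod_dvd_prod_of_subset _ _ _ (Finset.range_mono h)

theorem hypY_mul_hypX_mul_evalYX_mul_mu_eq_zero {a : ℤ} {v : ℕ} (hv : v < p) {g : (ZMod p)[X]}
    (hg : phi p a p ∣ phi p a v * g) :
    hypY k v * hypX k v * (evalYX k p g * mu k p a) = 0 := by
  have hpow : hypY k 1 ^ v * hypX k 1 ^ v * (evalYX k p g * mu k p a) = 0 := by
    rw [← (mu_commute_evalYX k p a g).eq, ← mul_assoc, ← evalYX_phi_mul_mu, mul_assoc,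
      (mu_commute_evalYX k p a g).eq, ← mul_assoc, ← map_mul, evalYX_mul_mu_eq_zero k p hg]
  rw [hypY_pow_mul_hypX_pow, smul_mul_assoc] at hpow
  have hv! := factorial_cast_ne_zero k hv
  exact ((IsUnit.mk0 _ (mul_ne_zero hv! hv!)).smul_eq_zero).1 hpow

theorem frobSplit_commute_evalYX_mul_mu (z : U k) (f : (ZMod p)[X]) (a : ℤ) :
    Commute (frobSplit k p z) (evalYX k p f * mu k p a) :=
  (commute_evalYX p (frobSplit_commute_hypYX k p z) f).mul_right (frobSplit_commute_mu k p a z)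

theorem frobSplit_mul_evalYX (b : ℕ) {g : (ZMod p)[X]} (hg : phi p b p ∣ phi p b (p - b % p) * g)
    (z z' : U k) : frobSplit k p z * frobSplit k p z' * (evalYX k p g * mu k p b) =
      frobSplit k p (z * z') * (evalYX k p g * mu k p b) := by
  refine frobSplit_mul (b := b) ?_ (fun v hv hvp => ?_)
    (fun z => frobSplit_commute_evalYX_mul_mu k p z g b) z z'
  · rw [← mul_assoc, (mu_commute_evalYX k p b g).eq, mul_assoc, mu_mul_self]
  · exact hypY_mul_hypX_mul_evalYX_mul_mu_eq_zero k p hvp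
      (hg.trans (mul_dvd_mul_right (phi_dvd_phi p b hv) g))

end EvalYX

section Twist

variable (k : Type*) [Field k] (p : ℕ) [Fact p.Prime] [CharP k p]

/-- The element `Yˢ Fr'(z) Q(Y X) μ_b Xˢ`. Every `Z^{(ε)}(z; (a, j))` has this form, with `s` the
shift `s(a, j)` under (A) or (C) and `s = 0` otherwise, and `b = a + 2s`. -/
def twist (s b : ℕ) (Q : (ZMod p)[X]) (z : U k) : U k :=
  hypY k 1 ^ s * (frobSplit k p z * (evalYX k p Q * mu k p b)) * hypX k 1 ^ s

theorem twist_congr (a s : ℕ) (hs : s ≤ p) {Q R : (ZMod p)[X]}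
    (h : phi p ((a + 2 * s : ℕ) : ℤ) (p - s) ∣ Q - R) (z : U k) :
    twist k p s (a + 2 * s) Q z = twist k p s (a + 2 * s) R z := by
  have hzero : evalYX k p (Q - R) * mu k p ((a + 2 * s : ℕ) : ℤ) * hypX k 1 ^ s = 0 := by
    obtain ⟨g, hg⟩ := h
    rw [hg, mul_comm, map_mul, mul_assoc (evalYX k p g), evalYX_phi_mul_mu, mul_assoc, mul_assoc,
      Nat.cast_add, Nat.cast_mul, Nat.cast_ofNat, ← hypX_pow_mul_mu, mul_assoc (_ ^ (p - s)),
      ← mul_assoc (_ ^ (p - s)) (_ ^ s), ← pow_add, Nat.sub_add_cancel hs,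
      (isDividedPowerSeq_hypX k).one_pow_char, zero_mul, mul_zero, mul_zero]
  rw [map_sub, sub_mul, sub_mul, sub_eq_zero] at hzero
  simp only [twist, mul_assoc] at hzero ⊢
  rw [hzero]

theorem evalYX_mul_mu_mul_hypX_pow_mul_hypY_pow (a s : ℕ) (Q : (ZMod p)[X]) :
    evalYX k p Q * mu k p ((a + 2 * s : ℕ) : ℤ) * (hypX k 1 ^ s * hypY k 1 ^ s) =
      evalYX k p (taylor ((s : ZMod p) * (s + a + 1)) (phi p a s) * Q) *
        mu k p ((a + 2 * s : ℕ) : ℤ) := by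
  have hcomm : mu k p (a + 2 * s) * (hypX k 1 ^ s * hypY k 1 ^ s) =
      hypX k 1 ^ s * hypY k 1 ^ s * mu k p (a + 2 * s) := by
    rw [← mul_assoc, ← hypX_pow_mul_mu, mul_assoc, ← hypY_pow_mul_mu, mul_assoc]
  have hXY := hypX_pow_mul_hypY_pow_mul_mu k p s a
  push_cast at hXY ⊢
  rw [mul_assoc, hcomm, hXY, ← mul_assoc, ← map_mul, mul_comm Q]

theorem evalYX_mul_mu_mul_evalYX_mul_mu (a : ℤ) (Q R : (ZMod p)[X]) :
    evalYX k p Q * mu k p a * (evalYX k p R * mu k p a) = evalYX k p (Q * R) * mu k p a := by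
  rw [mul_assoc, ← mul_assoc (mu k p a), (mu_commute_evalYX k p a R).eq, mul_assoc, mu_mul_self,
    map_mul, mul_assoc]

theorem twist_mul_twist (a s : ℕ) {Q R : (ZMod p)[X]}
    (h : phi p ((a + 2 * s : ℕ) : ℤ) p ∣ phi p ((a + 2 * s : ℕ) : ℤ) (p - (a + 2 * s) % p) *
      (taylor ((s : ZMod p) * (s + a + 1)) (phi p a s) * Q)) (z z' : U k) :
    twist k p s (a + 2 * s) Q z * twist k p s (a + 2 * s) R z' =
      twist k p s (a + 2 * s) (taylor ((s : ZMod p) * (s + a + 1)) (phi p a s) * Q * R)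
        (z * z') := by
  have hXY := evalYX_mul_mu_mul_hypX_pow_mul_hypY_pow k p a s Q
  set P := taylor ((s : ZMod p) * (s + a + 1)) (phi p a s) * Q
  set μ := mu k p ((a + 2 * s : ℕ) : ℤ) with hμ
  have hz' : Commute (frobSplit k p z') (evalYX k p P * μ) :=
    frobSplit_commute_evalYX_mul_mu k p z' P _
  calc twist k p s (a + 2 * s) Q z * twist k p s (a + 2 * s) R z'
      = hypY k 1 ^ s * (frobSplit k p z * (evalYX k p Q * μ * (hypX k 1 ^ s * hypY k 1 ^ s)) *
          (frobSplit k p z' * (evalYX k p R * μ))) * hypX k 1 ^ s := by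
        simp only [twist, hμ, mul_assoc]
    _ = hypY k 1 ^ s * (frobSplit k p z * frobSplit k p z' * (evalYX k p P * μ) *
          (evalYX k p R * μ)) * hypX k 1 ^ s := by
        rw [hXY, mul_assoc (frobSplit k p z) (frobSplit k p z'), hz'.eq]
        simp only [mul_assoc]
    _ = hypY k 1 ^ s * (frobSplit k p (z * z') * (evalYX k p (P * R) * μ)) * hypX k 1 ^ s := by
        rw [frobSplit_mul_evalYX k p _ h, mul_assoc (frobSplit k p (z * z')),
          evalYX_mul_mu_mul_evalYX_mul_mu]

end Twist

/-! ### The polynomials `ψ` and `φ` -/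

section Taylor

variable {R : Type*} [CommRing R]

theorem taylor_dvd_taylor (r : R) {f g : R[X]} (h : f ∣ g) : taylor r f ∣ taylor r g := by
  obtain ⟨q, rfl⟩ := h
  rw [taylor_mul]
  exact dvd_mul_right _ _

theorem taylor_prod (r : R) {ι : Type*} (t : Finset ι) (f : ι → R[X]) :
    taylor r (∏ i ∈ t, f i) = ∏ i ∈ t, taylor r (f i) :=
  map_prod (taylorAlgHom r) f t

theorem X_sub_C_sq_dvd {c : R} {f : R[X]} (h : f.eval c = 0) (h' : f.derivative.eval c = 0) :
    (X - C c) ^ 2 ∣ f := by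
  have hX : X ^ 2 ∣ taylor c f := X_pow_dvd_iff.2 fun d hd => by
    interval_cases d
    · rwa [taylor_coeff_zero]
    · rwa [taylor_coeff_one]
  have h := taylor_dvd_taylor (-c) hX
  rwa [taylor_X_pow, taylor_taylor, neg_add_cancel, taylor_zero, C_neg, ← sub_eq_add_neg] at h

theorem eval_and_eval_derivative_of_X_pow_sub_one_eq {n : ℕ} {c : R} {v : R[X]}
    (hv : (X ^ n - 1 : R[X]) = (X - C c) * v) :
    c * v.eval c = n ∧ 2 * c * v.derivative.eval c = (n - 1) * v.eval c := by
  have euler : X * derivative (X ^ n - 1 : R[X]) = (n : R[X]) * (X ^ n - 1) + (n : R[X]) := by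
    rcases n with _ | n
    · simp
    · rw [derivative_sub, derivative_X_pow, derivative_one, C_eq_natCast, Nat.add_sub_cancel]
      ring
  rw [hv, derivative_mul] at euler
  have hval := congrArg (eval c) euler
  have hderiv := congrArg (fun f => eval c (derivative f)) euler
  simp only [derivative_mul, derivative_sub, derivative_add, derivative_X, derivative_C,
    derivative_natCast, derivative_one, derivative_zero, eval_sub, eval_mul, eval_add, eval_X,
    eval_C, eval_natCast, eval_one, eval_zero] at hval hderiv
  constructor
  · linear_combination hval
  · linear_combination hderiv

end Taylor

section Psi

variable {p : ℕ} [hp : Fact p.Prime]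

theorem two_ne_zero_of_ne_two (hp2 : p ≠ 2) : (2 : ZMod p) ≠ 0 :=
  Ring.two_ne_zero ((ZMod.ringChar_zmod_n p).substr hp2)

variable (p) in
/-- The product of the `x - i²` over all `i ≠ ± s`, the common factor of `ψ_s^{(0)}` and
`ψ_s^{(1)}`. -/
def psiAway (s : ZMod p) : (ZMod p)[X] := ∏ i ∈ Finset.univ \ {s, -s}, (X - C (i ^ 2))

theorem psiAway_mul_prod (s : ZMod p) :
    psiAway p s * ∏ i ∈ {s, -s}, (X - C (i ^ 2)) = psiFull p :=
  Finset.prod_sdiff (Finset.subset_univ _)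

theorem psiAway_zero_mul_X : psiAway p 0 * X = psiFull p := by
  simpa using psiAway_mul_prod (0 : ZMod p)

theorem psiAway_mul_sq (hp2 : p ≠ 2) {s : ZMod p} (hs : s ≠ 0) :
    psiAway p s * (X - C (s ^ 2)) ^ 2 = psiFull p := by
  rw [← psiAway_mul_prod s,
    Finset.prod_pair (ZMod.ne_neg_self (hp.out.odd_of_ne_two hp2) hs), neg_sq, sq]

theorem psi_of_ne_zero (hp2 : p ≠ 2) {ε : ℕ} (hε : ε ≠ 0) {s : ZMod p} (hs : s ≠ 0) :
    psi p ε s = psiAway p s * (X - C (s ^ 2)) := by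
  rw [psi, if_neg hε, ← psiAway_mul_sq hp2 hs, sq, ← mul_assoc,
    mul_comm, mul_divByMonic_cancel_left _ (monic_X_sub_C _)]

theorem psi_zero {s : ZMod p} (hs : s ≠ 0) :
    psi p 0 s = 2 * (X + C (s ^ 2)) * psiAway p s := by
  have hinsert : (Finset.univ \ {s, -s} : Finset (ZMod p)) =
      insert 0 (Finset.univ \ {0, s, -s}) := by
    ext i
    simp only [Finset.mem_sdiff, Finset.mem_univ, true_and, Finset.mem_insert, Finset.mem_singleton]
    by_cases hi : i = 0
    · simpa [hi, eq_comm] using hs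
    · simp [hi]
  rw [psi, if_pos rfl, if_neg hs, psiAway, hinsert, Finset.prod_insert (by simp),
    zero_pow two_ne_zero, C_0, sub_zero]
  ring

theorem psi_zero_zero : psi p 0 0 = psiAway p 0 := by
  rw [psi, if_pos rfl, if_pos rfl, psiAway, neg_zero, Finset.pair_eq_singleton,
    Finset.sdiff_singleton_eq_erase]

theorem psiAway_dvd_psi (hp2 : p ≠ 2) {ε : ℕ} {s : ZMod p} (h : s = 0 → ε = 0) :
    psiAway p s ∣ psi p ε s := by
  by_cases hs : s = 0
  · rw [h hs, hs, psi_zero_zero]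
  · by_cases hε : ε = 0
    · rw [hε, psi_zero hs]
      exact dvd_mul_left _ _
    · rw [psi_of_ne_zero hp2 hε hs]
      exact dvd_mul_right _ _

theorem prod_X_sub_C_univ : ∏ i : ZMod p, (X - C i) = X ^ p - X := by
  have hroots := FiniteField.roots_X_pow_card_sub_X (ZMod p)
  rw [ZMod.card] at hroots
  have hmonic : (X ^ p - X : (ZMod p)[X]).Monic :=
    monic_X_pow_sub (degree_X_le.trans_lt (by exact_mod_cast hp.out.one_lt))
  have h := prod_multiset_X_sub_C_of_monic_of_roots_card_eq hmonic (by
    rw [hroots, FiniteField.X_pow_card_sub_X_natDegree_eq _ hp.out.one_lt]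
    exact ZMod.card p)
  rwa [hroots] at h

theorem psiFull_eq (hp2 : p ≠ 2) : psiFull p = X * (X ^ ((p - 1) / 2) - 1) ^ 2 := by
  have hodd := Nat.two_mul_div_two_add_one_of_odd (hp.out.odd_of_ne_two hp2)
  have hn : (p - 1) / 2 = p / 2 := by omega
  have hneg : ∏ i : ZMod p, (X + C i) = X ^ p - X := by
    rw [← prod_X_sub_C_univ]
    exact Fintype.prod_equiv (Equiv.neg _) _ _ fun i => by simp
  have hfactor : ∀ i : ZMod p, expand (ZMod p) 2 (X - C (i ^ 2)) = (X - C i) * (X + C i) := by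
    intro i
    rw [map_sub, expand_X, expand_C, C_pow]
    ring
  -- The substitution `x ↦ x²` splits each factor into `(x - i) (x + i)`.
  apply expand_injective (n := 2) two_pos
  rw [psiFull, map_prod]
  simp only [hfactor, Finset.prod_mul_distrib, prod_X_sub_C_univ, hneg, hn]
  simp only [map_mul, map_pow, map_sub, expand_X, map_one]
  have hX : (X ^ p : (ZMod p)[X]) = X ^ (2 * (p / 2) + 1) := by rw [hodd]
  rw [hX]
  ring

theorem psiAway_zero_eq (hp2 : p ≠ 2) : psiAway p 0 = (X ^ ((p - 1) / 2) - 1) ^ 2 :=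
  mul_right_cancel₀ X_ne_zero (by rw [psiAway_zero_mul_X, psiFull_eq hp2, mul_comm])

theorem exists_psiAway_eq (hp2 : p ≠ 2) {s : ZMod p} (hs : s ≠ 0) :
    ∃ v : (ZMod p)[X], (X ^ ((p - 1) / 2) - 1 : (ZMod p)[X]) = (X - C (s ^ 2)) * v ∧
      psiAway p s = X * v ^ 2 := by
  have hodd := Nat.two_mul_div_two_add_one_of_odd (hp.out.odd_of_ne_two hp2)
  have hs2 : (s ^ 2) ^ ((p - 1) / 2) = 1 := by
    rw [← pow_mul, ← ZMod.pow_card_sub_one_eq_one hs]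
    congr 1
    omega
  obtain ⟨v, hv⟩ : X - C (s ^ 2) ∣ (X ^ ((p - 1) / 2) - 1 : (ZMod p)[X]) := by
    rw [dvd_iff_isRoot, IsRoot, eval_sub, eval_pow, eval_X, hs2, eval_one, sub_self]
  refine ⟨v, hv, mul_right_cancel₀ (pow_ne_zero 2 (X_sub_C_ne_zero (s ^ 2))) ?_⟩
  rw [psiAway_mul_sq hp2 hs, psiFull_eq hp2, hv]
  ring

theorem X_sub_C_sq_dvd_psi_zero_sub_one (hp2 : p ≠ 2) {s : ZMod p} (hs : s ≠ 0) :
    (X - C (s ^ 2)) ^ 2 ∣ psi p 0 s - 1 := by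
  obtain ⟨v, hv, hpsi⟩ := exists_psiAway_eq hp2 hs
  have hn : (2 : ZMod p) * ((p - 1) / 2 : ℕ) = -1 := by
    have hodd := Nat.two_mul_div_two_add_one_of_odd (hp.out.odd_of_ne_two hp2)
    have h : 2 * ((p - 1) / 2) + 1 = p := by omega
    have h := congrArg (Nat.cast : ℕ → ZMod p) h
    push_cast [CharP.cast_eq_zero] at h
    linear_combination h
  obtain ⟨hval, hderiv⟩ := eval_and_eval_derivative_of_X_pow_sub_one_eq hv
  rw [psi_zero hs, hpsi]
  set c := s ^ 2
  apply X_sub_C_sq_dvd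
  · simp only [eval_sub, eval_mul, eval_add, eval_X, eval_C, eval_pow, eval_ofNat, eval_one]
    linear_combination (4 * c * eval c v + 4 * ((p - 1) / 2 : ℕ)) * hval +
      (2 * ((p - 1) / 2 : ℕ) - 1) * hn
  · simp only [derivative_mul, derivative_sub, derivative_add, derivative_X, derivative_C,
      derivative_pow, derivative_ofNat, derivative_one, eval_sub, eval_mul, eval_add, eval_X,
      eval_C, eval_pow, eval_ofNat, eval_one, eval_zero, Nat.cast_ofNat,
      Nat.add_one_sub_one, pow_one]
    linear_combination 4 * c * eval c v * hderiv + 2 * c * eval c v ^ 2 * hn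

theorem psiFull_dvd_psi_zero_mul_psi_sub (hp2 : p ≠ 2) {ε : ℕ} {s : ZMod p} (hε : s = 0 → ε = 0) :
    psiFull p ∣ psi p 0 s * psi p ε s - psi p ε s := by
  rw [← sub_one_mul, mul_comm]
  by_cases hs : s = 0
  · have hX : X ∣ psiAway p 0 - 1 := by
      have h0 : (p - 1) / 2 ≠ 0 := by
        have := hp.out.two_le
        omega
      rw [psiAway_zero_eq hp2]
      exact (dvd_pow_self X h0).trans ⟨X ^ ((p - 1) / 2) - 2, by ring⟩
    rw [hε hs, hs, psi_zero_zero, ← psiAway_zero_mul_X]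
    exact mul_dvd_mul_left _ hX
  · rw [← psiAway_mul_sq hp2 hs]
    exact mul_dvd_mul (psiAway_dvd_psi hp2 hε) (X_sub_C_sq_dvd_psi_zero_sub_one hp2 hs)

theorem psiFull_dvd_psi_mul_psi_sub (hp2 : p ≠ 2) {ε ε' : ℕ} {s : ZMod p} (hε : s = 0 → ε = 0)
    (hε' : s = 0 → ε' = 0) (h : ε = 0 ∨ ε' = 0) :
    psiFull p ∣ psi p ε s * psi p ε' s - psi p (ε + ε') s := by
  rcases h with rfl | rfl
  · rw [zero_add]
    exact psiFull_dvd_psi_zero_mul_psi_sub hp2 hε'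
  · rw [add_zero, mul_comm]
    exact psiFull_dvd_psi_zero_mul_psi_sub hp2 hε

theorem psiFull_dvd_psi_mul_psi (hp2 : p ≠ 2) {ε ε' : ℕ} {s : ZMod p} (hs : s ≠ 0)
    (hε : ε ≠ 0) (hε' : ε' ≠ 0) : psiFull p ∣ psi p ε s * psi p ε' s := by
  rw [psi_of_ne_zero hp2 hε hs, psi_of_ne_zero hp2 hε' hs, ← psiAway_mul_sq hp2 hs]
  exact ⟨psiAway p s, by ring⟩

end Psi

section Phi

variable {p : ℕ} [hp : Fact p.Prime]

variable (p) in
/-- The number `((a + 1) / 2)²`, by which the Casimir element `Y X + ((H + 1) / 2)²` differs from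
`Y X` on weight `a`. -/
def casimirShift (a : ℕ) : ZMod p := (((a : ZMod p) + 1) / 2) ^ 2

theorem casimirShift_add_two_mul (hp2 : p ≠ 2) (a s : ℕ) :
    casimirShift p (a + 2 * s) = (s : ZMod p) * (s + a + 1) + casimirShift p a := by
  have h2 := two_ne_zero_of_ne_two hp2
  simp only [casimirShift]
  push_cast
  field_simp
  ring

variable (p) in
theorem injOn_natCast_add {m : ℕ} (hm : m ≤ p) (c : ZMod p) :
    Set.InjOn (fun i : ℕ => (i : ZMod p) + c) (Finset.range m) := by
  intro i hi j hj h
  have h := add_right_cancel h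
  rw [ZMod.natCast_eq_natCast_iff'] at h
  simp only [Finset.coe_range, Set.mem_Iio] at hi hj
  rwa [Nat.mod_eq_of_lt (by omega), Nat.mod_eq_of_lt (by omega)] at h

theorem phi_eq_taylor (hp2 : p ≠ 2) (a : ℕ) {m : ℕ} (hm : m ≤ p) :
    phi p a m = taylor (casimirShift p a)
      (∏ w ∈ (Finset.range m).image (fun i : ℕ => (i : ZMod p) + ((a : ZMod p) + 1) / 2),
        (X - C (w ^ 2))) := by
  have h2 := two_ne_zero_of_ne_two hp2
  rw [Finset.prod_image (injOn_natCast_add p hm _), taylor_prod, phi]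
  refine Finset.prod_congr rfl fun i _ => ?_
  rw [map_sub, taylor_X, taylor_C, add_sub_assoc, ← C_sub, sub_eq_add_neg, ← C_neg, casimirShift]
  congr 2
  push_cast
  field_simp
  ring

theorem phi_self_eq_taylor (hp2 : p ≠ 2) (a : ℕ) :
    phi p a p = taylor (casimirShift p a) (psiFull p) := by
  rw [phi_eq_taylor hp2 a le_rfl, psiFull]
  congr 2
  refine Finset.eq_univ_of_card _ ?_
  rw [Finset.card_image_of_injOn (injOn_natCast_add p le_rfl _), Finset.card_range, ZMod.card]

theorem phi_mul_taylor (a s m : ℕ) :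
    phi p a s * taylor (-((s : ZMod p) * (s + a + 1))) (phi p ((a + 2 * s : ℕ) : ℤ) m) =
      phi p a (s + m) := by
  simp only [phi]
  rw [Finset.prod_range_add, taylor_prod]
  congr 1
  refine Finset.prod_congr rfl fun i _ => ?_
  rw [map_sub, taylor_X, taylor_C, C_neg, ← sub_eq_add_neg, sub_sub, ← C_add]
  congr 2
  push_cast
  ring

theorem phi_dvd_taylor_of_forall_ne (hp2 : p ≠ 2) {a s : ℕ} (hs : s ≤ p) {f : (ZMod p)[X]}
    {j : ZMod p} (hf : psiAway p j ∣ f)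
    (h : ∀ i < s, (i : ZMod p) + ((a : ZMod p) + 1) / 2 ≠ j ∧
      (i : ZMod p) + ((a : ZMod p) + 1) / 2 ≠ -j) :
    phi p a s ∣ taylor (casimirShift p a) f := by
  rw [phi_eq_taylor hp2 a hs]
  refine taylor_dvd_taylor _ (dvd_trans ?_ hf)
  refine Finset.prod_dvd_prod_of_subset _ _ _ fun w hw => ?_
  obtain ⟨i, hi, rfl⟩ := Finset.mem_image.1 hw
  simpa using h i (Finset.mem_range.1 hi)

theorem phi_self_dvd_phi_mul_taylor (hp2 : p ≠ 2) {a m : ℕ} (hm : m ≤ p) {f : (ZMod p)[X]}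
    {j : ZMod p} (hf : psiAway p j ∣ f)
    (h : ∃ i < m, (i : ZMod p) + ((a : ZMod p) + 1) / 2 = j)
    (h' : ∃ i < m, (i : ZMod p) + ((a : ZMod p) + 1) / 2 = -j) :
    phi p a p ∣ phi p a m * taylor (casimirShift p a) f := by
  rw [phi_eq_taylor hp2 a hm, phi_self_eq_taylor hp2 a, ← taylor_mul, ← psiAway_mul_prod j,
    mul_comm (psiAway p j)]
  refine taylor_dvd_taylor _ (mul_dvd_mul (Finset.prod_dvd_prod_of_subset _ _ _ ?_) hf)
  obtain ⟨i, hi, hij⟩ := h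
  obtain ⟨i', hi', hij'⟩ := h'
  rw [Finset.insert_subset_iff, Finset.singleton_subset_iff]
  exact ⟨Finset.mem_image.2 ⟨i, Finset.mem_range.2 hi, hij⟩,
    Finset.mem_image.2 ⟨i', Finset.mem_range.2 hi', hij'⟩⟩

end Phi

section RedPoly

variable {p : ℕ} [hp : Fact p.Prime]

variable (p) in
/-- The polynomial `f` with `B^{(ε)}(a, j) = f(Y X) μ_a`. -/
def redPoly (ε a : ℕ) (j : ℚ) : (ZMod p)[X] :=
  if p = 2 then
    if a = 0 then (if ε = 0 then 1 else X) else (if j = 0 then X else X + 1)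
  else taylor (casimirShift p a) (psi p ε (j : ZMod p))

theorem redPoly_of_ne_two (hp2 : p ≠ 2) (ε a j : ℕ) :
    redPoly p ε a (j : ℚ) = taylor (casimirShift p a) (psi p ε (j : ZMod p)) := by
  rw [redPoly, if_neg hp2, Rat.cast_natCast]

theorem natDegree_redPoly_lt (ε a : ℕ) (j : ℚ) : (redPoly p ε a j).natDegree < p := by
  have hp1 := hp.out.one_lt
  rw [redPoly]
  split_ifs
  · rw [natDegree_one]
    exact hp.out.pos
  · rwa [natDegree_X]
  · rwa [natDegree_X]
  · rwa [← C_1, natDegree_X_add_C]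
  · rw [natDegree_taylor]
    exact (psi_ne_zero_and_natDegree_lt p ‹_› _ _).2

open Classical in
/-- The exponent `s(a, j)` under (A) or (C), and zero otherwise. -/
def twistExp (p a : ℕ) (j : ℚ) : ℕ := if CondA p a j ∨ CondC a j then shiftExp p a else 0

theorem condA_natCast (p a j : ℕ) :
    CondA p a (j : ℚ) ↔ Even a ∧ p + 1 ≤ 2 * j + a ∧ 2 * j + 1 ≤ p := by
  have h1 : ((p : ℚ) - a + 1) / 2 ≤ j ↔ p + 1 ≤ 2 * j + a := by
    rw [div_le_iff₀ two_pos, ← Nat.cast_le (α := ℚ)]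
    push_cast
    constructor <;> intro h <;> linarith
  have h2 : (j : ℚ) ≤ ((p : ℚ) - 1) / 2 ↔ 2 * j + 1 ≤ p := by
    rw [le_div_iff₀ two_pos, ← Nat.cast_le (α := ℚ)]
    push_cast
    constructor <;> intro h <;> linarith
  rw [CondA, h1, h2]

theorem condC_natCast (a j : ℕ) : CondC a (j : ℚ) ↔ Odd a ∧ 2 * j + 1 ≤ a := by
  have h : (j : ℚ) ≤ ((a : ℚ) - 1) / 2 ↔ 2 * j + 1 ≤ a := by
    rw [le_div_iff₀ two_pos, ← Nat.cast_le (α := ℚ)]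
    push_cast
    constructor <;> intro h <;> linarith
  rw [CondC, h, and_iff_right (Nat.cast_nonneg j)]

theorem twistExp_trichotomy (hp2 : p ≠ 2) {a j : ℕ} (ha : a < p) (hj : 2 * j + 1 ≤ p) :
    (a % 2 = 0 ∧ p + 1 ≤ 2 * j + a ∧ a + 2 * twistExp p a j = p + 1) ∨
    (a % 2 = 1 ∧ 2 * j + 1 ≤ a ∧ a + 2 * twistExp p a j = p) ∨
    (twistExp p a j = 0 ∧ (a % 2 = 0 ∧ 2 * j + a ≤ p ∨ a % 2 = 1 ∧ a ≤ 2 * j)) := by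
  have hodd := Nat.odd_iff.1 (hp.out.odd_of_ne_two hp2)
  simp only [twistExp, condA_natCast, condC_natCast, shiftExp, if_neg hp2, Nat.even_iff,
    Nat.odd_iff]
  split_ifs <;> omega

theorem twistExp_le_of_ne_two (hp2 : p ≠ 2) {a j : ℕ} (ha : a < p) (hj : 2 * j + 1 ≤ p) :
    twistExp p a j ≤ p := by
  have := twistExp_trichotomy hp2 ha hj
  omega

theorem natCast_add_half_eq_intCast_iff (hp2 : p ≠ 2) (i a : ℕ) (j : ℤ) :
    (i : ZMod p) + ((a : ZMod p) + 1) / 2 = j ↔ (p : ℤ) ∣ 2 * i + a + 1 - 2 * j := by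
  have h2 := two_ne_zero_of_ne_two hp2
  rw [← ZMod.intCast_zmod_eq_zero_iff_dvd]
  push_cast
  constructor
  · intro h
    rw [← h]
    field_simp
    ring
  · intro h
    field_simp
    linear_combination h

theorem phi_twistExp_dvd_redPoly_of_ne_two (hp2 : p ≠ 2) {ε a j : ℕ} (ha : a < p)
    (hj : 2 * j + 1 ≤ p) (hε : (j : ZMod p) = 0 → ε = 0) :
    phi p a (twistExp p a j) ∣ redPoly p ε a (j : ℚ) := by
  have hodd := Nat.odd_iff.1 (hp.out.odd_of_ne_two hp2)
  have hs := twistExp_trichotomy hp2 ha hj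
  rw [redPoly_of_ne_two hp2]
  refine phi_dvd_taylor_of_forall_ne hp2 (twistExp_le_of_ne_two hp2 ha hj)
    (psiAway_dvd_psi hp2 hε) fun i hi => ⟨fun h => ?_, fun h => ?_⟩
  · have hd := (natCast_add_half_eq_intCast_iff hp2 i a j).1 (by simpa using h)
    have := Int.eq_zero_of_abs_lt_dvd hd (abs_lt.2 ⟨by omega, by omega⟩)
    omega
  · have hd := (natCast_add_half_eq_intCast_iff hp2 i a (-j)).1 (by simpa using h)
    have := Int.eq_zero_of_abs_lt_dvd (dvd_sub_self_right.2 hd) (abs_lt.2 ⟨by omega, by omega⟩)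
    omega

theorem phi_self_dvd_phi_mul_taylor_psi (hp2 : p ≠ 2) {ε b j : ℕ} (hε : (j : ZMod p) = 0 → ε = 0)
    (h : ∃ i < p - b % p, (p : ℤ) ∣ 2 * (i : ℤ) + b + 1 - 2 * j)
    (h' : ∃ i < p - b % p, (p : ℤ) ∣ 2 * (i : ℤ) + b + 1 - 2 * (-j)) :
    phi p b p ∣ phi p b (p - b % p) * taylor (casimirShift p b) (psi p ε (j : ZMod p)) := by
  obtain ⟨i, hi, h⟩ := h
  obtain ⟨i', hi', h'⟩ := h'
  rw [← natCast_add_half_eq_intCast_iff hp2] at h h'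
  push_cast at h h'
  exact phi_self_dvd_phi_mul_taylor hp2 (Nat.sub_le _ _) (psiAway_dvd_psi hp2 hε) ⟨i, hi, h⟩
    ⟨i', hi', h'⟩

theorem phi_self_dvd_phi_mul_taylor_redPoly_of_ne_two (hp2 : p ≠ 2) {ε a j : ℕ} (ha : a < p)
    (hj : 2 * j + 1 ≤ p) (hε : (j : ZMod p) = 0 → ε = 0) {s : ℕ} (hs : s = twistExp p a j) :
    phi p ((a + 2 * s : ℕ) : ℤ) p ∣ phi p ((a + 2 * s : ℕ) : ℤ) (p - (a + 2 * s) % p) *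
      taylor ((s : ZMod p) * (s + a + 1)) (redPoly p ε a (j : ℚ)) := by
  have hodd := Nat.odd_iff.1 (hp.out.odd_of_ne_two hp2)
  rw [redPoly_of_ne_two hp2, taylor_taylor, ← casimirShift_add_two_mul hp2]
  have hcases := twistExp_trichotomy hp2 ha hj
  rw [← hs] at hcases
  rcases hcases with ⟨-, hja, hb⟩ | ⟨-, -, hb⟩ | ⟨h0, heven | hodd'⟩
  · have hmod : (p + 1) % p = 1 := by
      rw [Nat.add_mod_left, Nat.mod_eq_of_lt hp.out.one_lt]
    rw [hb]
    exact phi_self_dvd_phi_mul_taylor_psi hp2 hε ⟨j - 1, by omega, 1, by omega⟩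
      ⟨p - 1 - j, by omega, 3, by omega⟩
  · rw [hb, Nat.mod_self, Nat.sub_zero]
    exact dvd_mul_right _ _
  · have hmod := Nat.mod_eq_of_lt ha
    rw [h0, mul_zero, add_zero]
    exact phi_self_dvd_phi_mul_taylor_psi hp2 hε
      ⟨(2 * j + p - a - 1) / 2, by omega, 1, by omega⟩
      ⟨(p - a - 1 - 2 * j) / 2, by omega, 1, by omega⟩
  · have hmod := Nat.mod_eq_of_lt ha
    rw [h0, mul_zero, add_zero]
    exact phi_self_dvd_phi_mul_taylor_psi hp2 hε ⟨(2 * j - a - 1) / 2, by omega, 0, by omega⟩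
      ⟨(2 * p - 2 * j - a - 1) / 2, by omega, 2, by omega⟩

end RedPoly

section Admissible

variable {p ε ε' a : ℕ} {j : ℚ}

/-- The condition that `(a, j) ∈ 𝒫` and `ε` is allowed at `(a, j)`, so that `ε ∈ 𝒳_r(a, j)` says
that all entries are admissible and lie in `{0, 1}`. -/
def IsAdmissible (p ε a : ℕ) (j : ℚ) : Prop :=
  (a, j) ∈ labels p ∧ ((if p = 2 then a = 1 else j = 0) → ε = 0)

theorem isAdmissible_two :
    IsAdmissible 2 ε a j ↔ a = 0 ∧ j = 1 / 2 ∨ ε = 0 ∧ a = 1 ∧ (j = 0 ∨ j = 1) := by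
  simp only [IsAdmissible, labels, if_true, Set.mem_insert_iff, Set.mem_singleton_iff,
    Prod.mk.injEq]
  constructor
  · rintro ⟨h | h | h, hε⟩
    · exact Or.inl h
    · exact Or.inr ⟨hε h.1, h.1, Or.inl h.2⟩
    · exact Or.inr ⟨hε h.1, h.1, Or.inr h.2⟩
  · rintro (⟨rfl, rfl⟩ | ⟨rfl, rfl, rfl | rfl⟩) <;> simp

theorem IsAdmissible.add (h : IsAdmissible p ε a j) (h' : IsAdmissible p ε' a j) :
    IsAdmissible p (ε + ε') a j :=
  ⟨h.1, fun h0 => by rw [h.2 h0, h'.2 h0]⟩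

variable [hp : Fact p.Prime]

theorem IsAdmissible.exists_natCast (h : IsAdmissible p ε a j) (hp2 : p ≠ 2) :
    ∃ i : ℕ, j = i ∧ a < p ∧ 2 * i + 1 ≤ p ∧ ((i : ZMod p) = 0 → ε = 0) := by
  obtain ⟨hl, hε⟩ := h
  rw [labels, if_neg hp2] at hl
  obtain ⟨ha, i, hi, rfl⟩ := hl
  rw [if_neg hp2, Nat.cast_eq_zero] at hε
  have := hp.out.two_le
  refine ⟨i, rfl, ha, by omega, fun h => hε ?_⟩
  exact Nat.eq_zero_of_dvd_of_lt ((ZMod.natCast_eq_zero_iff _ _).1 h) (by omega)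

theorem phi_one (a : ℤ) : phi p a 1 = X := by
  rw [phi, Finset.prod_range_one, Nat.cast_zero, zero_mul, C_0, sub_zero]

theorem phi_two (a : ℤ) : phi p a 2 = X * (X - C ((a : ZMod p) + 2)) := by
  rw [phi, Finset.prod_range_succ, Finset.prod_range_one]
  push_cast
  rw [zero_mul, C_0, sub_zero, one_mul, add_right_comm, one_add_one_eq_two, add_comm (2 : ZMod p)]

theorem phi_two_two_of_odd {a : ℕ} (ha : Odd a) : phi 2 a 2 = X * (X + 1) := by
  rw [phi_two, Int.cast_natCast, ZMod.natCast_eq_one_iff_odd.2 ha,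
    CharTwo.two_eq_zero (R := ZMod 2), add_zero, C_1, CharTwo.sub_eq_add]

theorem twistExp_two_zero : twistExp 2 0 (1 / 2) = 0 := by
  rw [twistExp, if_neg]
  rintro (⟨-, h, -⟩ | ⟨h, -⟩)
  · norm_num at h
  · exact Nat.not_odd_zero h

theorem twistExp_two_one_zero : twistExp 2 1 0 = 1 := by
  rw [twistExp, if_pos, shiftExp, if_pos rfl]
  exact Or.inr ⟨odd_one, le_rfl, by norm_num⟩

theorem twistExp_two_one_one : twistExp 2 1 1 = 0 := by
  rw [twistExp, if_neg]
  rintro (⟨h, -⟩ | ⟨-, -, h⟩)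
  · exact Nat.not_even_one h
  · norm_num at h

theorem redPoly_two_one_zero : redPoly 2 ε 1 0 = X := by
  rw [redPoly, if_pos rfl, if_neg one_ne_zero, if_pos rfl]

theorem redPoly_two_one_one : redPoly 2 ε 1 1 = X + 1 := by
  rw [redPoly, if_pos rfl, if_neg one_ne_zero, if_neg one_ne_zero]

theorem IsAdmissible.twistExp_le (h : IsAdmissible p ε a j) : twistExp p a j ≤ p := by
  by_cases hp2 : p = 2
  · subst hp2
    obtain ⟨rfl, rfl⟩ | ⟨rfl, rfl, rfl | rfl⟩ := isAdmissible_two.1 h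
    · exact twistExp_two_zero.trans_le zero_le_two
    · exact twistExp_two_one_zero.trans_le one_le_two
    · exact twistExp_two_one_one.trans_le zero_le_two
  · obtain ⟨i, rfl, ha, hi, -⟩ := h.exists_natCast hp2
    exact twistExp_le_of_ne_two hp2 ha hi

theorem IsAdmissible.phi_twistExp_dvd_redPoly (h : IsAdmissible p ε a j) :
    phi p a (twistExp p a j) ∣ redPoly p ε a j := by
  by_cases hp2 : p = 2
  · subst hp2
    obtain ⟨rfl, rfl⟩ | ⟨rfl, rfl, rfl | rfl⟩ := isAdmissible_two.1 h
    · rw [twistExp_two_zero, phi, Finset.prod_range_zero]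
      exact one_dvd _
    · rw [twistExp_two_one_zero, phi_one, redPoly_two_one_zero]
    · rw [twistExp_two_one_one, phi, Finset.prod_range_zero]
      exact one_dvd _
  · obtain ⟨i, rfl, ha, hi, hε⟩ := h.exists_natCast hp2
    exact phi_twistExp_dvd_redPoly_of_ne_two hp2 ha hi hε

theorem IsAdmissible.twistExp_le_lowIdx (h : IsAdmissible p ε a j) :
    twistExp p a j ≤ lowIdx p ε a j := by
  have hdvd := h.phi_twistExp_dvd_redPoly
  by_cases hp2 : p = 2
  · subst hp2
    obtain ⟨rfl, rfl⟩ | ⟨rfl, rfl, rfl | rfl⟩ := isAdmissible_two.1 h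
    · exact twistExp_two_zero.trans_le (Nat.zero_le _)
    · rw [twistExp_two_one_zero, lowIdx, if_pos rfl, if_neg one_ne_zero, if_pos rfl]
    · exact twistExp_two_one_one.trans_le (Nat.zero_le _)
  · rw [redPoly, if_neg hp2, taylor_apply] at hdvd
    rw [lowIdx, if_neg hp2]
    refine le_csSup ⟨p, fun n hn => ?_⟩ hdvd
    obtain ⟨hne, hdeg⟩ := psi_ne_zero_and_natDegree_lt p hp2 ε (j : ZMod p)
    have hn' : phi p a n ∣ taylor ((((a : ZMod p) + 1) / 2) ^ 2) (psi p ε (j : ZMod p)) := hn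
    have hle := natDegree_le_of_dvd hn' ((taylor_injective _).ne_iff' (map_zero _) |>.2 hne)
    rw [natDegree_phi, natDegree_taylor] at hle
    exact hle.trans hdeg.le

theorem IsAdmissible.phi_self_dvd_phi_mul_taylor_redPoly (h : IsAdmissible p ε a j) {s : ℕ}
    (hs : s = twistExp p a j) :
    phi p ((a + 2 * s : ℕ) : ℤ) p ∣ phi p ((a + 2 * s : ℕ) : ℤ) (p - (a + 2 * s) % p) *
      taylor ((s : ZMod p) * (s + a + 1)) (redPoly p ε a j) := by
  by_cases hp2 : p = 2
  · subst hp2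
    obtain ⟨rfl, rfl⟩ | ⟨rfl, rfl, rfl | rfl⟩ := isAdmissible_two.1 h
    · rw [hs, twistExp_two_zero]
      exact dvd_mul_right _ _
    · have h3 : ((1 : ℕ) : ZMod 2) * ((1 : ℕ) + (1 : ℕ) + 1) = 1 := rfl
      rw [hs, twistExp_two_one_zero, phi_two_two_of_odd (by decide), h3, redPoly_two_one_zero,
        taylor_X, C_1, phi_one]
    · rw [hs, twistExp_two_one_one, Nat.cast_zero, zero_mul, taylor_zero, redPoly_two_one_one,
        phi_two_two_of_odd (by decide), phi_one]
  · obtain ⟨i, rfl, ha, hi, hε⟩ := h.exists_natCast hp2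
    exact phi_self_dvd_phi_mul_taylor_redPoly_of_ne_two hp2 ha hi hε hs

theorem IsAdmissible.phi_self_dvd_redPoly_mul_redPoly_sub (h : IsAdmissible p ε a j)
    (h' : IsAdmissible p ε' a j) (h0 : ε = 0 ∨ ε' = 0) :
    phi p a p ∣ redPoly p ε a j * redPoly p ε' a j - redPoly p (ε + ε') a j := by
  by_cases hp2 : p = 2
  · subst hp2
    obtain ⟨rfl, rfl⟩ | ⟨rfl, rfl, rfl | rfl⟩ := isAdmissible_two.1 h
    · convert dvd_zero _
      rcases h0 with rfl | rfl <;> simp [redPoly]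
    · rw [phi_two_two_of_odd odd_one]
      refine dvd_of_eq ?_
      simp only [redPoly_two_one_zero]
      linear_combination X * CharTwo.two_eq_zero (R := (ZMod 2)[X])
    · rw [phi_two_two_of_odd odd_one]
      refine dvd_of_eq ?_
      simp only [redPoly_two_one_one]
      ring
  · obtain ⟨i, rfl, -, -, hε⟩ := h.exists_natCast hp2
    obtain ⟨i', hi', -, -, hε'⟩ := h'.exists_natCast hp2
    rw [Nat.cast_inj] at hi'
    subst hi'
    simp only [redPoly_of_ne_two hp2, ← taylor_mul, ← map_sub]
    rw [phi_self_eq_taylor hp2]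
    exact taylor_dvd_taylor _ (psiFull_dvd_psi_mul_psi_sub hp2 hε hε' h0)

theorem IsAdmissible.phi_self_dvd_redPoly_mul_redPoly (h : IsAdmissible p ε a j) (h0 : ε ≠ 0)
    (h0' : ε' ≠ 0) : phi p a p ∣ redPoly p ε a j * redPoly p ε' a j := by
  by_cases hp2 : p = 2
  · subst hp2
    obtain ⟨rfl, rfl⟩ | ⟨hε, -⟩ := isAdmissible_two.1 h
    · refine dvd_of_eq ?_
      simp only [phi_two, redPoly, if_true, if_neg h0, if_neg h0', Nat.cast_zero, Int.cast_zero,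
        CharTwo.two_eq_zero, add_zero, C_0, sub_zero]
    · exact absurd hε h0
  · obtain ⟨i, rfl, -, -, hε⟩ := h.exists_natCast hp2
    simp only [redPoly_of_ne_two hp2, ← taylor_mul]
    rw [phi_self_eq_taylor hp2]
    exact taylor_dvd_taylor _ (psiFull_dvd_psi_mul_psi hp2 (fun h => h0 (hε h)) h0 h0')

end Admissible

/-! ### Products of the elements `Z` and `B` -/

section Products

variable {p : ℕ} [hp : Fact p.Prime] (k : Type*) [Field k] [CharP k p]

theorem B₁_eq_evalYX (ε a : ℕ) (j : ℚ) :
    B₁ p k ε a j = evalYX k p (redPoly p ε a j) * mu k p a := by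
  rw [B₁, redPoly]
  by_cases hp2 : p = 2
  · have hcomm : mu k p a * hypY k 1 * hypX k 1 = hypYX k * mu k p a := by
      rw [mul_assoc]
      exact (commute_mu_hypYX p k a).eq
    rw [if_pos hp2, if_pos hp2]
    split_ifs
    · rw [map_one, one_mul]
    · rw [evalYX_X, hcomm]
    · rw [evalYX_X, hcomm]
    · rw [map_add, map_one, evalYX_X, hcomm, add_mul, one_mul]
  · have hshift : ofPrime p k (casimirShift p a) = (((a : k) + 1) / 2) ^ 2 := by
      rw [casimirShift, map_pow, map_div₀, map_add, map_natCast, map_one, map_ofNat]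
    rw [if_neg hp2, if_neg hp2, aeval_mul_mu p k hp2, evalYX_apply, taylor_apply,
      Polynomial.map_comp, Polynomial.map_add, map_X, map_C, hshift]

theorem sum_coeffB_mul_phi (ε a : ℕ) (j : ℚ) :
    ∑ m ∈ Finset.Icc (lowIdx p ε a j) (p - 1), C (coeffB p k ε a j m) * phi p a m =
      redPoly p ε a j := by
  have hpos := hp.out.pos
  rw [← sub_eq_zero]
  refine eq_zero_of_evalYX_mul_mu k p (a := a) ?_ ?_
  · refine (natDegree_sub_le _ _).trans_lt (max_lt ?_ (natDegree_redPoly_lt ε a j))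
    refine (natDegree_sum_le_of_forall_le (n := p - 1) _ _ fun m hm => ?_).trans_lt (by omega)
    refine (natDegree_C_mul_le _ _).trans ?_
    rw [natDegree_phi]
    exact (Finset.mem_Icc.1 hm).2
  · rw [map_sub, sub_mul, ← B₁_eq_evalYX, B₁_eq_sum, map_sum, Finset.sum_mul, Finset.mul_sum,
      sub_eq_zero]
    refine Finset.sum_congr rfl fun m _ => ?_
    rw [evalYX_C_mul, smul_mul_assoc, evalYX_phi_mul_mu, ← (commute_mu_pow p k a m).eq,
      mul_smul_comm]

theorem Z_eq_sum (ε a : ℕ) (j : ℚ) (z : U k) :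
    Z p k ε a j z = ∑ m ∈ Finset.Icc (lowIdx p ε a j) (p - 1), ofPrime p k (coeffB p k ε a j m) •
      (mu k p a * (hypY k 1 ^ m * hypX k 1 ^ (m - twistExp p a j) * frobSplit k p z *
        hypX k 1 ^ twistExp p a j)) := by
  rw [Z, twistExp]
  split_ifs
  · simp only [Finset.mul_sum, mul_smul_comm]
  · rw [B₁_eq_evalYX, (frobSplit_commute_evalYX_mul_mu k p z _ a).eq, ← B₁_eq_evalYX, B₁_eq_sum,
      mul_assoc, Finset.sum_mul, Finset.mul_sum]
    simp only [Nat.sub_zero, pow_zero, mul_one, smul_mul_assoc, mul_smul_comm]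

variable {k} in
theorem IsAdmissible.Z_one {ε a : ℕ} {j : ℚ} (h : IsAdmissible p ε a j) :
    Z p k ε a j 1 = B₁ p k ε a j := by
  rw [Z_eq_sum, B₁_eq_sum, Finset.mul_sum]
  refine Finset.sum_congr rfl fun m hm => ?_
  have hm : twistExp p a j ≤ m := h.twistExp_le_lowIdx.trans (Finset.mem_Icc.1 hm).1
  rw [frobSplit_one, mul_one, mul_assoc (_ ^ m), ← pow_add, Nat.sub_add_cancel hm, mul_smul_comm]

theorem twist_sum_C_mul (s b : ℕ) {ι : Type*} (t : Finset ι) (c : ι → ZMod p) (f : ι → (ZMod p)[X])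
    (z : U k) : twist k p s b (∑ i ∈ t, C (c i) * f i) z =
      ∑ i ∈ t, ofPrime p k (c i) • twist k p s b (f i) z := by
  simp only [twist, map_sum, evalYX_C_mul, Finset.sum_mul, Finset.mul_sum, smul_mul_assoc,
    mul_smul_comm]

theorem twist_phi (a s d : ℕ) (z : U k) :
    twist k p s (a + 2 * s) (phi p ((a + 2 * s : ℕ) : ℤ) d) z =
      mu k p a * (hypY k 1 ^ (s + d) * hypX k 1 ^ d * frobSplit k p z * hypX k 1 ^ s) := by
  have hμ : mu k p ((a + 2 * s : ℕ) : ℤ) = mu k p ((a : ℤ) + 2 * s) := by push_cast; rfl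
  rw [twist, (frobSplit_commute_evalYX_mul_mu k p z _ _).eq, evalYX_phi_mul_mu,
    ← (commute_mu_pow p k _ d).eq, hμ, pow_add]
  simp only [← mul_assoc]
  rw [hypY_pow_mul_mu]

variable {ε ε' a : ℕ} {j : ℚ}

variable {k} in
theorem IsAdmissible.Z_eq_twist (h : IsAdmissible p ε a j) {s : ℕ} (hs : s = twistExp p a j)
    {q : (ZMod p)[X]} (hq : redPoly p ε a j = phi p a s * q) (z : U k) :
    Z p k ε a j z = twist k p s (a + 2 * s) (taylor ((s : ZMod p) * (s + a + 1)) q) z := by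
  have hle {m : ℕ} (hm : m ∈ Finset.Icc (lowIdx p ε a j) (p - 1)) : s ≤ m :=
    hs ▸ h.twistExp_le_lowIdx.trans (Finset.mem_Icc.1 hm).1
  have hsum : taylor ((s : ZMod p) * (s + a + 1)) q = ∑ m ∈ Finset.Icc (lowIdx p ε a j) (p - 1),
      C (coeffB p k ε a j m) * phi p ((a + 2 * s : ℕ) : ℤ) (m - s) := by
    apply taylor_injective (-((s : ZMod p) * (s + a + 1)))
    apply mul_left_cancel₀ (monic_phi p a s).ne_zero
    rw [taylor_taylor, neg_add_cancel, taylor_zero, ← hq, ← sum_coeffB_mul_phi k, map_sum,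
      Finset.mul_sum]
    refine Finset.sum_congr rfl fun m hm => ?_
    rw [taylor_mul, taylor_C, mul_left_comm, phi_mul_taylor, Nat.add_sub_cancel' (hle hm)]
  rw [hsum, twist_sum_C_mul, Z_eq_sum, ← hs]
  refine Finset.sum_congr rfl fun m hm => ?_
  rw [twist_phi, Nat.add_sub_cancel' (hle hm)]

variable {k} in
theorem IsAdmissible.Z_mul_Z_eq_twist (h : IsAdmissible p ε a j) (h' : IsAdmissible p ε' a j)
    {s : ℕ} (hs : s = twistExp p a j) {q : (ZMod p)[X]}
    (hq : phi p a p ∣ redPoly p ε a j * redPoly p ε' a j - phi p a s * q) (z z' : U k) :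
    Z p k ε a j z * Z p k ε' a j z' =
      twist k p s (a + 2 * s) (taylor ((s : ZMod p) * (s + a + 1)) q) (z * z') := by
  obtain ⟨f, hf⟩ := hs ▸ h.phi_twistExp_dvd_redPoly
  obtain ⟨f', hf'⟩ := hs ▸ h'.phi_twistExp_dvd_redPoly
  have hsp : s ≤ p := hs ▸ h.twistExp_le
  have hdvd := h.phi_self_dvd_phi_mul_taylor_redPoly hs
  rw [hf, taylor_mul] at hdvd
  rw [h.Z_eq_twist hs hf, h'.Z_eq_twist hs hf', twist_mul_twist k p a s hdvd]
  refine twist_congr k p a s hsp ?_ _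
  have hcancel : taylor (-((s : ZMod p) * (s + a + 1))) (phi p ((a + 2 * s : ℕ) : ℤ) (p - s)) ∣
      phi p a s * f * f' - q := by
    rw [← mul_dvd_mul_iff_left (monic_phi p a s).ne_zero, phi_mul_taylor, Nat.add_sub_cancel' hsp,
      mul_sub]
    rw [hf, hf'] at hq
    convert hq using 2
    ring
  have hshift := taylor_dvd_taylor ((s : ZMod p) * (s + a + 1)) hcancel
  rwa [taylor_taylor, add_neg_cancel, taylor_zero, map_sub, taylor_mul, taylor_mul] at hshift

variable {k} in
theorem IsAdmissible.Z_mul_Z (h : IsAdmissible p ε a j) (h' : IsAdmissible p ε' a j)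
    (h0 : ε = 0 ∨ ε' = 0) (z z' : U k) :
    Z p k ε a j z * Z p k ε' a j z' = Z p k (ε + ε') a j (z * z') := by
  obtain ⟨q, hq⟩ := (h.add h').phi_twistExp_dvd_redPoly
  rw [(h.add h').Z_eq_twist rfl hq]
  exact h.Z_mul_Z_eq_twist h' rfl (hq ▸ h.phi_self_dvd_redPoly_mul_redPoly_sub h' h0) z z'

variable {k} in
theorem IsAdmissible.Z_mul_Z_eq_zero (h : IsAdmissible p ε a j) (h' : IsAdmissible p ε' a j)
    (h0 : ε ≠ 0) (h0' : ε' ≠ 0) (z z' : U k) : Z p k ε a j z * Z p k ε' a j z' = 0 := by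
  have hdvd := h.phi_self_dvd_redPoly_mul_redPoly h0 h0'
  rw [← sub_zero (_ * _), ← mul_zero (phi p a (twistExp p a j))] at hdvd
  rw [h.Z_mul_Z_eq_twist h' rfl hdvd, twist, map_zero, map_zero, zero_mul, mul_zero, mul_zero,
    zero_mul]

theorem Z_zero (ε a : ℕ) (j : ℚ) : Z p k ε a j 0 = 0 := by
  simp only [Z_eq_sum, map_zero, mul_zero, zero_mul, smul_zero, Finset.sum_const_zero]

end Products

section Tuples

variable {p r : ℕ}

theorem add_mem_XSet {ε ε' : Fin r → ℕ} {l : Fin r → ℕ × ℚ} (hε : ε ∈ XSet p l)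
    (hε' : ε' ∈ XSet p l) (h : ¬ ∃ s, ε s = 1 ∧ ε' s = 1) : ε + ε' ∈ XSet p l := by
  refine ⟨fun i => ?_, fun i hi => by rw [Pi.add_apply, hε.2 i hi, hε'.2 i hi]⟩
  have hi := hε.1 i
  have hi' := hε'.1 i
  have hne : ¬ (ε i = 1 ∧ ε' i = 1) := fun hs => h ⟨i, hs⟩
  rw [Pi.add_apply]
  omega

variable {ε ε' : Fin (r + 1) → ℕ} {l : Fin (r + 1) → ℕ × ℚ}

theorem tail_mem_XSet (hε : ε ∈ XSet p l) : Fin.tail ε ∈ XSet p (Fin.tail l) :=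
  ⟨fun i => hε.1 i.succ, fun i => hε.2 i.succ⟩

theorem isAdmissible_of_mem_XSet (hl : ∀ i, l i ∈ labels p) (hε : ε ∈ XSet p l) (i : Fin (r + 1)) :
    IsAdmissible p (ε i) (l i).1 (l i).2 :=
  ⟨hl i, hε.2 i⟩

variable [hp : Fact p.Prime] (k : Type*) [Field k] [CharP k p]

theorem B_succ (hl : ∀ i, l i ∈ labels p) (hε : ε ∈ XSet p l) :
    B p k (r + 1) ε l = Z p k (ε 0) (l 0).1 (l 0).2 (B p k r (Fin.tail ε) (Fin.tail l)) := by
  cases r with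
  | zero => exact (isAdmissible_of_mem_XSet hl hε 0).Z_one.symm
  | succ r => rfl

theorem B_mul_B_eq_zero {r : ℕ} {ε ε' : Fin r → ℕ} {l : Fin r → ℕ × ℚ} (hl : ∀ i, l i ∈ labels p)
    (hε : ε ∈ XSet p l) (hε' : ε' ∈ XSet p l) (h : ∃ s, ε s = 1 ∧ ε' s = 1) :
    B p k r ε l * B p k r ε' l = 0 := by
  obtain ⟨s, hs, hs'⟩ := h
  induction r with
  | zero => exact s.elim0
  | succ r ih =>
    have h₀ := isAdmissible_of_mem_XSet hl hε 0
    have h₀' := isAdmissible_of_mem_XSet hl hε' 0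
    rw [B_succ k hl hε, B_succ k hl hε']
    by_cases h0 : ε 0 = 0 ∨ ε' 0 = 0
    · obtain rfl | ⟨t, rfl⟩ := Fin.eq_zero_or_eq_succ s
      · omega
      · rw [h₀.Z_mul_Z h₀' h0, ih (l := Fin.tail l) (fun i => hl i.succ) (tail_mem_XSet hε)
          (tail_mem_XSet hε') t hs hs', Z_zero]
    · rw [not_or] at h0
      exact h₀.Z_mul_Z_eq_zero h₀' h0.1 h0.2 _ _

theorem B_mul_B {r : ℕ} {ε ε' : Fin r → ℕ} {l : Fin r → ℕ × ℚ} (hl : ∀ i, l i ∈ labels p)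
    (hε : ε ∈ XSet p l) (hε' : ε' ∈ XSet p l) (h : ¬ ∃ s, ε s = 1 ∧ ε' s = 1) :
    B p k r ε l * B p k r ε' l = B p k r (ε + ε') l := by
  induction r with
  | zero => exact mul_one _
  | succ r ih =>
    have h0 : ε 0 = 0 ∨ ε' 0 = 0 := by
      have hne : ¬ (ε 0 = 1 ∧ ε' 0 = 1) := fun hs => h ⟨0, hs⟩
      have := hε.1 0
      have := hε'.1 0
      omega
    rw [B_succ k hl hε, B_succ k hl hε', B_succ k hl (add_mem_XSet hε hε' h),
      (isAdmissible_of_mem_XSet hl hε 0).Z_mul_Z (isAdmissible_of_mem_XSet hl hε' 0) h0,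
      ih (l := Fin.tail l) (fun i => hl i.succ) (tail_mem_XSet hε) (tail_mem_XSet hε')
        fun ⟨t, ht⟩ => h ⟨t.succ, ht⟩]
    rfl

end Tuples

end Hyperalgebra

end

theorem lemma3p9_general (p : ℕ) [Fact p.Prime] (k : Type*) [Field k] [CharP k p]
    (r : ℕ) (l : Fin r → ℕ × ℚ) (hl : ∀ i, l i ∈ Hyperalgebra.labels p)
    (ε ε' : Fin r → ℕ) (hε : ε ∈ Hyperalgebra.XSet p l) (hε' : ε' ∈ Hyperalgebra.XSet p l) :
    ((∃ s, ε s = 1 ∧ ε' s = 1) →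
      Hyperalgebra.B p k r ε l * Hyperalgebra.B p k r ε' l = 0) ∧
    ((¬ ∃ s, ε s = 1 ∧ ε' s = 1) →
      Hyperalgebra.B p k r ε l * Hyperalgebra.B p k r ε' l = Hyperalgebra.B p k r (ε + ε') l ∧
      ε + ε' ∈ Hyperalgebra.XSet p l) :=
  ⟨fun h => Hyperalgebra.B_mul_B_eq_zero k hl hε hε' h, fun h =>
    ⟨Hyperalgebra.B_mul_B k hl hε hε' h, Hyperalgebra.add_mem_XSet hε hε' h⟩⟩

theorem lemma3p9 (p : ℕ) [Fact p.Prime] (k : Type*) [Field k] [IsAlgClosed k] [CharP k p]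
    (r : ℕ) (hr : 0 < r) (l : Fin r → ℕ × ℚ) (hl : ∀ i, l i ∈ Hyperalgebra.labels p)
    (ε ε' : Fin r → ℕ) (hε : ε ∈ Hyperalgebra.XSet p l) (hε' : ε' ∈ Hyperalgebra.XSet p l) :
    ((∃ s, ε s = 1 ∧ ε' s = 1) →
      Hyperalgebra.B p k r ε l * Hyperalgebra.B p k r ε' l = 0) ∧
    ((¬ ∃ s, ε s = 1 ∧ ε' s = 1) →
      Hyperalgebra.B p k r ε l * Hyperalgebra.B p k r ε' l = Hyperalgebra.B p k r (ε + ε') l ∧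
      ε + ε' ∈ Hyperalgebra.XSet p l) :=
  lemma3p9_general p k r l hl ε ε' hε hε'
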